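/- **Theorem 3.2 (a variant of the H-measure).** Let $(\Omega,\mathcal F,\mathbf P)$ be a probability space, $T>0$, $d,m\in\mathbb N$, and let $u_n=u_n(\omega,t,x,\lambda):\Omega\times(0,T)\times\mathbb R^d\times\mathbb R^m\to\mathbb R$ be measurable functions such that * $\sup_n\|u_n\|_{L^\infty(\Omega\times(0,T)\times\mathbb R^d\times\mathbb R^m)}<\infty$; * $u_n\to0$ in $L^2_t\bigl(L^2_w(\mathbb R^d\times\mathbb R^m)\bigr)$ almost surely, that is, $u_n(\omega,\cdot)\in L^2((0,T)\times\mathbb R^d\times\mathbb R^m)$ for a.e. $\omega$, and for every $f\in L^2(\mathbb R^d\times\mathbb R^m)$ one has $\bigl\|\int u_n(\omega,\cdot,x,\lambda)f(x,\lambda)\,dx\,d\lambda\bigr\|_{L^2(0,T)}\to0$ for a.e. $\omega$; * there is a compact $K\subset\mathbb R^d$ such that $u_n(\omega,t,x,\lambda)=0$ for $x\notin K$, for all $n$ and a.e. $(\omega,t,x,\lambda)$. Let $\mathbb S^d$ be the unit sphere of $\mathbb R^{d+1}$, write $\xi=(\xi_0,\xi')\in\mathbb R\times\mathbb R^d$,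 let $\mathcal F_x,\mathcal F_t$ be the Fourier transforms with kernel $e^{-2\pi i\,\cdot}$ in $x$ and $t$ (functions on $(0,T)$ being extended by $0$), and let $L^2_c$ be the space of all $\Phi=\Phi(x,p,q)\in L^2(\mathbb R^d\times\mathbb R^m\times\mathbb R^m;\mathbb C)$ that vanish for $(p,q)$ outside some compact set. Then there are a subsequence (not relabeled), which does not depend on the test functions below, and a deterministic, time-independent trilinear functional $$\mu:\;L^1_{\xi_0}(\mathbb R)\times L^2_c\times C(\mathbb S^d)\to\mathbb C$$ (complex-valued function spaces) with the following properties. 1. For every compact $B\subset\mathbb R^m\times\mathbb R^m$ there is $C_B$ with $|\mu(\phi,\Phi,\psi)|\le C_B\|\phi\|_{L^1}\|\Phi\|_{L^2}\|\psi\|_{C(\mathbb S^d)}$ for all $\phi\in L^1(\mathbb R)$, all $\psi\in C(\mathbb S^d)$ and all $\Phi\in L^2_c$ that vanish for $(p,q)\notin B$. 2. For all $\phi\in L^1(\mathbb R)$, all $\phi_1\in L^r(\mathbb R^d\times\mathbb R^m)$ with $r>2$ such that $\phi_1(x,p)$ vanishes for $p$ outside a compact set, all $\phi_2\in C_c(\mathbb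 R^d\times\mathbb R^m)$ and all $\psi\in C^d(\mathbb S^d)$, the function $\Phi(x,p,q)=\phi_1(x,p)\overline{\phi_2(x,q)}$ belongs to $L^2_c$, the integrands below are integrable over $\Omega\times\mathbb R^{2m+d+1}$ for every $n$, and $$\mu(\phi,\Phi,\psi)=\lim_{n\to\infty}E\Bigl[\int_{\mathbb R^{2m+d+1}}\psi\Bigl(\frac{\xi}{|\xi|}\Bigr)\phi(\xi_0)\,\mathcal F_t\Bigl(\mathcal F_x\bigl(\phi_1(\cdot,p)u_n(\cdot,\cdot,\cdot,p)\bigr)\,\overline{\mathcal F_x\bigl(\phi_2(\cdot,q)u_n(\cdot,\cdot,\cdot,q)\bigr)}\Bigr)(\xi)\,d\xi\,dp\,dq\Bigr].$$ 3. If moreover $\sup_n\operatorname{ess\,sup}_{(\omega,t,x)}\|u_n(\omega,t,x,\cdot)\|_{L^2(\mathbb R^m)}<\infty$ (for instance, if all $u_n$ vanish for $\lambda$ outside a fixed compact set), then $\mu$ extends to a trilinear functional on $L^1(\mathbb R)\times L^2(\mathbb R^d\times\mathbb R^m\times\mathbb R^m)\times C(\mathbb S^d)$ that is bounded with respect to the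 norms of these three spaces. -/

import Mathlib

open MeasureTheory Filter Set Topology
open scoped ENNReal NNReal FourierTransform Manifold

noncomputable section

namespace HMeas

/-- The Euclidean space of dimension `k`. -/
abbrev Euc (k : ℕ) : Type := EuclideanSpace ℝ (Fin k)

/-- The unit sphere of dimension `d`, in Euclidean space of dimension `d + 1`. -/
abbrev Sph (d : ℕ) : Type := Metric.sphere (0 : Euc (d + 1)) 1

/-- Lebesgue measure on the time interval `(0, T)`. -/
def timeMeasure (T : ℝ) : Measure ℝ := volume.restrict (Ioo 0 T)

/-- The product measure on `Ω × (0, T) × ℝ^d × ℝ^m`; points are written `(ω, t, x, l)`. -/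
def fullMeasure {Ω : Type*} [MeasurableSpace Ω] (P : Measure Ω) (T : ℝ) (d m : ℕ) :
    Measure (Ω × ℝ × Euc d × Euc m) :=
  P.prod ((timeMeasure T).prod volume)

/-- Almost sure convergence to `0` in `L²(0, T; L²(ℝ^d × ℝ^m)_w)`, strong in time and weak in
`(x, l)`: almost surely `u n` is in `L²((0, T) × ℝ^d × ℝ^m)`, and for every `f` in
`L²(ℝ^d × ℝ^m)` the functions `t ↦ ∫ u n (ω, t, x, l) f (x, l) d(x, l)` tend to `0` in
`L²(0, T)` almost surely. -/
def TendstoZeroStrongWeak {Ω : Type*} [MeasurableSpace Ω] (P : Measure Ω) (T : ℝ) {d m : ℕ}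
    (u : ℕ → Ω × ℝ × Euc d × Euc m → ℝ) : Prop :=
  (∀ n, ∀ᵐ ω ∂P, MemLp (fun y : ℝ × Euc d × Euc m => u n (ω, y)) 2
      ((timeMeasure T).prod volume)) ∧
  ∀ f : Euc d × Euc m → ℝ, MemLp f 2 volume → ∀ᵐ ω ∂P,
    Tendsto (fun n => eLpNorm (fun t : ℝ => ∫ y : Euc d × Euc m, u n (ω, t, y) * f y) 2
      (timeMeasure T)) atTop (𝓝 0)

/-- The frequency vector `(ξ₀, ξ')` in Euclidean space of dimension `d + 1`. -/
def freq {d : ℕ} (ξ₀ : ℝ) (ξ' : Euc d) : Euc (d + 1) :=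
  WithLp.toLp 2 (Fin.cons ξ₀ (fun i => ξ' i) : Fin (d + 1) → ℝ)

/-- The function `ξ ↦ ψ (ξ / |ξ|)`, set to `0` at the origin (a null set). -/
def homExt {d : ℕ} (ψ : Sph d → ℂ) (ξ : Euc (d + 1)) : ℂ :=
  open scoped Classical in
  if h : ‖ξ‖⁻¹ • ξ ∈ Metric.sphere (0 : Euc (d + 1)) 1 then ψ ⟨‖ξ‖⁻¹ • ξ, h⟩ else 0

/-- The spatial Fourier transform of `φ(·, l) v(ω, t, ·, l)` at the frequency `ξ'`. -/
def spaceFourier {Ω : Type*} {d m : ℕ} (φ : Euc d × Euc m → ℂ)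
    (v : Ω × ℝ × Euc d × Euc m → ℝ) (ω : Ω) (l : Euc m) (t : ℝ) (ξ' : Euc d) : ℂ :=
  𝓕 (fun x : Euc d => φ (x, l) * (v (ω, t, x, l) : ℂ)) ξ'

/-- The temporal Fourier transform at `ξ₀` of
`t ↦ F_x(φ₁(·, p) v(ω, t, ·, p))(ξ') * conj (F_x(φ₂(·, q) v(ω, t, ·, q))(ξ'))` on `(0, T)`,
extended by zero to the real line. -/
def crossFourier {Ω : Type*} (T : ℝ) {d m : ℕ} (φ₁ φ₂ : Euc d × Euc m → ℂ)
    (v : Ω × ℝ × Euc d × Euc m → ℝ) (ω : Ω) (p q : Euc m) (ξ₀ : ℝ) (ξ' : Euc d) : ℂ :=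
  𝓕 ((Ioo 0 T).indicator (fun t : ℝ =>
    spaceFourier φ₁ v ω p t ξ' * (starRingEnd ℂ) (spaceFourier φ₂ v ω q t ξ'))) ξ₀

/-- The integrand `ψ(ξ/|ξ|) φ(ξ₀) F_t(F_x(φ₁ v(p)) conj F_x(φ₂ v(q)))(ξ₀, ξ')` at `ω` and at
the point `z = (p, q, ξ₀, ξ')`. -/
def integrand {Ω : Type*} (T : ℝ) {d m : ℕ} (φ : ℝ → ℂ) (φ₁ φ₂ : Euc d × Euc m → ℂ)
    (ψ : Sph d → ℂ) (v : Ω × ℝ × Euc d × Euc m → ℝ) (ω : Ω)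
    (z : Euc m × Euc m × ℝ × Euc d) : ℂ :=
  homExt ψ (freq z.2.2.1 z.2.2.2) * φ z.2.2.1 *
    crossFourier T φ₁ φ₂ v ω z.1 z.2.1 z.2.2.1 z.2.2.2

/-- `L¹(ℝ)`, in the variable `ξ₀`. -/
abbrev L1 : Type := Lp ℂ 1 (volume : Measure ℝ)

/-- `L²(ℝ^d × ℝ^m × ℝ^m)`, in the variables `(x, p, q)`. -/
abbrev L2 (d m : ℕ) : Type := Lp ℂ 2 (volume : Measure (Euc d × Euc m × Euc m))

/-- `Φ(x, p, q)` vanishes for almost every `(x, p, q)` with `(p, q)` outside `B`. -/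
def VanishesOff {d m : ℕ} (B : Set (Euc m × Euc m)) (Φ : L2 d m) : Prop :=
  ∀ᵐ z : Euc d × Euc m × Euc m, z.2 ∉ B → Φ z = 0

/-- The subspace of `L²(ℝ^d × ℝ^m × ℝ^m)` of the classes that vanish for `(p, q)` outside
some compact set. -/
def L2c (d m : ℕ) : Submodule ℂ (L2 d m) where
  carrier := {Φ | ∃ B : Set (Euc m × Euc m), IsCompact B ∧ VanishesOff B Φ}
  zero_mem' := ⟨∅, isCompact_empty, by
    filter_upwards [Lp.coeFn_zero ℂ 2 (volume : Measure (Euc d × Euc m × Euc m))] with z hz _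
    simpa using hz⟩
  add_mem' := by
    rintro Φ Ψ ⟨B, hB, hΦ⟩ ⟨B', hB', hΨ⟩
    refine ⟨B ∪ B', hB.union hB', ?_⟩
    filter_upwards [hΦ, hΨ, Lp.coeFn_add Φ Ψ] with z h1 h2 h3 hz
    rw [h3, Pi.add_apply, h1 (fun h => hz (Or.inl h)), h2 (fun h => hz (Or.inr h)), add_zero]
  smul_mem' := by
    rintro c Φ ⟨B, hB, hΦ⟩
    refine ⟨B, hB, ?_⟩
    filter_upwards [hΦ, Lp.coeFn_smul c Φ] with z h1 h2 hz
    rw [h2, Pi.smul_apply, h1 hz, smul_zero]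

end HMeas

end

set_option linter.unusedSectionVars false

noncomputable section

/-! The limit expression carries its two test functions inside two different Fourier transforms. In
this form it is visible neither that it depends on them only through `Φ = φ₁ ⊗ conj φ₂`, nor that it
is bounded by the `L²` norm of `Φ`. Both become clear once `φ₂` is moved from the second transform
into the first. What results is `locForm`, the integral of `ψ(ξ/|ξ|) φ(ξ₀) e^{-2πi t ξ₀} F_x(∫ Φ(·,
p, q) u(p) dp) conj F_x(u(q))`, which is linear in `Φ`. Cauchy-Schwarz and Plancherel in `x` bound
it by `C ‖φ‖ ‖Φ‖ ‖ψ‖` as soon as `u` is bounded in `L²` with respect to `l`, uniformly in `(ω, t,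
x)` (`norm_locForm_le`). For `l` in a compact set this follows from the `L^∞` bound. The transform
in time is merely written out: its phase has modulus one, and integrability in `ξ₀` comes from `φ`.

The error of the move tends to `0` (`tendsto_commForm`); this is a commutator lemma. Multiplication
by a character of `x`-frequency `η` translates `ξ'` by `η`, so for characters the error is a form
whose symbol is the difference of `ψ(ξ/|ξ|)` and its translate by `(0, η)`. This difference is small
for large `|ξ'|`, uniformly in `ξ₀` (`symb_slowly_varying`). For `|ξ'| ≤ R`, weak convergence in
`(x, l)` and strong convergence in `t` make the transform of the slice integral tend to `0` in `L²`
(`tendsto_eLpNorm_lowPass`). Stone-Weierstrass passes from characters to continuous multipliers on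
the compact set of `(x, l)` that matters.

For existence, `l` is restricted to balls of radius `j`. The three function spaces are separable, so
one subsequence makes the forms of all balls converge for all arguments
(`exists_subseq_tendsto_trilinear`). The functional itself is a limit along an ultrafilter. On `L2c`
every `Φ` is seen entirely by some ball, so there the ultralimit is an ordinary limit. Under the
additional bound in `l` the form without restriction is bounded on all of `L²`, and its ultralimit
along the same subsequence is the extension. -/

namespace HMeas

/-! ### Plancherel's identity for the Fourier integral. -/

section Plancherel

variable {E : Type*} [NormedAddCommGroup E] [InnerProductSpace ℝ E] [FiniteDimensional ℝ E]
  [MeasurableSpace E] [BorelSpace E]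

/-- On `L¹ ∩ L²`, the Fourier integral is the Fourier transform in `L²`. -/
theorem fourier_toLp_ae_eq {f : E → ℂ} (h1 : Integrable f) (h2 : MemLp f 2 volume) :
    ((𝓕 (h2.toLp f) : Lp ℂ 2 (volume : Measure E)) : E → ℂ) =ᵐ[volume] 𝓕 f := by
  have hcont : Continuous (𝓕 f) :=
    VectorFourier.fourierIntegral_continuous Real.continuous_fourierChar
      (by exact continuous_inner) h1
  have hloc : LocallyIntegrable ((𝓕 (h2.toLp f) : Lp ℂ 2 (volume : Measure E)) : E → ℂ) :=
    (Lp.memLp _).locallyIntegrable (by norm_num)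
  -- Both sides are locally integrable, so testing against smooth compactly supported `g` suffices.
  -- Such a `g` is a Schwartz function, and each of the two transforms can be moved onto it: the one
  -- in `L²` through tempered distributions, the integral through Fubini.
  refine ae_eq_of_integral_contDiff_smul_eq hloc hcont.locallyIntegrable fun g hg hgs => ?_
  have hgc : HasCompactSupport (fun x => (g x : ℂ)) := hgs.comp_left (g := Complex.ofReal) rfl
  have hgd : ContDiff ℝ ((⊤ : ℕ∞) : WithTop ℕ∞) (fun x => (g x : ℂ)) :=
    Complex.ofRealCLM.contDiff.comp hg
  set G : SchwartzMap E ℂ := hgc.toSchwartzMap hgd with hG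
  have hGx : ∀ x, G x = (g x : ℂ) := fun x => rfl
  have key := congrArg (fun D : TemperedDistribution E ℂ => D G)
    (Lp.fourier_toTemperedDistribution_eq (h2.toLp f))
  simp only [TemperedDistribution.fourier_apply] at key
  rw [Lp.toTemperedDistribution_apply, Lp.toTemperedDistribution_apply] at key
  have e1 : ∫ x, g x • ((𝓕 (h2.toLp f) : Lp ℂ 2 (volume : Measure E)) : E → ℂ) x
      = ∫ x, G x • ((𝓕 (h2.toLp f) : Lp ℂ 2 (volume : Measure E)) : E → ℂ) x := by
    simp [hGx]
  have e2 : ∫ x, (𝓕 G) x • (h2.toLp f) x = ∫ x, (𝓕 (G : E → ℂ)) x • f x := by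
    refine integral_congr_ae ?_
    filter_upwards [h2.coeFn_toLp] with x hx
    rw [hx, SchwartzMap.fourier_coe]
  have e3 : ∫ x, (𝓕 (G : E → ℂ)) x • f x = ∫ x, G x • 𝓕 f x := by
    have := VectorFourier.integral_fourierIntegral_smul_eq_flip (L := innerₗ E)
      (μ := volume) (ν := volume) (f := (G : E → ℂ)) (g := f)
      Real.continuous_fourierChar continuous_inner G.integrable h1
    simpa [flip_innerₗ] using! this
  rw [e1, ← key, e2, e3]
  simp [hGx]

theorem eLpNorm_fourier {f : E → ℂ} (h1 : Integrable f) (h2 : MemLp f 2 volume) :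
    eLpNorm (𝓕 f) 2 volume = eLpNorm f 2 volume := by
  rw [← eLpNorm_congr_ae (fourier_toLp_ae_eq h1 h2), ← eLpNorm_congr_ae h2.coeFn_toLp,
    ← Lp.enorm_def, ← Lp.enorm_def, ← ofReal_norm, ← ofReal_norm, Lp.norm_fourier_eq]

end Plancherel

theorem eLpNorm_two_sq {α F : Type*} [MeasurableSpace α] [NormedAddCommGroup F] (μ : Measure α)
    (f : α → F) : eLpNorm f 2 μ ^ 2 = ∫⁻ a, ‖f a‖ₑ ^ 2 ∂μ := by
  have := eLpNorm_nnreal_pow_eq_lintegral (p := 2) (f := f) (μ := μ) (by norm_num)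
  simpa using this

theorem eLpNorm_two_le_of_sq_le {α F : Type*} [MeasurableSpace α] [NormedAddCommGroup F]
    {μ : Measure α} {f : α → F} {c : ℝ≥0∞} (h : ∫⁻ a, ‖f a‖ₑ ^ 2 ∂μ ≤ c ^ 2) :
    eLpNorm f 2 μ ≤ c := by
  rw [← eLpNorm_two_sq] at h
  exact (ENNReal.pow_le_pow_left_iff (by norm_num)).1 h

/-- The Cauchy-Schwarz inequality for `ℝ≥0∞`-valued functions, squared. -/
theorem sq_lintegral_mul_le {α : Type*} [MeasurableSpace α] {μ : Measure α} {f g : α → ℝ≥0∞}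
    (hf : AEMeasurable f μ) (hg : AEMeasurable g μ) :
    (∫⁻ a, f a * g a ∂μ) ^ 2 ≤ (∫⁻ a, f a ^ 2 ∂μ) * ∫⁻ a, g a ^ 2 ∂μ := by
  have h := ENNReal.lintegral_mul_le_Lp_mul_Lq μ Real.HolderConjugate.two_two hf hg
  have h2 := pow_le_pow_left' h 2
  simp only [Pi.mul_apply, ENNReal.rpow_ofNat] at h2
  refine h2.trans (le_of_eq ?_)
  rw [mul_pow, ← ENNReal.rpow_natCast, ← ENNReal.rpow_mul, ← ENNReal.rpow_natCast,
    ← ENNReal.rpow_mul]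
  norm_num

/-! ### The Fourier transform in `x` with parameters. -/

section ParametricFourier

variable {A : Type*} [MeasurableSpace A] {d : ℕ}

/-- The Fourier transform in the last variable. -/
def pF (F : A × Euc d → ℂ) (z : A × Euc d) : ℂ := 𝓕 (fun x => F (z.1, x)) z.2

theorem stronglyMeasurable_pF {F : A × Euc d → ℂ} (hF : StronglyMeasurable F) :
    StronglyMeasurable (pF F) := by
  have h1 : Continuous fun p : Euc d × Euc d => (Real.fourierChar (-inner ℝ p.2 p.1) : ℂ) :=
    continuous_subtype_val.comp (Real.continuous_fourierChar.comp (by fun_prop))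
  have h2 : StronglyMeasurable fun y : (A × Euc d) × Euc d =>
      Real.fourierChar (-inner ℝ y.2 y.1.2) • F (y.1.1, y.2) := by
    refine StronglyMeasurable.smul
      (h1.stronglyMeasurable.comp_measurable (g := fun y : (A × Euc d) × Euc d => (y.1.2, y.2))
        (by fun_prop)) ?_
    exact hF.comp_measurable (by fun_prop)
  have h3 := h2.integral_prod_right' (ν := (volume : Measure (Euc d)))
  have : pF F = fun z : A × Euc d => ∫ v : Euc d,
      Real.fourierChar (-inner ℝ v z.2) • F (z.1, v) := by
    funext z
    simp only [pF, Real.fourier_eq]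
  rw [this]
  exact h3

/-- Plancherel on almost every fibre. Almost every fibre is in `L²`, and its compact support makes
it integrable, so that the Fourier integral is the `L²` transform. -/
theorem lintegral_pF_sq {α : Measure A} [SFinite α] {F : A × Euc d → ℂ}
    (hF : StronglyMeasurable F) {K : Set (Euc d)} (hK : IsCompact K)
    (hFK : ∀ a x, x ∉ K → F (a, x) = 0) (h2 : MemLp F 2 (α.prod volume)) :
    ∫⁻ z, ‖pF F z‖ₑ ^ 2 ∂(α.prod volume) = ∫⁻ z, ‖F z‖ₑ ^ 2 ∂(α.prod volume) := by
  have m1 : Measurable fun z => ‖pF F z‖ₑ ^ 2 := (stronglyMeasurable_pF hF).enorm.pow_const 2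
  have m2 : Measurable fun z => ‖F z‖ₑ ^ 2 := hF.enorm.pow_const 2
  rw [lintegral_prod _ m1.aemeasurable, lintegral_prod _ m2.aemeasurable]
  have hfin : ∫⁻ a, (∫⁻ x : Euc d, ‖F (a, x)‖ₑ ^ 2) ∂α ≠ ∞ := by
    have := h2.eLpNorm_lt_top
    rw [← lintegral_prod _ m2.aemeasurable, ← eLpNorm_two_sq]
    exact (ENNReal.pow_lt_top this).ne
  refine lintegral_congr_ae ?_
  filter_upwards [ae_lt_top (m2.lintegral_prod_right') hfin] with a ha
  have hmeas : StronglyMeasurable fun x => F (a, x) := hF.comp_measurable (by fun_prop)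
  have hL2 : MemLp (fun x => F (a, x)) 2 volume := by
    refine ⟨hmeas.aestronglyMeasurable, ?_⟩
    rw [← eLpNorm_two_sq] at ha
    by_contra h
    rw [not_lt_top_iff.1 h] at ha
    simp at ha
  have hL1 : Integrable (fun x => F (a, x)) volume := by
    have : IsFiniteMeasure (volume.restrict K) := ⟨by simpa using hK.measure_lt_top⟩
    have h3 : IntegrableOn (fun x => F (a, x)) K volume := (hL2.restrict K).integrable (by norm_num)
    rwa [integrableOn_iff_integrable_of_support_subset] at h3
    intro x hx
    by_contra hxK
    exact hx (hFK a x hxK)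
  have h4 := congrArg (· ^ 2) (eLpNorm_fourier hL1 hL2)
  simp only [eLpNorm_two_sq] at h4
  exact h4

theorem eLpNorm_pF {α : Measure A} [SFinite α] {F : A × Euc d → ℂ}
    (hF : StronglyMeasurable F) {K : Set (Euc d)} (hK : IsCompact K)
    (hFK : ∀ a x, x ∉ K → F (a, x) = 0) (h2 : MemLp F 2 (α.prod volume)) :
    eLpNorm (pF F) 2 (α.prod volume) = eLpNorm F 2 (α.prod volume) := by
  refine le_antisymm (eLpNorm_two_le_of_sq_le ?_) (eLpNorm_two_le_of_sq_le ?_)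
  · rw [lintegral_pF_sq hF hK hFK h2, eLpNorm_two_sq]
  · rw [← lintegral_pF_sq hF hK hFK h2, eLpNorm_two_sq]

theorem memLp_pF {α : Measure A} [SFinite α] {F : A × Euc d → ℂ}
    (hF : StronglyMeasurable F) {K : Set (Euc d)} (hK : IsCompact K)
    (hFK : ∀ a x, x ∉ K → F (a, x) = 0) (h2 : MemLp F 2 (α.prod volume)) :
    MemLp (pF F) 2 (α.prod volume) :=
  ⟨(stronglyMeasurable_pF hF).aestronglyMeasurable, by
    rw [eLpNorm_pF hF hK hFK h2]; exact h2.eLpNorm_lt_top⟩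

end ParametricFourier

/-! ### Sesquilinear forms with a bounded symbol. -/

section SesquilinearForm

variable {A : Type*} [MeasurableSpace A] {d : ℕ}

/-- The integrand of the sesquilinear form with symbol `b(ξ₀, ξ') φ(ξ₀) θ(a, ξ₀)`. -/
def formFun (b : ℝ × Euc d → ℂ) (θ : A × ℝ → ℂ) (φ : ℝ → ℂ) (X Y : A × Euc d → ℂ)
    (y : ℝ × A × Euc d) : ℂ :=
  b (y.1, y.2.2) * φ y.1 * θ (y.2.1, y.1) * (X y.2 * (starRingEnd ℂ) (Y y.2))

/-- The sesquilinear form with symbol `b(ξ₀, ξ') φ(ξ₀) θ(a, ξ₀)`. -/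
def form (α : Measure A) (b : ℝ × Euc d → ℂ) (θ : A × ℝ → ℂ) (φ : ℝ → ℂ)
    (X Y : A × Euc d → ℂ) : ℂ :=
  ∫ y, formFun b θ φ X Y y ∂((volume : Measure ℝ).prod (α.prod volume))

variable {α : Measure A} {b : ℝ × Euc d → ℂ} {θ : A × ℝ → ℂ} {C : ℝ}

theorem integrable_mul_conj {B : Type*} [MeasurableSpace B] {β : Measure B} {X Y : B → ℂ}
    (hX : MemLp X 2 β) (hY : MemLp Y 2 β) :
    Integrable (fun z => X z * (starRingEnd ℂ) (Y z)) β :=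
  MemLp.integrable_mul hX (hY.star)

theorem integrable_formFun (hb : StronglyMeasurable b) (hbC : ∀ z, ‖b z‖ ≤ C)
    (hθ : StronglyMeasurable θ) (hθ1 : ∀ z, ‖θ z‖ ≤ 1) {φ : ℝ → ℂ} (hφ : Integrable φ)
    {X Y : A × Euc d → ℂ} (hX : MemLp X 2 (α.prod volume)) (hY : MemLp Y 2 (α.prod volume)) :
    Integrable (formFun b θ φ X Y) ((volume : Measure ℝ).prod (α.prod volume)) := by
  have h1 := hφ.mul_prod (integrable_mul_conj hX hY)
  have hm : StronglyMeasurable fun y : ℝ × A × Euc d => b (y.1, y.2.2) * θ (y.2.1, y.1) :=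
    (hb.comp_measurable (by fun_prop)).mul (hθ.comp_measurable (by fun_prop))
  have h2 := h1.bdd_mul (c := C) hm.aestronglyMeasurable (Eventually.of_forall fun y => by
    rw [norm_mul]
    calc _ ≤ C * 1 :=
          mul_le_mul (hbC _) (hθ1 _) (norm_nonneg _) ((norm_nonneg _).trans (hbC (y.1, y.2.2)))
      _ = C := mul_one C)
  refine h2.congr (Eventually.of_forall fun y => ?_)
  simp only [formFun]
  ring

/-- The symbol and `θ` enter only through their sup norms. After that `ξ₀` separates from `(a, ξ')`:
the first variable gives the `L¹` norm of `φ`, and Cauchy-Schwarz in the second gives the two `L²`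
norms. -/
theorem enorm_form_le [SFinite α] (hbC : ∀ z, ‖b z‖ ≤ C) (hθ1 : ∀ z, ‖θ z‖ ≤ 1) {φ : ℝ → ℂ}
    (hφ : AEStronglyMeasurable φ volume) {X Y : A × Euc d → ℂ}
    (hX : AEStronglyMeasurable X (α.prod volume)) (hY : AEStronglyMeasurable Y (α.prod volume)) :
    ‖form α b θ φ X Y‖ₑ ≤ ENNReal.ofReal C * eLpNorm φ 1 volume *
      (eLpNorm X 2 (α.prod volume) * eLpNorm Y 2 (α.prod volume)) := by
  have hXY : AEStronglyMeasurable (fun z => X z * (starRingEnd ℂ) (Y z)) (α.prod volume) :=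
    hX.mul hY.star
  calc ‖form α b θ φ X Y‖ₑ
      ≤ ∫⁻ y, ‖formFun b θ φ X Y y‖ₑ ∂((volume : Measure ℝ).prod (α.prod volume)) :=
        enorm_integral_le_lintegral_enorm _
    _ ≤ ∫⁻ y, ENNReal.ofReal C * (‖φ y.1‖ₑ * ‖X y.2 * (starRingEnd ℂ) (Y y.2)‖ₑ)
          ∂((volume : Measure ℝ).prod (α.prod volume)) := by
        refine lintegral_mono fun y => ?_
        simp only [formFun, enorm_mul]
        have h1 : ‖b (y.1, y.2.2)‖ₑ ≤ ENNReal.ofReal C := by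
          rw [← ofReal_norm]; exact ENNReal.ofReal_le_ofReal (hbC _)
        have h2 : ‖θ (y.2.1, y.1)‖ₑ ≤ 1 := by
          rw [← ofReal_norm, ← ENNReal.ofReal_one]; exact ENNReal.ofReal_le_ofReal (hθ1 _)
        calc _ ≤ ENNReal.ofReal C * ‖φ y.1‖ₑ * 1 * (‖X y.2‖ₑ * ‖(starRingEnd ℂ) (Y y.2)‖ₑ) := by
              gcongr
          _ = _ := by ring
    _ = ENNReal.ofReal C * (eLpNorm φ 1 volume *
          ∫⁻ z, ‖X z * (starRingEnd ℂ) (Y z)‖ₑ ∂(α.prod volume)) := by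
        rw [lintegral_const_mul' _ _ ENNReal.ofReal_ne_top,
          lintegral_prod_mul hφ.enorm hXY.enorm, eLpNorm_one_eq_lintegral_enorm]
    _ ≤ _ := by
        rw [mul_assoc]
        gcongr
        rw [← eLpNorm_one_eq_lintegral_enorm]
        have := eLpNorm_le_eLpNorm_mul_eLpNorm_of_nnnorm (p := 2) (q := 2) (r := 1) hX hY
          (fun x y : ℂ => x * (starRingEnd ℂ) y) 1 (Eventually.of_forall fun z => by simp)
        simpa using this

/-- Only the products are compared, because a discrepancy in one factor is harmless where the other
factor vanishes; the cutoff arguments below rely on this. -/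
theorem form_congr [SFinite α] {φ φ' : ℝ → ℂ} {X X' Y Y' : A × Euc d → ℂ} (hφ : φ =ᵐ[volume] φ')
    (h : ∀ᵐ z ∂(α.prod volume), X z * (starRingEnd ℂ) (Y z) = X' z * (starRingEnd ℂ) (Y' z)) :
    form α b θ φ X Y = form α b θ φ' X' Y' := by
  refine integral_congr_ae ?_
  have h1 := (Measure.quasiMeasurePreserving_fst (μ := (volume : Measure ℝ))
    (ν := α.prod (volume : Measure (Euc d)))).ae hφ
  have h2 := (Measure.quasiMeasurePreserving_snd (μ := (volume : Measure ℝ))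
    (ν := α.prod (volume : Measure (Euc d)))).ae h
  filter_upwards [h1, h2] with y e1 e2
  simp only [formFun, e1, e2]

theorem form_add_left (hb : StronglyMeasurable b) (hbC : ∀ z, ‖b z‖ ≤ C)
    (hθ : StronglyMeasurable θ) (hθ1 : ∀ z, ‖θ z‖ ≤ 1) {φ : ℝ → ℂ} (hφ : Integrable φ)
    {X X' Y : A × Euc d → ℂ}
    (hX : MemLp X 2 (α.prod volume)) (hX' : MemLp X' 2 (α.prod volume))
    (hY : MemLp Y 2 (α.prod volume)) :
    form α b θ φ (fun z => X z + X' z) Y = form α b θ φ X Y + form α b θ φ X' Y := by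
  rw [form, form, form, ← integral_add (integrable_formFun hb hbC hθ hθ1 hφ hX hY)
    (integrable_formFun hb hbC hθ hθ1 hφ hX' hY)]
  congr 1
  funext y
  simp only [formFun]
  ring

theorem form_add_right (hb : StronglyMeasurable b) (hbC : ∀ z, ‖b z‖ ≤ C)
    (hθ : StronglyMeasurable θ) (hθ1 : ∀ z, ‖θ z‖ ≤ 1) {φ : ℝ → ℂ} (hφ : Integrable φ)
    {X Y Y' : A × Euc d → ℂ}
    (hX : MemLp X 2 (α.prod volume)) (hY : MemLp Y 2 (α.prod volume))
    (hY' : MemLp Y' 2 (α.prod volume)) :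
    form α b θ φ X (fun z => Y z + Y' z) = form α b θ φ X Y + form α b θ φ X Y' := by
  rw [form, form, form, ← integral_add (integrable_formFun hb hbC hθ hθ1 hφ hX hY)
    (integrable_formFun hb hbC hθ hθ1 hφ hX hY')]
  congr 1
  funext y
  simp only [formFun, map_add]
  ring

theorem form_add_fun (hb : StronglyMeasurable b) (hbC : ∀ z, ‖b z‖ ≤ C)
    (hθ : StronglyMeasurable θ) (hθ1 : ∀ z, ‖θ z‖ ≤ 1) {φ φ' : ℝ → ℂ} (hφ : Integrable φ)
    (hφ' : Integrable φ')
    {X Y : A × Euc d → ℂ} (hX : MemLp X 2 (α.prod volume)) (hY : MemLp Y 2 (α.prod volume)) :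
    form α b θ (fun t => φ t + φ' t) X Y = form α b θ φ X Y + form α b θ φ' X Y := by
  rw [form, form, form, ← integral_add (integrable_formFun hb hbC hθ hθ1 hφ hX hY)
    (integrable_formFun hb hbC hθ hθ1 hφ' hX hY)]
  congr 1
  funext y
  simp only [formFun]
  ring

theorem form_add_symbol (hb : StronglyMeasurable b) (hbC : ∀ z, ‖b z‖ ≤ C)
    (hθ : StronglyMeasurable θ) (hθ1 : ∀ z, ‖θ z‖ ≤ 1) {b' : ℝ × Euc d → ℂ} {C' : ℝ}
    (hb' : StronglyMeasurable b')
    (hbC' : ∀ z, ‖b' z‖ ≤ C') {φ : ℝ → ℂ} (hφ : Integrable φ)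
    {X Y : A × Euc d → ℂ} (hX : MemLp X 2 (α.prod volume)) (hY : MemLp Y 2 (α.prod volume)) :
    form α (fun z => b z + b' z) θ φ X Y = form α b θ φ X Y + form α b' θ φ X Y := by
  rw [form, form, form, ← integral_add (integrable_formFun hb hbC hθ hθ1 hφ hX hY)
    (integrable_formFun hb' hbC' hθ hθ1 hφ hX hY)]
  congr 1
  funext y
  simp only [formFun]
  ring

theorem form_smul_left (c : ℂ) (φ : ℝ → ℂ) (X Y : A × Euc d → ℂ) :
    form α b θ φ (fun z => c * X z) Y = c * form α b θ φ X Y := by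
  rw [form, form, ← integral_const_mul]
  congr 1; funext y; simp only [formFun]; ring

theorem form_smul_fun (c : ℂ) (φ : ℝ → ℂ) (X Y : A × Euc d → ℂ) :
    form α b θ (fun t => c * φ t) X Y = c * form α b θ φ X Y := by
  rw [form, form, ← integral_const_mul]
  congr 1; funext y; simp only [formFun]; ring

theorem form_smul_symbol (c : ℂ) (φ : ℝ → ℂ) (X Y : A × Euc d → ℂ) :
    form α (fun z => c * b z) θ φ X Y = c * form α b θ φ X Y := by
  rw [form, form, ← integral_const_mul]
  congr 1; funext y; simp only [formFun]; ring

end SesquilinearForm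

/-! ### The symbol `ψ(ξ/|ξ|)` and its slow variation. -/

section Symbol

variable {d : ℕ}

/-- The symbol `ψ(ξ/|ξ|)` as a function of `(ξ₀, ξ')`. -/
def symb (ψ : C(Sph d, ℂ)) (z : ℝ × Euc d) : ℂ := homExt ψ (freq z.1 z.2)

theorem continuous_freq : Continuous fun z : ℝ × Euc d => freq z.1 z.2 := by
  refine (PiLp.continuous_toLp 2 _).comp (continuous_pi fun i => ?_)
  refine Fin.cases ?_ (fun j => ?_) i
  · simpa using continuous_fst
  · simp only [Fin.cons_succ]
    fun_prop

theorem freq_sub (a b : ℝ) (x y : Euc d) : freq a x - freq b y = freq (a - b) (x - y) := by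
  ext i
  refine Fin.cases ?_ (fun j => ?_) i <;> simp [freq]

theorem norm_le_norm_freq (a : ℝ) (x : Euc d) : ‖x‖ ≤ ‖freq a x‖ := by
  rw [EuclideanSpace.norm_eq, EuclideanSpace.norm_eq]
  refine Real.sqrt_le_sqrt ?_
  rw [Fin.sum_univ_succ]
  simp [freq, sq_nonneg]

theorem norm_freq_zero (x : Euc d) : ‖freq 0 x‖ = ‖x‖ := by
  rw [EuclideanSpace.norm_eq, EuclideanSpace.norm_eq, Fin.sum_univ_succ]
  simp [freq]

theorem stronglyMeasurable_symb (ψ : C(Sph d, ℂ)) : StronglyMeasurable (symb ψ) := by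
  have h1 : Measurable fun ξ : Euc (d + 1) => ‖ξ‖⁻¹ • ξ := by fun_prop
  have hs : MeasurableSet {y : Euc (d + 1) | y ∈ Metric.sphere (0 : Euc (d + 1)) 1} :=
    Metric.isClosed_sphere.measurableSet
  classical
  have h2 : Measurable fun y : Euc (d + 1) =>
      if h : y ∈ Metric.sphere (0 : Euc (d + 1)) 1 then ψ ⟨y, h⟩ else 0 :=
    Measurable.dite (s := Metric.sphere (0 : Euc (d + 1)) 1) (f := fun y => ψ y)
      ψ.continuous.measurable (g := fun _ => 0) measurable_const hs
  have h3 := (h2.comp h1).comp (continuous_freq (d := d)).measurable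
  refine Measurable.stronglyMeasurable ?_
  convert h3 using 1
  funext z
  simp only [symb, homExt, Function.comp]

theorem norm_symb_le (ψ : C(Sph d, ℂ)) (z : ℝ × Euc d) : ‖symb ψ z‖ ≤ ‖ψ‖ := by
  simp only [symb, homExt]
  split_ifs with h
  · exact ψ.norm_coe_le_norm _
  · simp

theorem symb_add (ψ ψ' : C(Sph d, ℂ)) (z : ℝ × Euc d) :
    symb (ψ + ψ') z = symb ψ z + symb ψ' z := by
  simp only [symb, homExt]
  split_ifs with h <;> simp

theorem symb_smul (c : ℂ) (ψ : C(Sph d, ℂ)) (z : ℝ × Euc d) :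
    symb (c • ψ) z = c * symb ψ z := by
  simp only [symb, homExt]
  split_ifs with h <;> simp

/-- The change of direction and the change of length each cost at most `‖x - y‖ / ‖x‖`. Only `‖x‖`
stands in the denominator, so nothing but `y ≠ 0` is needed of the translated vector. -/
theorem norm_normalize_sub_le {E : Type*} [NormedAddCommGroup E] [NormedSpace ℝ E] {x y : E}
    (hx : x ≠ 0) (hy : y ≠ 0) : ‖‖x‖⁻¹ • x - ‖y‖⁻¹ • y‖ ≤ 2 * ‖x - y‖ / ‖x‖ := by
  have hx' : 0 < ‖x‖ := norm_pos_iff.2 hx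
  have hy' : 0 < ‖y‖ := norm_pos_iff.2 hy
  have e : ‖x‖⁻¹ • x - ‖y‖⁻¹ • y = ‖x‖⁻¹ • (x - y) + (‖x‖⁻¹ - ‖y‖⁻¹) • y := by
    rw [smul_sub, sub_smul]; abel
  have h2 : ‖(‖x‖⁻¹ - ‖y‖⁻¹) • y‖ ≤ ‖x - y‖ / ‖x‖ := by
    rw [norm_smul, Real.norm_eq_abs]
    have : ‖x‖⁻¹ - ‖y‖⁻¹ = (‖y‖ - ‖x‖) / (‖x‖ * ‖y‖) := by field_simp
    rw [this, abs_div, abs_of_pos (mul_pos hx' hy'), div_mul_eq_mul_div, mul_comm ‖x‖ ‖y‖,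
      mul_comm _ ‖y‖, mul_div_mul_left _ _ hy'.ne']
    gcongr
    rw [abs_sub_comm]
    exact abs_norm_sub_norm_le x y
  rw [e]
  calc _ ≤ ‖‖x‖⁻¹ • (x - y)‖ + ‖(‖x‖⁻¹ - ‖y‖⁻¹) • y‖ := norm_add_le _ _
    _ ≤ ‖x - y‖ / ‖x‖ + ‖x - y‖ / ‖x‖ := by
        gcongr
        rw [norm_smul, norm_inv, norm_norm, div_eq_inv_mul]
    _ = _ := by ring

/-- The symbol varies slowly at infinity, uniformly in `ξ₀`. -/
theorem symb_slowly_varying (ψ : C(Sph d, ℂ)) (η : Euc d) {ε : ℝ} (hε : 0 < ε) :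
    ∃ R : ℝ, ∀ (t : ℝ) (ξ : Euc d), R < ‖ξ‖ → ‖symb ψ (t, ξ) - symb ψ (t, ξ - η)‖ ≤ ε := by
  have huc := CompactSpace.uniformContinuous_of_continuous ψ.continuous
  obtain ⟨δ, hδ, hψ⟩ := Metric.uniformContinuous_iff.1 huc ε hε
  -- The first entry keeps `ξ - η` away from `0`; the second makes `2‖η‖ / ‖ξ‖ < δ`. The full
  -- frequencies differ by `(0, η)` and have norm at least that of their `ξ'` part, so this radius
  -- serves every `ξ₀`.
  refine ⟨max ‖η‖ (2 * ‖η‖ / δ), fun t ξ hξ => ?_⟩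
  have h1 : ‖η‖ < ‖ξ‖ := (le_max_left _ _).trans_lt hξ
  have h2 : 2 * ‖η‖ / δ < ‖ξ‖ := (le_max_right _ _).trans_lt hξ
  have hξ0 : 0 < ‖ξ‖ := (norm_nonneg _).trans_lt h1
  have hx : freq t ξ ≠ 0 := norm_pos_iff.1 (hξ0.trans_le (norm_le_norm_freq t ξ))
  have hη : 0 < ‖ξ - η‖ := by
    rw [norm_pos_iff, sub_ne_zero]
    rintro rfl
    exact lt_irrefl _ h1
  have hy : freq t (ξ - η) ≠ 0 := norm_pos_iff.1 (hη.trans_le (norm_le_norm_freq _ _))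
  have mem : ∀ {x : Euc (d + 1)}, x ≠ 0 → ‖x‖⁻¹ • x ∈ Metric.sphere (0 : Euc (d + 1)) 1 := by
    intro x hx
    rw [mem_sphere_zero_iff_norm, norm_smul, norm_inv, norm_norm,
      inv_mul_cancel₀ (norm_ne_zero_iff.2 hx)]
  simp only [symb, homExt, dif_pos (mem hx), dif_pos (mem hy)]
  rw [← dist_eq_norm]
  refine (hψ ?_).le
  rw [Subtype.dist_eq, dist_eq_norm]
  refine (norm_normalize_sub_le hx hy).trans_lt ?_
  rw [freq_sub, sub_self, norm_freq_zero, sub_sub_cancel]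
  have h3 := norm_le_norm_freq t ξ
  rw [div_lt_iff₀ hδ] at h2
  rw [div_lt_iff₀ (hξ0.trans_le h3)]
  nlinarith

end Symbol

/-! ### Permutations of variables in product measures. -/

section Rearrange

variable {α β γ δ : Type*} [MeasurableSpace α] [MeasurableSpace β] [MeasurableSpace γ]
  [MeasurableSpace δ] (a : Measure α) (b : Measure β) (c : Measure γ) (e : Measure δ)
  [SFinite a] [SFinite b] [SFinite c] [SFinite e]

theorem measurePreserving_swap_last :
    MeasurePreserving (fun z : (α × β) × γ => ((z.1.1, z.2), z.1.2))
      ((a.prod b).prod c) ((a.prod c).prod b) :=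
  ((measurePreserving_prodAssoc a c b).symm).comp
    (((MeasurePreserving.id a).prod (Measure.measurePreserving_swap (μ := b) (ν := c))).comp
      (measurePreserving_prodAssoc a b c))

theorem measurePreserving_rotate :
    MeasurePreserving (fun z : ((α × β) × γ) × δ => (z.1.1.1, z.1.2, z.2, z.1.1.2))
      (((a.prod b).prod c).prod e) (a.prod (c.prod (e.prod b))) := by
  have h1 := measurePreserving_prodAssoc (a.prod b) c e
  have h2 := measurePreserving_prodAssoc a b (c.prod e)
  have h3 := (MeasurePreserving.id a).prod
    (Measure.measurePreserving_swap (μ := b) (ν := c.prod e))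
  have h4 := (MeasurePreserving.id a).prod (measurePreserving_prodAssoc c e b)
  exact h4.comp (h3.comp (h2.comp h1))

end Rearrange

/-! ### Almost everywhere linearity of the partial Fourier transform. -/

section ParametricFourier

variable {A : Type*} [MeasurableSpace A] {d : ℕ} {α : Measure A} [SFinite α]

theorem ae_integrable_slice {F : A × Euc d → ℂ}
    (hF : StronglyMeasurable F) {K : Set (Euc d)} (hK : IsCompact K)
    (hFK : ∀ a x, x ∉ K → F (a, x) = 0) (h2 : MemLp F 2 (α.prod volume)) :
    ∀ᵐ a ∂α, Integrable (fun x => F (a, x)) volume := by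
  have m2 : Measurable fun z => ‖F z‖ₑ ^ 2 := hF.enorm.pow_const 2
  have hfin : ∫⁻ a, (∫⁻ x : Euc d, ‖F (a, x)‖ₑ ^ 2) ∂α ≠ ∞ := by
    rw [← lintegral_prod _ m2.aemeasurable, ← eLpNorm_two_sq]
    exact (ENNReal.pow_lt_top h2.eLpNorm_lt_top).ne
  filter_upwards [ae_lt_top (m2.lintegral_prod_right') hfin] with a ha
  have hmeas : StronglyMeasurable fun x => F (a, x) := hF.comp_measurable (by fun_prop)
  have hL2 : MemLp (fun x => F (a, x)) 2 volume := by
    refine ⟨hmeas.aestronglyMeasurable, ?_⟩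
    rw [← eLpNorm_two_sq] at ha
    by_contra h
    rw [not_lt_top_iff.1 h] at ha
    simp at ha
  have : IsFiniteMeasure (volume.restrict K) := ⟨by simpa using hK.measure_lt_top⟩
  have h3 : IntegrableOn (fun x => F (a, x)) K volume := (hL2.restrict K).integrable (by norm_num)
  rwa [integrableOn_iff_integrable_of_support_subset] at h3
  intro x hx
  by_contra hxK
  exact hx (hFK a x hxK)

theorem pF_eq_of_ae_eq {F F' : A × Euc d → ℂ} {a : A} (h : ∀ᵐ x : Euc d, F (a, x) = F' (a, x))
    (ξ : Euc d) : pF F (a, ξ) = pF F' (a, ξ) := by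
  simp only [pF, Real.fourier_eq]
  refine integral_congr_ae ?_
  filter_upwards [h] with x hx
  rw [hx]

theorem ae_prod_of_ae_fst {p : A × Euc d → Prop} (h : ∀ᵐ a ∂α, ∀ ξ, p (a, ξ)) :
    ∀ᵐ z ∂(α.prod (volume : Measure (Euc d))), p z := by
  have := (Measure.quasiMeasurePreserving_fst (μ := α) (ν := (volume : Measure (Euc d)))).ae h
  filter_upwards [this] with z hz using hz z.2

theorem pF_congr_ae {F F' : A × Euc d → ℂ} (h : F =ᵐ[α.prod volume] F') :
    pF F =ᵐ[α.prod volume] pF F' := by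
  refine ae_prod_of_ae_fst (α := α) ?_
  filter_upwards [Measure.ae_ae_of_ae_prod h] with a ha ξ using pF_eq_of_ae_eq ha ξ

theorem pF_add_ae {F F' : A × Euc d → ℂ} (hF : ∀ᵐ a ∂α, Integrable (fun x => F (a, x)) volume)
    (hF' : ∀ᵐ a ∂α, Integrable (fun x => F' (a, x)) volume) :
    pF (fun z => F z + F' z) =ᵐ[α.prod volume] fun z => pF F z + pF F' z := by
  refine ae_prod_of_ae_fst (α := α) ?_
  filter_upwards [hF, hF'] with a h1 h2 ξ
  simp only [pF]
  exact congrFun (VectorFourier.fourierIntegral_add Real.continuous_fourierChar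
    (by exact continuous_inner) h1 h2) ξ

theorem pF_const_mul (c : ℂ) (F : A × Euc d → ℂ) : pF (fun z => c * F z) = fun z => c * pF F z := by
  funext z
  simp only [pF, Real.fourier_eq, Circle.smul_def, smul_eq_mul]
  rw [← integral_const_mul]
  congr 1; funext x; ring

end ParametricFourier

/-! ### Slice integrals and their `L²` bounds. -/

section Slices

variable {S : Type*} [MeasurableSpace S] {d m : ℕ}

/-- `((s, q), x) ↦ ∫ Φ(x, p, q) v(s, x, p) dp`. -/
def sliceInt (Φ : Euc d × Euc m × Euc m → ℂ) (v : S × Euc d × Euc m → ℂ)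
    (z : (S × Euc m) × Euc d) : ℂ :=
  ∫ p, Φ (z.2, p, z.1.2) * v (z.1.1, z.2, p)

/-- `((s, q), x) ↦ v(s, x, q)`. -/
def swapArr (v : S × Euc d × Euc m → ℂ) (z : (S × Euc m) × Euc d) : ℂ := v (z.1.1, z.2, z.1.2)

/-- Functions `v(s, x, l)` that vanish for `x ∉ K` and are bounded by `N` in `L²` with respect
to `l`. -/
structure SliceBounded (σ : Measure S) (K : Set (Euc d)) (N : ℝ≥0) (v : S × Euc d × Euc m → ℂ) :
    Prop where
  meas : StronglyMeasurable v
  supp : ∀ s x l, x ∉ K → v (s, x, l) = 0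
  bound : ∀ᵐ w ∂(σ.prod (volume : Measure (Euc d))), ∫⁻ l, ‖v (w.1, w.2, l)‖ₑ ^ 2 ≤ (N : ℝ≥0∞) ^ 2

variable {σ : Measure S} [IsFiniteMeasure σ] {K : Set (Euc d)} {N : ℝ≥0}
  {v : S × Euc d × Euc m → ℂ}

theorem stronglyMeasurable_swapArr (hv : StronglyMeasurable v) :
    StronglyMeasurable (swapArr v) :=
  hv.comp_measurable (by fun_prop)

theorem stronglyMeasurable_sliceInt {Φ : Euc d × Euc m × Euc m → ℂ} (hΦ : StronglyMeasurable Φ)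
    (hv : StronglyMeasurable v) : StronglyMeasurable (sliceInt Φ v) := by
  have h : StronglyMeasurable fun y : ((S × Euc m) × Euc d) × Euc m =>
      Φ (y.1.2, y.2, y.1.1.2) * v (y.1.1.1, y.1.2, y.2) :=
    (hΦ.comp_measurable (by fun_prop)).mul (hv.comp_measurable (by fun_prop))
  exact h.integral_prod_right' (ν := (volume : Measure (Euc m)))

theorem swapArr_eq_zero (hv : SliceBounded σ K N v) (a : S × Euc m) (x : Euc d) (hx : x ∉ K) :
    swapArr v (a, x) = 0 := hv.supp _ _ _ hx

theorem sliceInt_eq_zero (hv : SliceBounded σ K N v) (Φ : Euc d × Euc m × Euc m → ℂ)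
    (a : S × Euc m) (x : Euc d) (hx : x ∉ K) : sliceInt Φ v (a, x) = 0 := by
  simp [sliceInt, hv.supp _ _ _ hx]

/-- The bound for `swapArr` in `L²`. -/
def swapConst (σ : Measure S) (K : Set (Euc d)) (N : ℝ≥0) : ℝ≥0∞ :=
  N * (σ univ) ^ (1 / 2 : ℝ) * (volume K) ^ (1 / 2 : ℝ)

theorem rpow_half_sq (x : ℝ≥0∞) : (x ^ (1 / 2 : ℝ)) ^ 2 = x := by
  rw [← ENNReal.rpow_natCast, ← ENNReal.rpow_mul]; norm_num

theorem swapConst_lt_top (hK : IsCompact K) : swapConst σ K N < ∞ := by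
  refine ENNReal.mul_lt_top (ENNReal.mul_lt_top ENNReal.coe_lt_top ?_) ?_
  · exact ENNReal.rpow_lt_top_of_nonneg (by norm_num) (measure_ne_top _ _)
  · exact ENNReal.rpow_lt_top_of_nonneg (by norm_num) hK.measure_lt_top.ne

/-- The bound in `l` is uniform in `(s, x)`, so integrating it over the set `S × K` of finite
measure gives the three factors of `swapConst`. -/
theorem eLpNorm_swapArr_le (hK : IsCompact K) (hv : SliceBounded σ K N v) :
    eLpNorm (swapArr v) 2 ((σ.prod volume).prod volume) ≤ swapConst σ K N := by
  refine eLpNorm_two_le_of_sq_le ?_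
  have hm : Measurable fun y : (S × Euc d) × Euc m => ‖v (y.1.1, y.1.2, y.2)‖ₑ ^ 2 :=
    (hv.meas.comp_measurable (by fun_prop)).enorm.pow_const 2
  have e1 := (measurePreserving_swap_last σ (volume : Measure (Euc m))
    (volume : Measure (Euc d))).lintegral_comp hm
  have e2 : ∫⁻ z, ‖swapArr v z‖ₑ ^ 2 ∂((σ.prod volume).prod volume)
      = ∫⁻ w, ∫⁻ l : Euc m, ‖v (w.1, w.2, l)‖ₑ ^ 2 ∂volume
          ∂(σ.prod (volume : Measure (Euc d))) := by
    rw [← lintegral_prod _ hm.aemeasurable, ← e1]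
    rfl
  rw [e2]
  calc _ ≤ ∫⁻ w, (univ ×ˢ K).indicator (fun _ => (N : ℝ≥0∞) ^ 2) w
        ∂(σ.prod (volume : Measure (Euc d))) := by
        refine lintegral_mono_ae ?_
        filter_upwards [hv.bound] with w hw
        by_cases hx : w.2 ∈ K
        · rwa [indicator_of_mem (by simp [hx])]
        · simp [hv.supp _ _ _ hx]
    _ = _ := by
        rw [lintegral_indicator_const (MeasurableSet.univ.prod hK.measurableSet),
          Measure.prod_prod, swapConst, mul_pow, mul_pow, rpow_half_sq, rpow_half_sq, mul_assoc]

theorem memLp_swapArr (hK : IsCompact K) (hv : SliceBounded σ K N v) :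
    MemLp (swapArr v) 2 ((σ.prod volume).prod volume) :=
  ⟨(stronglyMeasurable_swapArr hv.meas).aestronglyMeasurable,
    (eLpNorm_swapArr_le hK hv).trans_lt (swapConst_lt_top hK)⟩

/-- Cauchy-Schwarz in `p` uses up the uniform bound on `v`; what remains is `Φ` alone, and
integration over `s` contributes the total mass of `σ`. The absolute value stays inside the inner
integral so that the estimate also yields integrability in `p`. -/
theorem lintegral_sq_lintegral_slice_le (hv : SliceBounded σ K N v)
    {Φ : Euc d × Euc m × Euc m → ℂ} (hΦ : StronglyMeasurable Φ) :
    ∫⁻ z : (S × Euc m) × Euc d, (∫⁻ p, ‖Φ (z.2, p, z.1.2) * v (z.1.1, z.2, p)‖ₑ) ^ 2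
        ∂((σ.prod volume).prod volume)
      ≤ (N * (σ univ) ^ (1 / 2 : ℝ) * eLpNorm Φ 2 volume) ^ 2 := by
  have hb : ∀ᵐ z : (S × Euc m) × Euc d ∂((σ.prod volume).prod volume),
      ∫⁻ p, ‖v (z.1.1, z.2, p)‖ₑ ^ 2 ≤ (N : ℝ≥0∞) ^ 2 := by
    have h1 := (measurePreserving_swap_last σ (volume : Measure (Euc m))
      (volume : Measure (Euc d))).quasiMeasurePreserving
    exact (Measure.quasiMeasurePreserving_fst.comp h1).ae hv.bound
  have hm : Measurable fun y : S × Euc d × Euc m × Euc m => ‖Φ y.2‖ₑ ^ 2 :=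
    (hΦ.comp_measurable (by fun_prop)).enorm.pow_const 2
  have hm' : Measurable fun y : ((S × Euc m) × Euc d) × Euc m => ‖Φ (y.1.2, y.2, y.1.1.2)‖ₑ ^ 2 :=
    (hΦ.comp_measurable (by fun_prop)).enorm.pow_const 2
  calc _ ≤ ∫⁻ z : (S × Euc m) × Euc d, (∫⁻ p, ‖Φ (z.2, p, z.1.2)‖ₑ ^ 2) * (N : ℝ≥0∞) ^ 2
          ∂((σ.prod volume).prod volume) := by
        refine lintegral_mono_ae ?_
        filter_upwards [hb] with z hz
        simp only [enorm_mul]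
        refine (sq_lintegral_mul_le ?_ ?_).trans ?_
        · exact (hΦ.comp_measurable (by fun_prop)).enorm.aemeasurable
        · exact (hv.meas.comp_measurable (by fun_prop)).enorm.aemeasurable
        · gcongr
    _ = (∫⁻ y, ‖Φ y.2‖ₑ ^ 2 ∂(σ.prod volume)) * (N : ℝ≥0∞) ^ 2 := by
        rw [lintegral_mul_const _ hm'.lintegral_prod_right', ← lintegral_prod _ hm'.aemeasurable]
        congr 1
        exact (measurePreserving_rotate σ (volume : Measure (Euc m))
          (volume : Measure (Euc d)) (volume : Measure (Euc m))).lintegral_comp hm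
    _ = _ := by
        have : ∫⁻ y, ‖Φ y.2‖ₑ ^ 2 ∂(σ.prod volume) = σ univ * eLpNorm Φ 2 volume ^ 2 := by
          have h := lintegral_prod_mul (μ := σ) (ν := (volume : Measure (Euc d × Euc m × Euc m)))
            (f := fun _ => 1) (g := fun y => ‖Φ y‖ₑ ^ 2) aemeasurable_const
            (hΦ.enorm.pow_const 2).aemeasurable
          rw [eLpNorm_two_sq]
          simpa using h
        rw [this, mul_pow, mul_pow, rpow_half_sq]
        ring

theorem eLpNorm_sliceInt_le (hv : SliceBounded σ K N v)
    {Φ : Euc d × Euc m × Euc m → ℂ} (hΦ : StronglyMeasurable Φ) :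
    eLpNorm (sliceInt Φ v) 2 ((σ.prod volume).prod volume)
      ≤ N * (σ univ) ^ (1 / 2 : ℝ) * eLpNorm Φ 2 volume := by
  refine eLpNorm_two_le_of_sq_le ((lintegral_mono fun z => ?_).trans
    (lintegral_sq_lintegral_slice_le hv hΦ))
  exact pow_le_pow_left' (enorm_integral_le_lintegral_enorm _) 2

theorem sliceConst_lt_top {x : ℝ≥0∞} (hx : x < ∞) : N * (σ univ) ^ (1 / 2 : ℝ) * x < ∞ :=
  ENNReal.mul_lt_top (ENNReal.mul_lt_top ENNReal.coe_lt_top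
    (ENNReal.rpow_lt_top_of_nonneg (by norm_num) (measure_ne_top _ _))) hx

theorem memLp_sliceInt (hv : SliceBounded σ K N v)
    {Φ : Euc d × Euc m × Euc m → ℂ} (hΦ : StronglyMeasurable Φ) (h2 : MemLp Φ 2 volume) :
    MemLp (sliceInt Φ v) 2 ((σ.prod volume).prod volume) :=
  ⟨(stronglyMeasurable_sliceInt hΦ hv.meas).aestronglyMeasurable,
    (eLpNorm_sliceInt_le hv hΦ).trans_lt (sliceConst_lt_top h2.eLpNorm_lt_top)⟩

/-- Needed for additivity in `Φ`, since the integral over `p` takes the default value `0` where the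
integrand is not integrable. -/
theorem ae_integrable_slice_mul (hv : SliceBounded σ K N v)
    {Φ : Euc d × Euc m × Euc m → ℂ} (hΦ : StronglyMeasurable Φ) (h2 : MemLp Φ 2 volume) :
    ∀ᵐ z : (S × Euc m) × Euc d ∂((σ.prod volume).prod volume),
      Integrable fun p => Φ (z.2, p, z.1.2) * v (z.1.1, z.2, p) := by
  have hm : StronglyMeasurable fun y : ((S × Euc m) × Euc d) × Euc m =>
      Φ (y.1.2, y.2, y.1.1.2) * v (y.1.1.1, y.1.2, y.2) :=
    (hΦ.comp_measurable (by fun_prop)).mul (hv.meas.comp_measurable (by fun_prop))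
  have h := (lintegral_sq_lintegral_slice_le hv hΦ).trans_lt
    (ENNReal.pow_lt_top (n := 2) (sliceConst_lt_top h2.eLpNorm_lt_top))
  filter_upwards [ae_lt_top (hm.enorm.lintegral_prod_right'.pow_const 2) h.ne] with z hz
  refine ⟨(hm.comp_measurable (g := fun p => (z, p)) (by fun_prop)).aestronglyMeasurable, ?_⟩
  rw [hasFiniteIntegral_iff_enorm]
  by_contra hc
  have hc := not_lt_top_iff.1 hc
  rw [hc] at hz
  simp at hz

theorem sliceInt_add_ae (hv : SliceBounded σ K N v)
    {Φ Φ' : Euc d × Euc m × Euc m → ℂ} (hΦ : StronglyMeasurable Φ) (h2 : MemLp Φ 2 volume)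
    (hΦ' : StronglyMeasurable Φ') (h2' : MemLp Φ' 2 volume) :
    sliceInt (fun y => Φ y + Φ' y) v =ᵐ[(σ.prod volume).prod volume]
      fun z => sliceInt Φ v z + sliceInt Φ' v z := by
  filter_upwards [ae_integrable_slice_mul hv hΦ h2, ae_integrable_slice_mul hv hΦ' h2'] with z h h'
  simp only [sliceInt, add_mul]
  exact integral_add h h'

theorem ae_ae_slice {p : Euc d × Euc m × Euc m → Prop} (h : ∀ᵐ y, p y) :
    ∀ᵐ z : (S × Euc m) × Euc d ∂((σ.prod volume).prod volume),
      ∀ᵐ l : Euc m, p (z.2, l, z.1.2) := by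
  have h1 := (measurePreserving_rotate σ (volume : Measure (Euc m))
    (volume : Measure (Euc d)) (volume : Measure (Euc m))).quasiMeasurePreserving
  exact Measure.ae_ae_of_ae_prod ((Measure.quasiMeasurePreserving_snd.comp h1).ae h)

theorem sliceInt_congr_ae {Φ Φ' : Euc d × Euc m × Euc m → ℂ} (h : Φ =ᵐ[volume] Φ') :
    sliceInt Φ v =ᵐ[(σ.prod volume).prod volume] sliceInt Φ' v := by
  filter_upwards [ae_ae_slice (σ := σ) h] with z hz
  refine integral_congr_ae ?_
  filter_upwards [hz] with p hp
  rw [hp]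

end Slices

/-! ### Limits of bounded trilinear functionals. -/

section Trilinear

variable {X Y Z : Type*} [NormedAddCommGroup X] [NormedSpace ℂ X] [NormedAddCommGroup Y]
  [NormedSpace ℂ Y] [NormedAddCommGroup Z] [NormedSpace ℂ Z]

/-- `f` is additive and homogeneous in each of its three arguments. -/
structure IsTrilinear {X Y Z : Type*} [AddCommGroup X] [Module ℂ X] [AddCommGroup Y]
    [Module ℂ Y] [AddCommGroup Z] [Module ℂ Z] (f : X → Y → Z → ℂ) : Prop where
  add₁ : ∀ x x' y z, f (x + x') y z = f x y z + f x' y z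
  smul₁ : ∀ (c : ℂ) x y z, f (c • x) y z = c * f x y z
  add₂ : ∀ x y y' z, f x (y + y') z = f x y z + f x y' z
  smul₂ : ∀ (c : ℂ) x y z, f x (c • y) z = c * f x y z
  add₃ : ∀ x y z z', f x y (z + z') = f x y z + f x y z'
  smul₃ : ∀ (c : ℂ) x y z, f x y (c • z) = c * f x y z

/-- The bundled trilinear map of a trilinear function. -/
def IsTrilinear.toLin {X Y Z : Type*} [AddCommGroup X] [Module ℂ X] [AddCommGroup Y]
    [Module ℂ Y] [AddCommGroup Z] [Module ℂ Z] {f : X → Y → Z → ℂ} (h : IsTrilinear f) :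
    X →ₗ[ℂ] Y →ₗ[ℂ] Z →ₗ[ℂ] ℂ where
  toFun x :=
    { toFun := fun y =>
        { toFun := fun z => f x y z
          map_add' := h.add₃ x y
          map_smul' := fun c z => h.smul₃ c x y z }
      map_add' := fun y y' => LinearMap.ext fun z => h.add₂ x y y' z
      map_smul' := fun c y => LinearMap.ext fun z => h.smul₂ c x y z }
  map_add' x x' := LinearMap.ext fun y => LinearMap.ext fun z => h.add₁ x x' y z
  map_smul' c x := LinearMap.ext fun y => LinearMap.ext fun z => h.smul₁ c x y z

@[simp] theorem IsTrilinear.toLin_apply {X Y Z : Type*} [AddCommGroup X] [Module ℂ X]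
    [AddCommGroup Y] [Module ℂ Y] [AddCommGroup Z] [Module ℂ Z] {f : X → Y → Z → ℂ}
    (h : IsTrilinear f) (x : X) (y : Y) (z : Z) : h.toLin x y z = f x y z := rfl

/-- `f` is trilinear and bounded by `C`. -/
structure IsBoundedTrilinear (f : X → Y → Z → ℂ) (C : ℝ) : Prop extends IsTrilinear f where
  bound : ∀ x y z, ‖f x y z‖ ≤ C * ‖x‖ * ‖y‖ * ‖z‖

theorem IsTrilinear.sub₁ {f : X → Y → Z → ℂ} (h : IsTrilinear f) (x x' : X) (y : Y) (z : Z) :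
    f (x - x') y z = f x y z - f x' y z := by
  have := h.add₁ (x - x') x' y z
  rw [sub_add_cancel] at this
  rw [this, add_sub_cancel_right]

theorem IsTrilinear.sub₂ {f : X → Y → Z → ℂ} (h : IsTrilinear f) (x : X) (y y' : Y) (z : Z) :
    f x (y - y') z = f x y z - f x y' z := by
  have := h.add₂ x (y - y') y' z
  rw [sub_add_cancel] at this
  rw [this, add_sub_cancel_right]

theorem IsTrilinear.sub₃ {f : X → Y → Z → ℂ} (h : IsTrilinear f) (x : X) (y : Y) (z z' : Z) :
    f x y (z - z') = f x y z - f x y z' := by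
  have := h.add₃ x y (z - z') z'
  rw [sub_add_cancel] at this
  rw [this, add_sub_cancel_right]

/-- A sequence of functions that are Lipschitz with a common constant and converge on a dense
set converges everywhere. -/
theorem exists_tendsto_of_dense {D : ℕ → X} (hD : DenseRange D) {f : ℕ → X → ℂ} {C : ℝ}
    (hf : ∀ n x y, ‖f n x - f n y‖ ≤ C * ‖x - y‖)
    (h : ∀ i, ∃ l, Tendsto (fun n => f n (D i)) atTop (𝓝 l)) (x : X) :
    ∃ l, Tendsto (fun n => f n x) atTop (𝓝 l) := by
  refine cauchySeq_tendsto_of_complete (Metric.cauchySeq_iff.2 fun ε hε => ?_)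
  have hC : 0 < |C| + 1 := by positivity
  obtain ⟨i, hi⟩ := hD.exists_dist_lt x (show 0 < ε / 3 / (|C| + 1) by positivity)
  obtain ⟨l, hl⟩ := h i
  obtain ⟨N, hN⟩ := Metric.cauchySeq_iff.1 hl.cauchySeq (ε / 3) (by positivity)
  have key : ∀ n, dist (f n x) (f n (D i)) < ε / 3 := fun n => by
    rw [dist_eq_norm] at hi ⊢
    calc _ ≤ C * ‖x - D i‖ := hf n _ _
      _ ≤ (|C| + 1) * ‖x - D i‖ := by
          gcongr
          linarith [le_abs_self C]
      _ < ε / 3 := by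
          rw [lt_div_iff₀ hC] at hi
          linarith
  refine ⟨N, fun p hp q hq => ?_⟩
  have h1 := key p
  have h2 := key q
  have h3 := hN p hp q hq
  rw [dist_comm] at h2
  linarith [dist_triangle4 (f p x) (f p (D i)) (f q (D i)) (f q x)]

/-- From countably many bounded sequences of trilinear functions on separable spaces one can
select a common subsequence along which all of them converge pointwise. -/
theorem exists_subseq_tendsto_trilinear [TopologicalSpace.SeparableSpace X]
    [TopologicalSpace.SeparableSpace Y] [TopologicalSpace.SeparableSpace Z]
    {f : ℕ → ℕ → X → Y → Z → ℂ} {C : ℕ → ℝ} (hf : ∀ n j, IsBoundedTrilinear (f n j) (C j)) :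
    ∃ k : ℕ → ℕ, StrictMono k ∧ ∀ j x y z, ∃ l, Tendsto (fun n => f (k n) j x y z) atTop (𝓝 l) := by
  set a := TopologicalSpace.denseSeq X
  set b := TopologicalSpace.denseSeq Y
  set c := TopologicalSpace.denseSeq Z
  have ha : DenseRange a := TopologicalSpace.denseRange_denseSeq X
  have hb : DenseRange b := TopologicalSpace.denseRange_denseSeq Y
  have hc : DenseRange c := TopologicalSpace.denseRange_denseSeq Z
  -- The values at all dense triples, for all `j`, form a point of a countable product of compact
  -- discs. Sequential compactness of this product replaces the diagonal argument.
  have hcomp : IsCompact (Set.pi univ fun i : ℕ × ℕ × ℕ × ℕ =>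
      Metric.closedBall (0 : ℂ) (C i.1 * ‖a i.2.1‖ * ‖b i.2.2.1‖ * ‖c i.2.2.2‖)) :=
    isCompact_univ_pi fun i => isCompact_closedBall _ _
  obtain ⟨g, -, k, hk, hlim⟩ := hcomp.tendsto_subseq
    (x := fun n => fun i : ℕ × ℕ × ℕ × ℕ => f n i.1 (a i.2.1) (b i.2.2.1) (c i.2.2.2))
    (fun n i _ => by
      rw [mem_closedBall_zero_iff]
      exact (hf n i.1).bound _ _ _)
  rw [tendsto_pi_nhds] at hlim
  refine ⟨k, hk, fun j => ?_⟩
  -- Convergence is extended from the dense sequences to the whole spaces one argument at a time.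
  -- The Lipschitz constant in each argument is the trilinear bound with the other two arguments
  -- fixed.
  have h1 : ∀ i i' z, ∃ l, Tendsto (fun n => f (k n) j (a i) (b i') z) atTop (𝓝 l) := fun i i' =>
    exists_tendsto_of_dense hc (C := C j * ‖a i‖ * ‖b i'‖)
      (fun n z z' => by rw [← (hf _ j).sub₃]; exact (hf _ j).bound _ _ _)
      (fun i'' => ⟨_, hlim (j, i, i', i'')⟩)
  have h2 : ∀ i y z, ∃ l, Tendsto (fun n => f (k n) j (a i) y z) atTop (𝓝 l) := fun i y z =>
    exists_tendsto_of_dense (f := fun n y => f (k n) j (a i) y z) hb (C := C j * ‖a i‖ * ‖z‖)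
      (fun n y y' => by
        rw [← (hf _ j).sub₂, mul_right_comm]; exact (hf _ j).bound _ _ _)
      (fun i' => h1 i i' z) y
  exact fun x y z => exists_tendsto_of_dense (f := fun n x => f (k n) j x y z) ha
      (C := C j * ‖y‖ * ‖z‖)
      (fun n x x' => by
        rw [← (hf _ j).sub₁]
        exact ((hf _ j).bound _ _ _).trans (le_of_eq (by ring)))
      (fun i => h2 i y z) x

/-- The limit of a bounded sequence along the hyperfilter. -/
def ulim (a : ℕ → ℂ) : ℂ := limUnder (hyperfilter ℕ : Filter ℕ) a

theorem ulim_eq_of_tendsto {a : ℕ → ℂ} {l : ℂ} (h : Tendsto a atTop (𝓝 l)) : ulim a = l :=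
  (h.mono_left (Nat.hyperfilter_le_atTop)).limUnder_eq

theorem tendsto_ulim {a : ℕ → ℂ} {C : ℝ} (h : ∀ n, ‖a n‖ ≤ C) :
    Tendsto a (hyperfilter ℕ : Filter ℕ) (𝓝 (ulim a)) := by
  obtain ⟨l, -, hl⟩ := (isCompact_closedBall (0 : ℂ) C).ultrafilter_le_nhds
    ((hyperfilter ℕ).map a) (by
      rw [le_principal_iff]
      exact Filter.mem_map.2 (Eventually.of_forall fun n => by simpa using h n))
  have : Tendsto a (hyperfilter ℕ : Filter ℕ) (𝓝 l) := hl
  rwa [ulim, this.limUnder_eq]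

/-- Every bounded sequence converges along an ultrafilter, and such limits respect sums, scalars and
bounds. A functional is thus obtained even where no ordinary convergence is known. -/
theorem isBoundedTrilinear_ulim {f : ℕ → X → Y → Z → ℂ} {C : ℝ}
    (hf : ∀ n, IsBoundedTrilinear (f n) C) :
    IsBoundedTrilinear (fun x y z => ulim fun n => f n x y z) C := by
  have ht : ∀ x y z, Tendsto (fun n => f n x y z) (hyperfilter ℕ : Filter ℕ)
      (𝓝 (ulim fun n => f n x y z)) := fun x y z => tendsto_ulim fun n => (hf n).bound x y z
  refine ⟨⟨?_, ?_, ?_, ?_, ?_, ?_⟩, ?_⟩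
  · intro x x' y z
    refine tendsto_nhds_unique (ht _ y z) ?_
    simpa only [(hf _).add₁] using (ht x y z).add (ht x' y z)
  · intro c x y z
    refine tendsto_nhds_unique (ht _ y z) ?_
    simpa only [(hf _).smul₁] using (ht x y z).const_mul c
  · intro x y y' z
    refine tendsto_nhds_unique (ht _ _ z) ?_
    simpa only [(hf _).add₂] using (ht x y z).add (ht x y' z)
  · intro c x y z
    refine tendsto_nhds_unique (ht _ _ z) ?_
    simpa only [(hf _).smul₂] using (ht x y z).const_mul c
  · intro x y z z'
    refine tendsto_nhds_unique (ht _ _ _) ?_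
    simpa only [(hf _).add₃] using (ht x y z).add (ht x y z')
  · intro c x y z
    refine tendsto_nhds_unique (ht _ _ _) ?_
    simpa only [(hf _).smul₃] using (ht x y z).const_mul c
  · exact fun x y z => le_of_tendsto (ht x y z).norm
      (Eventually.of_forall fun n => (hf n).bound x y z)

end Trilinear

/-! ### The localized form and its cutoff in `l`. -/

section LocalizedForm

variable {S : Type*} [MeasurableSpace S] {d m : ℕ}

/-- The trilinear form
`∫ ψ(ξ/|ξ|) φ(ξ₀) θ(s, ξ₀) F_x(∫ Φ(·, p, q) v(s, ·, p) dp)(ξ') conj F_x(v(s, ·, q))(ξ')`. -/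
def locForm (σ : Measure S) (θ : S × ℝ → ℂ) (v : S × Euc d × Euc m → ℂ) (φ : ℝ → ℂ)
    (Φ : Euc d × Euc m × Euc m → ℂ) (ψ : C(Sph d, ℂ)) : ℂ :=
  form (σ.prod (volume : Measure (Euc m))) (symb ψ) (fun w => θ (w.1.1, w.2)) φ
    (pF (sliceInt Φ v)) (pF (swapArr v))

/-- The restriction of `v(s, x, l)` to `l ∈ Λ`. -/
def cut (Λ : Set (Euc m)) (v : S × Euc d × Euc m → ℂ) (z : S × Euc d × Euc m) : ℂ :=
  Λ.indicator (fun _ => v z) z.2.2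

theorem cut_of_mem {Λ : Set (Euc m)} {v : S × Euc d × Euc m → ℂ} {z : S × Euc d × Euc m}
    (h : z.2.2 ∈ Λ) : cut Λ v z = v z := indicator_of_mem h _

theorem cut_of_notMem {Λ : Set (Euc m)} {v : S × Euc d × Euc m → ℂ} {z : S × Euc d × Euc m}
    (h : z.2.2 ∉ Λ) : cut Λ v z = 0 := indicator_of_notMem h _

theorem stronglyMeasurable_cut {Λ : Set (Euc m)} (hΛ : MeasurableSet Λ)
    {v : S × Euc d × Euc m → ℂ} (hv : StronglyMeasurable v) : StronglyMeasurable (cut Λ v) := by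
  have : cut Λ v = {z : S × Euc d × Euc m | z.2.2 ∈ Λ}.indicator v := by
    funext z
    by_cases h : z.2.2 ∈ Λ
    · rw [cut_of_mem h, indicator_of_mem (by exact h)]
    · rw [cut_of_notMem h, indicator_of_notMem (by exact h)]
  rw [this]
  exact hv.indicator ((by fun_prop : Measurable fun z : S × Euc d × Euc m => z.2.2) hΛ)

variable {σ : Measure S} [IsFiniteMeasure σ] {K : Set (Euc d)} {N : ℝ≥0}
  {v : S × Euc d × Euc m → ℂ} {θ : S × ℝ → ℂ}

/-- A function bounded by `M` has `L²` norm at most `M |Λ|^{1/2}` on `Λ`; this is the constant. -/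
theorem sliceBounded_cut (hv : StronglyMeasurable v) {M : ℝ≥0} (hM : ∀ z, ‖v z‖ ≤ M)
    (hK : ∀ s x l, x ∉ K → v (s, x, l) = 0) {Λ : Set (Euc m)} (hΛ : IsCompact Λ) :
    SliceBounded σ K (M * ((volume Λ).toNNReal) ^ (1 / 2 : ℝ)) (cut Λ v) := by
  refine ⟨stronglyMeasurable_cut hΛ.measurableSet hv, fun s x l hx => ?_,
    Eventually.of_forall fun w => ?_⟩
  · by_cases h : l ∈ Λ
    · rw [cut_of_mem (by exact h), hK _ _ _ hx]
    · rw [cut_of_notMem (by exact h)]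
  · calc ∫⁻ l, ‖cut Λ v (w.1, w.2, l)‖ₑ ^ 2
        ≤ ∫⁻ l, Λ.indicator (fun _ => (M : ℝ≥0∞) ^ 2) l := by
          refine lintegral_mono fun l => ?_
          by_cases h : l ∈ Λ
          · rw [cut_of_mem (by exact h), indicator_of_mem h]
            refine pow_le_pow_left' ?_ 2
            rw [← ofReal_norm]
            exact (ENNReal.ofReal_le_ofReal (hM _)).trans (by simp)
          · rw [cut_of_notMem (by exact h), indicator_of_notMem h]
            simp
      _ = (M : ℝ≥0∞) ^ 2 * volume Λ := lintegral_indicator_const hΛ.measurableSet _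
      _ = _ := by
          rw [ENNReal.coe_mul, mul_pow, ENNReal.coe_rpow_of_nonneg _ (by norm_num), rpow_half_sq,
            ENNReal.coe_toNNReal hΛ.measure_lt_top.ne]

theorem locForm_congr {φ φ' : ℝ → ℂ} {Φ Φ' : Euc d × Euc m × Euc m → ℂ} (ψ : C(Sph d, ℂ))
    (hφ : φ =ᵐ[volume] φ') (hΦ : Φ =ᵐ[volume] Φ') :
    locForm σ θ v φ Φ ψ = locForm σ θ v φ' Φ' ψ := by
  refine form_congr hφ ?_
  filter_upwards [pF_congr_ae (sliceInt_congr_ae (σ := σ) (v := v) hΦ)] with z hz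
  rw [hz]

/-- The slice integral sees `v` only at `p ∈ Λ`, and it vanishes for `q ∉ Λ`, where the two second
factors may differ. Hence a `v` that is merely bounded may be replaced by a slice-bounded one, and
the cutoffs to different large balls agree. -/
theorem locForm_cut (φ : ℝ → ℂ) {Φ : Euc d × Euc m × Euc m → ℂ} (ψ : C(Sph d, ℂ))
    {Λ : Set (Euc m)} (hΦ : ∀ᵐ y : Euc d × Euc m × Euc m, y.2 ∉ Λ ×ˢ Λ → Φ y = 0) :
    locForm σ θ v φ Φ ψ = locForm σ θ (cut Λ v) φ Φ ψ := by
  refine form_congr (ae_eq_refl _) (ae_prod_of_ae_fst (α := σ.prod volume) ?_)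
  filter_upwards [Measure.ae_ae_of_ae_prod (ae_ae_slice (σ := σ) hΦ)] with a ha ξ
  have h1 : pF (sliceInt Φ v) (a, ξ) = pF (sliceInt Φ (cut Λ v)) (a, ξ) := by
    refine pF_eq_of_ae_eq ?_ ξ
    filter_upwards [ha] with x hx
    refine integral_congr_ae ?_
    filter_upwards [hx] with p hp
    by_cases h : p ∈ Λ
    · rw [cut_of_mem (by exact h)]
    · rw [hp (fun hc => h hc.1), zero_mul, zero_mul]
  rw [h1]
  by_cases hq : a.2 ∈ Λ
  · congr 2
    refine pF_eq_of_ae_eq (Eventually.of_forall fun x => ?_) ξ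
    simp only [swapArr]
    rw [cut_of_mem (by exact hq)]
  · have h2 : pF (sliceInt Φ (cut Λ v)) (a, ξ) = pF (fun _ => 0) (a, ξ) := by
      refine pF_eq_of_ae_eq ?_ ξ
      filter_upwards [ha] with x hx
      have : sliceInt Φ (cut Λ v) (a, x) = ∫ _ : Euc m, (0 : ℂ) := by
        refine integral_congr_ae ?_
        filter_upwards [hx] with p hp
        rw [hp (fun hc => hq hc.2), zero_mul]
      rw [this, integral_zero]
    rw [h2]
    simp [pF, Real.fourier_eq]

theorem locForm_add_mid (hK : IsCompact K) (hv : SliceBounded σ K N v)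
    (hθ : StronglyMeasurable θ) (hθ1 : ∀ z, ‖θ z‖ ≤ 1) {φ : ℝ → ℂ} (hφ : Integrable φ)
    {Φ Φ' : Euc d × Euc m × Euc m → ℂ} (hΦ : StronglyMeasurable Φ) (h2 : MemLp Φ 2 volume)
    (hΦ' : StronglyMeasurable Φ') (h2' : MemLp Φ' 2 volume) (ψ : C(Sph d, ℂ)) :
    locForm σ θ v φ (fun y => Φ y + Φ' y) ψ = locForm σ θ v φ Φ ψ + locForm σ θ v φ Φ' ψ := by
  have hm := stronglyMeasurable_sliceInt hΦ hv.meas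
  have hm' := stronglyMeasurable_sliceInt hΦ' hv.meas
  have hl := memLp_sliceInt hv hΦ h2
  have hl' := memLp_sliceInt hv hΦ' h2'
  have hs := memLp_pF (stronglyMeasurable_swapArr hv.meas) hK (swapArr_eq_zero hv)
    (memLp_swapArr hK hv)
  have hθ' : StronglyMeasurable fun w : (S × Euc m) × ℝ => θ (w.1.1, w.2) :=
    hθ.comp_measurable (by fun_prop)
  rw [locForm, locForm, locForm, ← form_add_left (stronglyMeasurable_symb ψ) (norm_symb_le ψ)
    hθ' (fun _ => hθ1 _) hφ
    (memLp_pF hm hK (sliceInt_eq_zero hv Φ) hl) (memLp_pF hm' hK (sliceInt_eq_zero hv Φ') hl') hs]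
  refine form_congr (ae_eq_refl _) ?_
  filter_upwards [pF_congr_ae (sliceInt_add_ae hv hΦ h2 hΦ' h2'),
    pF_add_ae (ae_integrable_slice hm hK (sliceInt_eq_zero hv Φ) hl)
      (ae_integrable_slice hm' hK (sliceInt_eq_zero hv Φ') hl')] with z h3 h4
  rw [h3, h4]

theorem locForm_smul_mid (c : ℂ) (φ : ℝ → ℂ) (Φ : Euc d × Euc m × Euc m → ℂ) (ψ : C(Sph d, ℂ)) :
    locForm σ θ v φ (fun y => c * Φ y) ψ = c * locForm σ θ v φ Φ ψ := by
  rw [locForm, locForm, ← form_smul_left]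
  congr 1
  have : sliceInt (fun y => c * Φ y) v = fun z => c * sliceInt Φ v z := by
    funext z
    simp only [sliceInt, mul_assoc]
    rw [integral_const_mul]
  rw [this, pF_const_mul]

/-- The bound of the localized form on slice-bounded functions. -/
def locConst (σ : Measure S) (K : Set (Euc d)) (N : ℝ≥0) : ℝ :=
  (N * (σ univ) ^ (1 / 2 : ℝ) * swapConst σ K N).toReal

/-- Plancherel in `x` turns both transforms back into the slice integral and into `v` itself, for
which the slice bounds are available. -/
theorem norm_locForm_le (hK : IsCompact K) (hv : SliceBounded σ K N v)
    (hθ1 : ∀ z, ‖θ z‖ ≤ 1) {φ : ℝ → ℂ} (hφ : Integrable φ)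
    {Φ : Euc d × Euc m × Euc m → ℂ} (hΦ : StronglyMeasurable Φ) (h2 : MemLp Φ 2 volume)
    (ψ : C(Sph d, ℂ)) :
    ‖locForm σ θ v φ Φ ψ‖ ≤ locConst σ K N * (eLpNorm φ 1 volume).toReal *
      (eLpNorm Φ 2 volume).toReal * ‖ψ‖ := by
  have hm := stronglyMeasurable_sliceInt hΦ hv.meas
  have hl := memLp_sliceInt hv hΦ h2
  have hms := stronglyMeasurable_swapArr hv.meas
  have h := enorm_form_le (α := σ.prod (volume : Measure (Euc m))) (b := symb ψ)
    (θ := fun w => θ (w.1.1, w.2)) (norm_symb_le ψ) (fun _ => hθ1 _) hφ.aestronglyMeasurable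
    (stronglyMeasurable_pF hm).aestronglyMeasurable (stronglyMeasurable_pF hms).aestronglyMeasurable
  rw [eLpNorm_pF hm hK (sliceInt_eq_zero hv Φ) hl,
    eLpNorm_pF hms hK (swapArr_eq_zero hv) (memLp_swapArr hK hv)] at h
  have h' := h.trans (mul_le_mul_right (mul_le_mul' (eLpNorm_sliceInt_le hv hΦ)
    (eLpNorm_swapArr_le hK hv)) _)
  have hφ' : eLpNorm φ 1 volume < ∞ := (memLp_one_iff_integrable.2 hφ).eLpNorm_lt_top
  have h3 := ENNReal.toReal_mono (ENNReal.mul_lt_top (ENNReal.mul_lt_top ENNReal.ofReal_lt_top hφ')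
    (ENNReal.mul_lt_top (sliceConst_lt_top h2.eLpNorm_lt_top) (swapConst_lt_top hK))).ne h'
  rw [toReal_enorm] at h3
  refine h3.trans (le_of_eq ?_)
  simp only [locConst, ENNReal.toReal_mul, ENNReal.toReal_ofReal (norm_nonneg _)]
  ring

theorem isBoundedTrilinear_locForm (hK : IsCompact K) (hv : SliceBounded σ K N v)
    (hθ : StronglyMeasurable θ) (hθ1 : ∀ z, ‖θ z‖ ≤ 1) :
    IsBoundedTrilinear (fun (φ : L1) (Φ : L2 d m) (ψ : C(Sph d, ℂ)) => locForm σ θ v φ Φ ψ)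
      (locConst σ K N) := by
  have hs := memLp_pF (stronglyMeasurable_swapArr hv.meas) hK (swapArr_eq_zero hv)
    (memLp_swapArr hK hv)
  have hX : ∀ Φ : L2 d m, MemLp (pF (sliceInt Φ v)) 2 ((σ.prod volume).prod volume) := fun Φ =>
    memLp_pF (stronglyMeasurable_sliceInt (Lp.stronglyMeasurable Φ) hv.meas) hK
      (sliceInt_eq_zero hv _) (memLp_sliceInt hv (Lp.stronglyMeasurable Φ) (Lp.memLp Φ))
  have hθ' : StronglyMeasurable fun w : (S × Euc m) × ℝ => θ (w.1.1, w.2) :=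
    hθ.comp_measurable (by fun_prop)
  have hφ : ∀ φ : L1, Integrable φ := fun φ => L1.integrable_coeFn φ
  refine ⟨⟨?_, ?_, ?_, ?_, ?_, ?_⟩, ?_⟩
  · intro φ φ' Φ ψ
    rw [locForm_congr ψ (Lp.coeFn_add φ φ') (ae_eq_refl _)]
    exact form_add_fun (stronglyMeasurable_symb ψ) (norm_symb_le ψ) hθ' (fun _ => hθ1 _)
      (hφ φ) (hφ φ') (hX Φ) hs
  · intro c φ Φ ψ
    rw [locForm_congr ψ (Lp.coeFn_smul c φ) (ae_eq_refl _)]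
    exact form_smul_fun c _ _ _
  · intro φ Φ Φ' ψ
    rw [locForm_congr ψ (ae_eq_refl _) (Lp.coeFn_add Φ Φ')]
    exact locForm_add_mid hK hv hθ hθ1 (hφ φ) (Lp.stronglyMeasurable Φ) (Lp.memLp Φ)
      (Lp.stronglyMeasurable Φ') (Lp.memLp Φ') ψ
  · intro c φ Φ ψ
    rw [locForm_congr ψ (ae_eq_refl _) (Lp.coeFn_smul c Φ)]
    exact locForm_smul_mid c _ _ _
  · intro φ Φ ψ ψ'
    have : symb (ψ + ψ') = fun z => symb ψ z + symb ψ' z := funext (symb_add ψ ψ')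
    simp only [locForm, this]
    exact form_add_symbol (stronglyMeasurable_symb ψ) (norm_symb_le ψ) hθ' (fun _ => hθ1 _)
      (stronglyMeasurable_symb ψ') (norm_symb_le ψ') (hφ φ) (hX Φ) hs
  · intro c φ Φ ψ
    have : symb (c • ψ) = fun z => c * symb ψ z := funext (symb_smul c ψ)
    simp only [locForm, this]
    exact form_smul_symbol c _ _ _
  · intro φ Φ ψ
    exact norm_locForm_le hK hv hθ1 (hφ φ) (Lp.stronglyMeasurable Φ) (Lp.memLp Φ) ψ

end LocalizedForm

/-! ### Approximation by trigonometric polynomials. -/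

section TrigonometricApproximation

variable {d m : ℕ}

/-- The character `e^{2πi(⟨x, η⟩ + ⟨l, ζ⟩)}` with frequency `a = (η, ζ)`. -/
def chr (a : Euc d × Euc m) (y : Euc d × Euc m) : ℂ :=
  Real.fourierChar (inner ℝ y.1 a.1 + inner ℝ y.2 a.2)

theorem norm_chr (a y : Euc d × Euc m) : ‖chr a y‖ = 1 := Circle.norm_coe _

theorem continuous_chr (a : Euc d × Euc m) : Continuous (chr a) :=
  continuous_subtype_val.comp (Real.continuous_fourierChar.comp (by fun_prop))

/-- Trigonometric polynomials approximate continuous functions uniformly on compact sets. -/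
theorem exists_chr_sum_near {g : Euc d × Euc m → ℂ} (hg : Continuous g)
    {K : Set (Euc d × Euc m)} (hK : IsCompact K) {ε : ℝ} (hε : 0 < ε) :
    ∃ w : (Euc d × Euc m) →₀ ℂ, ∀ y ∈ K, ‖g y - w.sum fun a z => z * chr a y‖ ≤ ε := by
  -- The product of two Euclidean spaces carries the sup norm and no inner product, so the pairing
  -- that defines the characters is assembled from its components.
  let L : (Euc d × Euc m) →ₗ[ℝ] (Euc d × Euc m) →ₗ[ℝ] ℝ :=
    (innerₗ (Euc d)).compl₁₂ (LinearMap.fst ℝ _ _) (LinearMap.fst ℝ _ _) +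
    (innerₗ (Euc m)).compl₁₂ (LinearMap.snd ℝ _ _) (LinearMap.snd ℝ _ _)
  have hLa : ∀ y a, L y a = inner ℝ y.1 a.1 + inner ℝ y.2 a.2 := fun y a => rfl
  have hL : Continuous fun p : (Euc d × Euc m) × (Euc d × Euc m) => L p.1 p.2 := by
    simp only [hLa]
    fun_prop
  have hL' : ∀ v ≠ 0, L v ≠ 0 := by
    intro v hv h
    apply hv
    have h1 := LinearMap.congr_fun h v
    rw [hLa, LinearMap.zero_apply, real_inner_self_eq_norm_sq, real_inner_self_eq_norm_sq] at h1
    have h2 : ‖v.1‖ = 0 := by nlinarith [sq_nonneg ‖v.1‖, sq_nonneg ‖v.2‖]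
    have h3 : ‖v.2‖ = 0 := by nlinarith [sq_nonneg ‖v.1‖, sq_nonneg ‖v.2‖]
    exact Prod.ext (norm_eq_zero.1 h2) (norm_eq_zero.1 h3)
  -- The value at `1/2` is `-1`.
  have he' : Real.fourierChar ≠ 1 := by
    intro h
    have h1 := congrArg (fun f : AddChar ℝ Circle => ((f (1 / 2 : ℝ) : Circle) : ℂ)) h
    simp only [Real.fourierChar_apply, AddChar.one_apply, Circle.coe_one] at h1
    rw [show ((2 * Real.pi * (1 / 2) : ℝ) : ℂ) * Complex.I = Real.pi * Complex.I by
      push_cast; ring, Complex.exp_pi_mul_I] at h1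
    norm_num at h1
  have hsep := BoundedContinuousFunction.separatesPoints_charPoly
    Real.continuous_fourierChar he' hL hL'
  set A := (BoundedContinuousFunction.charPoly Real.continuous_fourierChar hL).map
    (BoundedContinuousFunction.toContinuousMapStarₐ ℂ) with hA
  have : CompactSpace K := isCompact_iff_compactSpace.1 hK
  let res : C(Euc d × Euc m, ℂ) →⋆ₐ[ℂ] C(K, ℂ) :=
    ContinuousMap.compStarAlgHom' ℂ ℂ ⟨Subtype.val, continuous_subtype_val⟩
  -- Stone-Weierstrass needs a compact space, so the algebra of characters is restricted to `K`,
  -- where it still separates points.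
  have hsep' : (A.map res).SeparatesPoints := by
    intro x y hxy
    obtain ⟨_, ⟨f, hf, rfl⟩, hfxy⟩ := hsep (Subtype.coe_ne_coe.2 hxy)
    exact ⟨_, ⟨res f, ⟨f, hf, rfl⟩, rfl⟩, hfxy⟩
  have htop := ContinuousMap.starSubalgebra_topologicalClosure_eq_top_of_separatesPoints _ hsep'
  have hmem : res ⟨g, hg⟩ ∈ (A.map res).topologicalClosure := by rw [htop]; trivial
  rw [← SetLike.mem_coe, StarSubalgebra.topologicalClosure_coe, Metric.mem_closure_iff] at hmem
  obtain ⟨_, ⟨_, ⟨f, hf, rfl⟩, rfl⟩, hdist⟩ := hmem ε hε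
  obtain ⟨w, hw⟩ := (BoundedContinuousFunction.mem_charPoly f).1 hf
  refine ⟨w.coeff, fun y hy => ?_⟩
  have h1 := (ContinuousMap.dist_apply_le_dist (f := res ⟨g, hg⟩) ⟨y, hy⟩).trans hdist.le
  rw [dist_eq_norm] at h1
  have h2 : f y = w.coeff.sum fun a z => z * chr a y := congrFun hw y
  rw [← h2]
  exact h1

end TrigonometricApproximation

/-- The constant `c` is fixed, while the null sequence may depend on `ε`; this suits a splitting
whose threshold is chosen after `ε`. -/
theorem tendsto_zero_of_norm_le_eps {a : ℕ → ℂ} {c : ℝ}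
    (h : ∀ ε > 0, ∃ b : ℕ → ℝ, Tendsto b atTop (𝓝 0) ∧ ∀ n, ‖a n‖ ≤ ε * c + b n) :
    Tendsto a atTop (𝓝 0) := by
  rw [Metric.tendsto_atTop]
  intro δ hδ
  have hc : 0 < |c| + 1 := by positivity
  obtain ⟨b, hb, hab⟩ := h (δ / 2 / (|c| + 1)) (by positivity)
  obtain ⟨n₀, hn₀⟩ := Metric.tendsto_atTop.1 hb (δ / 2) (by positivity)
  refine ⟨n₀, fun n hn => ?_⟩
  have h1 := hn₀ n hn
  rw [dist_zero_right] at h1 ⊢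
  have h2 : δ / 2 / (|c| + 1) * c ≤ δ / 2 := by
    rw [div_mul_eq_mul_div, div_le_iff₀ hc]
    gcongr
    linarith [le_abs_self c]
  have h3 := (le_abs_self (b n)).trans_lt h1
  linarith [hab n]

theorem norm_form_le {A : Type*} [MeasurableSpace A] {d : ℕ} {α : Measure A} [SFinite α]
    {b : ℝ × Euc d → ℂ} {θ : A × ℝ → ℂ} {C : ℝ} (hC : 0 ≤ C) (hbC : ∀ z, ‖b z‖ ≤ C)
    (hθ1 : ∀ z, ‖θ z‖ ≤ 1) {φ : ℝ → ℂ} (hφ : Integrable φ) {X Y : A × Euc d → ℂ}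
    (hX : MemLp X 2 (α.prod volume)) (hY : MemLp Y 2 (α.prod volume)) :
    ‖form α b θ φ X Y‖ ≤ C * (eLpNorm φ 1 volume).toReal *
      ((eLpNorm X 2 (α.prod volume)).toReal * (eLpNorm Y 2 (α.prod volume)).toReal) := by
  have h := enorm_form_le (α := α) hbC hθ1 hφ.aestronglyMeasurable hX.1 hY.1
  have hφ' : eLpNorm φ 1 volume < ∞ := (memLp_one_iff_integrable.2 hφ).eLpNorm_lt_top
  have h3 := ENNReal.toReal_mono (ENNReal.mul_lt_top (ENNReal.mul_lt_top ENNReal.ofReal_lt_top hφ')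
    (ENNReal.mul_lt_top hX.2 hY.2)).ne h
  rw [toReal_enorm] at h3
  simpa only [ENNReal.toReal_mul, ENNReal.toReal_ofReal hC] using h3

/-! ### Strong convergence of the low frequencies. -/

section LowFrequencies

variable {S : Type*} [MeasurableSpace S] {d m : ℕ} {σ : Measure S} [IsFiniteMeasure σ]

/-- The restriction of `X(a, ξ)` to `‖ξ‖ ≤ R`. -/
def lowPass {A : Type*} {d : ℕ} (R : ℝ) (X : A × Euc d → ℂ) (z : A × Euc d) : ℂ :=
  (Metric.closedBall (0 : Euc d) R).indicator (fun _ => X z) z.2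

theorem lowPass_eq {A : Type*} (R : ℝ) (X : A × Euc d → ℂ) :
    lowPass R X = {z : A × Euc d | z.2 ∈ Metric.closedBall (0 : Euc d) R}.indicator X := by
  funext z
  by_cases h : z.2 ∈ Metric.closedBall (0 : Euc d) R
  · rw [lowPass, indicator_of_mem h, indicator_of_mem (by exact h)]
  · rw [lowPass, indicator_of_notMem h, indicator_of_notMem (by exact h)]

theorem measurableSet_snd_closedBall {A : Type*} [MeasurableSpace A] (R : ℝ) :
    MeasurableSet {z : A × Euc d | z.2 ∈ Metric.closedBall (0 : Euc d) R} :=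
  measurable_snd Metric.isClosed_closedBall.measurableSet

theorem stronglyMeasurable_lowPass {A : Type*} [MeasurableSpace A] (R : ℝ) {X : A × Euc d → ℂ}
    (hX : StronglyMeasurable X) : StronglyMeasurable (lowPass R X) := by
  rw [lowPass_eq]
  exact hX.indicator (measurableSet_snd_closedBall R)

theorem MemLp.lowPass {A : Type*} [MeasurableSpace A] (R : ℝ) {X : A × Euc d → ℂ}
    {μ : Measure (A × Euc d)} (hX : MemLp X 2 μ) : MemLp (lowPass R X) 2 μ := by
  rw [lowPass_eq]
  exact MemLp.indicator (measurableSet_snd_closedBall R) hX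

theorem integrable_mul_of_lintegral_sq {α : Type*} [MeasurableSpace α] {μ : Measure α}
    {f g : α → ℂ} (hf : StronglyMeasurable f) (hg : StronglyMeasurable g)
    (h1 : ∫⁻ a, ‖f a‖ₑ ^ 2 ∂μ < ∞) (h2 : ∫⁻ a, ‖g a‖ₑ ^ 2 ∂μ < ∞) :
    Integrable (fun a => f a * g a) μ := by
  have aux : ∀ {f : α → ℂ}, StronglyMeasurable f → ∫⁻ a, ‖f a‖ₑ ^ 2 ∂μ < ∞ → MemLp f 2 μ := by
    intro f hf h
    refine ⟨hf.aestronglyMeasurable, ?_⟩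
    rw [← eLpNorm_two_sq] at h
    by_contra hc
    rw [not_lt_top_iff.1 hc] at h
    simp at h
  exact MemLp.integrable_mul (aux hf h1) (aux hg h2)

/-- By Fubini, the transform at a fixed frequency is the pairing of `v(s, ·)` with a fixed function
in `L²` of `(x, l)`. This is the quantity that weak convergence controls. -/
theorem pF_sliceInt_eq {Φ : Euc d × Euc m × Euc m → ℂ} (hΦ : StronglyMeasurable Φ)
    {v : S × Euc d × Euc m → ℂ} (hv : StronglyMeasurable v) (s : S) (q : Euc m) (ξ : Euc d)
    (h1 : ∫⁻ y : Euc d × Euc m, ‖Φ (y.1, y.2, q)‖ₑ ^ 2 < ∞)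
    (h2 : ∫⁻ y : Euc d × Euc m, ‖v (s, y)‖ₑ ^ 2 < ∞) :
    pF (sliceInt Φ v) ((s, q), ξ) = ∫ y : Euc d × Euc m,
      (Real.fourierChar (-inner ℝ y.1 ξ) : ℂ) * Φ (y.1, y.2, q) * v (s, y) := by
  have hI := integrable_mul_of_lintegral_sq (f := fun y : Euc d × Euc m => Φ (y.1, y.2, q))
    (g := fun y => v (s, y)) (hΦ.comp_measurable (by fun_prop)) (hv.comp_measurable (by fun_prop))
    h1 h2
  have hc : Continuous fun y : Euc d × Euc m => (Real.fourierChar (-inner ℝ y.1 ξ) : ℂ) :=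
    continuous_subtype_val.comp (Real.continuous_fourierChar.comp (by fun_prop))
  have hI' := hI.bdd_mul (c := 1) hc.aestronglyMeasurable
    (Eventually.of_forall fun y => (Circle.norm_coe _).le)
  simp only [mul_assoc]
  rw [Measure.volume_eq_prod, integral_prod _ hI']
  simp only [pF, Real.fourier_eq, sliceInt, Circle.smul_def, smul_eq_mul]
  congr 1
  funext x
  rw [integral_const_mul]

theorem lintegral_fibre_sq {Φ : Euc d × Euc m × Euc m → ℂ} (hΦ : StronglyMeasurable Φ) :
    ∫⁻ q : Euc m, ∫⁻ y : Euc d × Euc m, ‖Φ (y.1, y.2, q)‖ₑ ^ 2 = eLpNorm Φ 2 volume ^ 2 := by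
  have hm : Measurable fun z => ‖Φ z‖ₑ ^ 2 := hΦ.enorm.pow_const 2
  have hm' : Measurable fun z : (Euc d × Euc m) × Euc m => ‖Φ (z.1.1, z.1.2, z.2)‖ₑ ^ 2 :=
    (hΦ.comp_measurable (by fun_prop)).enorm.pow_const 2
  rw [eLpNorm_two_sq]
  have h1 := (measurePreserving_prodAssoc (volume : Measure (Euc d)) (volume : Measure (Euc m))
    (volume : Measure (Euc m))).lintegral_comp hm
  have h2 := lintegral_prod_symm (μ := (volume : Measure (Euc d)).prod (volume : Measure (Euc m)))
    (ν := (volume : Measure (Euc m))) _ hm'.aemeasurable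
  exact h2.symm.trans h1

/-- If `v n` tends to `0` strongly in `s` and weakly in `(x, l)`, then the low frequencies of the
slice integrals tend to `0` in `L²`. -/
theorem tendsto_eLpNorm_lowPass {v : ℕ → S × Euc d × Euc m → ℂ}
    (hv : ∀ n, StronglyMeasurable (v n)) {B : ℝ≥0∞} (hB : B < ∞)
    (hvB : ∀ n s, ∫⁻ y, ‖v n (s, y)‖ₑ ^ 2 ≤ B)
    (hw : ∀ f : Euc d × Euc m → ℂ, MemLp f 2 volume →
      Tendsto (fun n => ∫⁻ s, ‖∫ y, f y * v n (s, y)‖ₑ ^ 2 ∂σ) atTop (𝓝 0))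
    {Φ : Euc d × Euc m × Euc m → ℂ} (hΦ : StronglyMeasurable Φ) (h2 : MemLp Φ 2 volume) (R : ℝ) :
    Tendsto (fun n => eLpNorm (lowPass R (pF (sliceInt Φ (v n)))) 2
      ((σ.prod (volume : Measure (Euc m))).prod volume)) atTop (𝓝 0) := by
  have hsm : ∀ n, StronglyMeasurable (lowPass R (pF (sliceInt Φ (v n)))) := fun n =>
    stronglyMeasurable_lowPass R (stronglyMeasurable_pF (stronglyMeasurable_sliceInt hΦ (hv n)))
  set h : Euc m → ℝ≥0∞ := fun q => ∫⁻ y : Euc d × Euc m, ‖Φ (y.1, y.2, q)‖ₑ ^ 2 with hh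
  have hhm : Measurable h := by
    have hm' : Measurable fun z : (Euc d × Euc m) × Euc m => ‖Φ (z.1.1, z.1.2, z.2)‖ₑ ^ 2 :=
      (hΦ.comp_measurable (by fun_prop)).enorm.pow_const 2
    exact hm'.lintegral_prod_left'
  have hhfin : ∫⁻ q, h q < ∞ := by
    rw [hh, lintegral_fibre_sq hΦ]
    exact ENNReal.pow_lt_top h2.eLpNorm_lt_top
  have hgood : ∀ᵐ w : Euc m × Euc d, h w.1 < ∞ :=
    Measure.quasiMeasurePreserving_fst.ae (ae_lt_top hhm hhfin.ne)
  have hformula : ∀ n s q ξ, h q < ∞ → pF (sliceInt Φ (v n)) ((s, q), ξ) = ∫ y : Euc d × Euc m,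
      ((Real.fourierChar (-inner ℝ y.1 ξ) : ℂ) * Φ (y.1, y.2, q)) * v n (s, y) :=
    fun n s q ξ hq => pF_sliceInt_eq hΦ (hv n) s q ξ hq ((hvB n s).trans_lt hB)
  have hnorm : ∀ (q : Euc m) (ξ : Euc d), ∫⁻ y : Euc d × Euc m,
      ‖(Real.fourierChar (-inner ℝ y.1 ξ) : ℂ) * Φ (y.1, y.2, q)‖ₑ ^ 2 = h q := by
    intro q ξ
    refine lintegral_congr fun y => ?_
    rw [enorm_mul, ← ofReal_norm (Real.fourierChar _ : ℂ), Circle.norm_coe, ENNReal.ofReal_one,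
      one_mul]
  have hfm : ∀ (q : Euc m) (ξ : Euc d), StronglyMeasurable fun y : Euc d × Euc m =>
      (Real.fourierChar (-inner ℝ y.1 ξ) : ℂ) * Φ (y.1, y.2, q) := by
    intro q ξ
    have hc : Continuous fun y : Euc d × Euc m => (Real.fourierChar (-inner ℝ y.1 ξ) : ℂ) :=
      continuous_subtype_val.comp (Real.continuous_fourierChar.comp (by fun_prop))
    exact hc.stronglyMeasurable.mul (hΦ.comp_measurable (by fun_prop))
  -- Dominated convergence in `(q, ξ)`. Pointwise convergence is the hypothesis `hw`, applied to
  -- `e^{-2πi⟨x, ξ⟩} Φ(x, p, q)`. The majorant comes from Cauchy-Schwarz and does not decay in `ξ`: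
  -- it is integrable only because of the cutoff to a ball.
  have hsq : Tendsto (fun n => ∫⁻ w : Euc m × Euc d, ∫⁻ s,
      ‖lowPass R (pF (sliceInt Φ (v n))) ((s, w.1), w.2)‖ₑ ^ 2 ∂σ) atTop (𝓝 0) := by
    rw [← lintegral_zero (μ := (volume : Measure (Euc m × Euc d)))]
    refine tendsto_lintegral_of_dominated_convergence
      (fun w => h w.1 * ((Metric.closedBall (0 : Euc d) R).indicator
        (fun _ => B * σ univ) w.2)) ?_ ?_ ?_ ?_
    · intro n
      have hm : Measurable fun y : (Euc m × Euc d) × S =>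
          ‖lowPass R (pF (sliceInt Φ (v n))) ((y.2, y.1.1), y.1.2)‖ₑ ^ 2 :=
        ((hsm n).comp_measurable (by fun_prop)).enorm.pow_const 2
      exact hm.lintegral_prod_right'
    · intro n
      filter_upwards [hgood] with w hw1
      by_cases hξ : w.2 ∈ Metric.closedBall (0 : Euc d) R
      · rw [indicator_of_mem hξ]
        calc _ ≤ ∫⁻ _ : S, h w.1 * B ∂σ := by
              refine lintegral_mono fun s => ?_
              rw [lowPass, indicator_of_mem (by exact hξ), hformula n s _ _ hw1]
              refine (pow_le_pow_left' (enorm_integral_le_lintegral_enorm _) 2).trans ?_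
              simp only [enorm_mul _ (v n _)]
              refine (sq_lintegral_mul_le (hfm _ _).enorm.aemeasurable
                ((hv n).comp_measurable (by fun_prop)).enorm.aemeasurable).trans ?_
              rw [hnorm]
              gcongr
              exact hvB n s
          _ = _ := by rw [lintegral_const, mul_assoc]
      · simp [lowPass, indicator_of_notMem hξ]
    · rw [Measure.volume_eq_prod, lintegral_prod_mul hhm.aemeasurable
        ((measurable_const.indicator Metric.isClosed_closedBall.measurableSet).aemeasurable),
        lintegral_indicator_const Metric.isClosed_closedBall.measurableSet]
      exact (ENNReal.mul_lt_top hhfin (ENNReal.mul_lt_top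
        (ENNReal.mul_lt_top hB (measure_lt_top _ _)) measure_closedBall_lt_top)).ne
    · filter_upwards [hgood] with w hw1
      by_cases hξ : w.2 ∈ Metric.closedBall (0 : Euc d) R
      · simp only [lowPass, indicator_of_mem hξ, hformula _ _ _ _ hw1]
        refine hw _ ⟨(hfm _ _).aestronglyMeasurable, ?_⟩
        refine (eLpNorm_two_le_of_sq_le (c := h w.1 ^ (1 / 2 : ℝ)) ?_).trans_lt
          (ENNReal.rpow_lt_top_of_nonneg (by norm_num) hw1.ne)
        rw [hnorm, rpow_half_sq]
      · simp [lowPass, indicator_of_notMem hξ]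
  have hconv : ∀ n, eLpNorm (lowPass R (pF (sliceInt Φ (v n)))) 2
      ((σ.prod (volume : Measure (Euc m))).prod volume) =
      (∫⁻ w : Euc m × Euc d, ∫⁻ s,
        ‖lowPass R (pF (sliceInt Φ (v n))) ((s, w.1), w.2)‖ₑ ^ 2 ∂σ) ^ (1 / 2 : ℝ) := by
    intro n
    have hm : Measurable fun z => ‖lowPass R (pF (sliceInt Φ (v n))) z‖ₑ ^ 2 :=
      (hsm n).enorm.pow_const 2
    have hm' : Measurable fun z : S × Euc m × Euc d =>
        ‖lowPass R (pF (sliceInt Φ (v n))) ((z.1, z.2.1), z.2.2)‖ₑ ^ 2 :=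
      ((hsm n).comp_measurable (by fun_prop)).enorm.pow_const 2
    have h1 := (measurePreserving_prodAssoc σ (volume : Measure (Euc m))
      (volume : Measure (Euc d))).symm.lintegral_comp hm
    have h3 := lintegral_prod_symm (μ := σ)
      (ν := (volume : Measure (Euc m)).prod (volume : Measure (Euc d))) _ hm'.aemeasurable
    have h4 : eLpNorm (lowPass R (pF (sliceInt Φ (v n)))) 2
      ((σ.prod (volume : Measure (Euc m))).prod volume) ^ 2 = ∫⁻ w : Euc m × Euc d, ∫⁻ s,
        ‖lowPass R (pF (sliceInt Φ (v n))) ((s, w.1), w.2)‖ₑ ^ 2 ∂σ := by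
      rw [eLpNorm_two_sq]
      exact h1.symm.trans h3
    rw [← h4, ← ENNReal.rpow_natCast, ← ENNReal.rpow_mul]
    norm_num
  simp only [hconv]
  have := hsq.ennrpow_const (1 / 2 : ℝ)
  simpa using this

end LowFrequencies

/-! ### The commutator lemma. -/

section Commutator

variable {S : Type*} [MeasurableSpace S] {d m : ℕ}

/-- `(s, x, l) ↦ f(x, l) v(s, x, l)`. -/
def mulL (f : Euc d × Euc m → ℂ) (v : S × Euc d × Euc m → ℂ) (z : S × Euc d × Euc m) : ℂ :=
  f z.2 * v z

/-- `(x, p, q) ↦ Φ(x, p, q) conj (f(x, q))`. -/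
def mulConj (Φ : Euc d × Euc m × Euc m → ℂ) (f : Euc d × Euc m → ℂ) (y : Euc d × Euc m × Euc m) :
    ℂ :=
  Φ y * (starRingEnd ℂ) (f (y.1, y.2.2))

/-- The form with the multiplication by `f` inside the second Fourier transform. -/
def crossForm (σ : Measure S) (θ : S × ℝ → ℂ) (v : S × Euc d × Euc m → ℂ) (φ : ℝ → ℂ)
    (Φ : Euc d × Euc m × Euc m → ℂ) (f : Euc d × Euc m → ℂ) (ψ : C(Sph d, ℂ)) : ℂ :=
  form (σ.prod (volume : Measure (Euc m))) (symb ψ) (fun w => θ (w.1.1, w.2)) φ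
    (pF (sliceInt Φ v)) (pF (swapArr (mulL f v)))

/-- The error in moving the multiplication by `f` from one side to the other. -/
def commForm (σ : Measure S) (θ : S × ℝ → ℂ) (v : S × Euc d × Euc m → ℂ) (φ : ℝ → ℂ)
    (Φ : Euc d × Euc m × Euc m → ℂ) (f : Euc d × Euc m → ℂ) (ψ : C(Sph d, ℂ)) : ℂ :=
  crossForm σ θ v φ Φ f ψ - locForm σ θ v φ (mulConj Φ f) ψ

variable {σ : Measure S} [IsFiniteMeasure σ] {K : Set (Euc d)} {N : ℝ≥0}
  {v : S × Euc d × Euc m → ℂ} {θ : S × ℝ → ℂ}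

theorem SliceBounded.mulL (hv : SliceBounded σ K N v) {f : Euc d × Euc m → ℂ}
    (hf : StronglyMeasurable f) {c : ℝ≥0} (hc : ∀ y, ‖f y‖ ≤ c) :
    SliceBounded σ K (c * N) (mulL f v) := by
  refine ⟨(hf.comp_measurable (by fun_prop)).mul hv.meas, fun s x l hx => ?_, ?_⟩
  · simp [HMeas.mulL, hv.supp s x l hx]
  · filter_upwards [hv.bound] with w hw
    calc _ ≤ ∫⁻ l, (c : ℝ≥0∞) ^ 2 * ‖v (w.1, w.2, l)‖ₑ ^ 2 := by
          refine lintegral_mono fun l => ?_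
          simp only [HMeas.mulL, enorm_mul, mul_pow]
          gcongr
          rw [← ofReal_norm]
          exact (ENNReal.ofReal_le_ofReal (hc _)).trans (by simp)
      _ = (c : ℝ≥0∞) ^ 2 * ∫⁻ l, ‖v (w.1, w.2, l)‖ₑ ^ 2 :=
          lintegral_const_mul' _ _ (by simp)
      _ ≤ _ := by
          rw [ENNReal.coe_mul, mul_pow]
          gcongr

theorem stronglyMeasurable_mulConj {Φ : Euc d × Euc m × Euc m → ℂ} (hΦ : StronglyMeasurable Φ)
    {f : Euc d × Euc m → ℂ} (hf : StronglyMeasurable f) : StronglyMeasurable (mulConj Φ f) :=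
  hΦ.mul ((hf.comp_measurable (by fun_prop)).star)

theorem eLpNorm_mulConj_le (Φ : Euc d × Euc m × Euc m → ℂ) {f : Euc d × Euc m → ℂ} {c : ℝ≥0}
    (hc : ∀ y, ‖f y‖ ≤ c) : eLpNorm (mulConj Φ f) 2 volume ≤ c * eLpNorm Φ 2 volume := by
  refine eLpNorm_le_nnreal_smul_eLpNorm_of_ae_le_mul (Eventually.of_forall fun y => ?_) 2
  rw [← NNReal.coe_le_coe]
  simp only [mulConj, nnnorm_mul, NNReal.coe_mul, coe_nnnorm, RCLike.norm_conj]
  rw [mul_comm]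
  gcongr
  exact hc _

theorem memLp_mulConj {Φ : Euc d × Euc m × Euc m → ℂ} (hΦ : StronglyMeasurable Φ)
    (h2 : MemLp Φ 2 volume) {f : Euc d × Euc m → ℂ} (hf : StronglyMeasurable f) {c : ℝ≥0}
    (hc : ∀ y, ‖f y‖ ≤ c) : MemLp (mulConj Φ f) 2 volume :=
  ⟨(stronglyMeasurable_mulConj hΦ hf).aestronglyMeasurable, (eLpNorm_mulConj_le Φ hc).trans_lt
    (ENNReal.mul_lt_top ENNReal.coe_lt_top h2.eLpNorm_lt_top)⟩

theorem memLp_pF_sliceInt (hK : IsCompact K) (hv : SliceBounded σ K N v)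
    {Φ : Euc d × Euc m × Euc m → ℂ} (hΦ : StronglyMeasurable Φ) (h2 : MemLp Φ 2 volume) :
    MemLp (pF (sliceInt Φ v)) 2 ((σ.prod volume).prod volume) :=
  memLp_pF (stronglyMeasurable_sliceInt hΦ hv.meas) hK (sliceInt_eq_zero hv Φ)
    (memLp_sliceInt hv hΦ h2)

theorem toReal_eLpNorm_pF_sliceInt_le (hK : IsCompact K) (hv : SliceBounded σ K N v)
    {Φ : Euc d × Euc m × Euc m → ℂ} (hΦ : StronglyMeasurable Φ) (h2 : MemLp Φ 2 volume) :
    (eLpNorm (pF (sliceInt Φ v)) 2 ((σ.prod volume).prod volume)).toReal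
      ≤ (N * (σ univ) ^ (1 / 2 : ℝ) * eLpNorm Φ 2 volume).toReal := by
  rw [eLpNorm_pF (stronglyMeasurable_sliceInt hΦ hv.meas) hK (sliceInt_eq_zero hv Φ)
    (memLp_sliceInt hv hΦ h2)]
  exact ENNReal.toReal_mono (sliceConst_lt_top h2.eLpNorm_lt_top).ne (eLpNorm_sliceInt_le hv hΦ)

theorem memLp_pF_swapArr (hK : IsCompact K) (hv : SliceBounded σ K N v) :
    MemLp (pF (swapArr v)) 2 ((σ.prod volume).prod volume) :=
  memLp_pF (stronglyMeasurable_swapArr hv.meas) hK (swapArr_eq_zero hv) (memLp_swapArr hK hv)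

theorem toReal_eLpNorm_pF_swapArr_le (hK : IsCompact K) (hv : SliceBounded σ K N v) :
    (eLpNorm (pF (swapArr v)) 2 ((σ.prod volume).prod volume)).toReal
      ≤ (swapConst σ K N).toReal := by
  rw [eLpNorm_pF (stronglyMeasurable_swapArr hv.meas) hK (swapArr_eq_zero hv)
    (memLp_swapArr hK hv)]
  exact ENNReal.toReal_mono (swapConst_lt_top hK).ne (eLpNorm_swapArr_le hK hv)

theorem swapConst_mul (c : ℝ≥0) : swapConst σ K (c * N) = c * swapConst σ K N := by
  simp only [swapConst, ENNReal.coe_mul, mul_assoc]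

/-- The two forms are estimated separately, hence the factor `2`. The bound is linear in the sup
norm of the multiplier and does not involve `v` beyond its slice bound, so uniform approximation of
the multiplier is uniform over the sequence. -/
theorem norm_commForm_le (hK : IsCompact K) (hv : SliceBounded σ K N v)
    (hθ1 : ∀ z, ‖θ z‖ ≤ 1) {φ : ℝ → ℂ} (hφ : Integrable φ)
    {Φ : Euc d × Euc m × Euc m → ℂ} (hΦ : StronglyMeasurable Φ) (h2 : MemLp Φ 2 volume)
    {f : Euc d × Euc m → ℂ} (hf : StronglyMeasurable f) {c : ℝ≥0} (hc : ∀ y, ‖f y‖ ≤ c)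
    (ψ : C(Sph d, ℂ)) :
    ‖commForm σ θ v φ Φ f ψ‖ ≤ c * (2 * (locConst σ K N * (eLpNorm φ 1 volume).toReal *
      (eLpNorm Φ 2 volume).toReal * ‖ψ‖)) := by
  have h1 : ‖crossForm σ θ v φ Φ f ψ‖ ≤ c * (locConst σ K N * (eLpNorm φ 1 volume).toReal *
      (eLpNorm Φ 2 volume).toReal * ‖ψ‖) := by
    refine (norm_form_le (norm_nonneg ψ) (norm_symb_le ψ) (fun _ => hθ1 _) hφ
      (memLp_pF_sliceInt hK hv hΦ h2) (memLp_pF_swapArr hK (hv.mulL hf hc))).trans ?_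
    calc _ ≤ ‖ψ‖ * (eLpNorm φ 1 volume).toReal *
          ((N * (σ univ) ^ (1 / 2 : ℝ) * eLpNorm Φ 2 volume).toReal *
            (swapConst σ K (c * N)).toReal) := by
          exact mul_le_mul_of_nonneg_left (mul_le_mul (toReal_eLpNorm_pF_sliceInt_le hK hv hΦ h2)
            (toReal_eLpNorm_pF_swapArr_le hK (hv.mulL hf hc)) ENNReal.toReal_nonneg
            ENNReal.toReal_nonneg) (mul_nonneg (norm_nonneg _) ENNReal.toReal_nonneg)
      _ = _ := by
          rw [swapConst_mul]
          simp only [locConst, ENNReal.toReal_mul, ENNReal.coe_toReal]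
          ring
  have h3 : ‖locForm σ θ v φ (mulConj Φ f) ψ‖ ≤ c * (locConst σ K N *
      (eLpNorm φ 1 volume).toReal * (eLpNorm Φ 2 volume).toReal * ‖ψ‖) := by
    refine (norm_locForm_le hK hv hθ1 hφ (stronglyMeasurable_mulConj hΦ hf)
      (memLp_mulConj hΦ h2 hf hc) ψ).trans ?_
    have h4 : (eLpNorm (mulConj Φ f) 2 volume).toReal ≤ c * (eLpNorm Φ 2 volume).toReal := by
      have := ENNReal.toReal_mono (ENNReal.mul_lt_top ENNReal.coe_lt_top h2.eLpNorm_lt_top).ne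
        (eLpNorm_mulConj_le Φ hc)
      simpa using this
    have h5 : 0 ≤ locConst σ K N := ENNReal.toReal_nonneg
    calc _ ≤ locConst σ K N * (eLpNorm φ 1 volume).toReal *
          (c * (eLpNorm Φ 2 volume).toReal) * ‖ψ‖ := by gcongr
      _ = _ := by ring
  calc _ ≤ ‖crossForm σ θ v φ Φ f ψ‖ + ‖locForm σ θ v φ (mulConj Φ f) ψ‖ := norm_sub_le _ _
    _ ≤ _ := by linarith

theorem commForm_add (hK : IsCompact K) (hv : SliceBounded σ K N v)
    (hθ : StronglyMeasurable θ) (hθ1 : ∀ z, ‖θ z‖ ≤ 1) {φ : ℝ → ℂ} (hφ : Integrable φ)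
    {Φ : Euc d × Euc m × Euc m → ℂ} (hΦ : StronglyMeasurable Φ) (h2 : MemLp Φ 2 volume)
    {f f' : Euc d × Euc m → ℂ} (hf : StronglyMeasurable f) {c : ℝ≥0} (hc : ∀ y, ‖f y‖ ≤ c)
    (hf' : StronglyMeasurable f') {c' : ℝ≥0} (hc' : ∀ y, ‖f' y‖ ≤ c') (ψ : C(Sph d, ℂ)) :
    commForm σ θ v φ Φ (fun y => f y + f' y) ψ =
      commForm σ θ v φ Φ f ψ + commForm σ θ v φ Φ f' ψ := by
  have hθ' : StronglyMeasurable fun w : (S × Euc m) × ℝ => θ (w.1.1, w.2) :=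
    hθ.comp_measurable (by fun_prop)
  have h1 : crossForm σ θ v φ Φ (fun y => f y + f' y) ψ =
      crossForm σ θ v φ Φ f ψ + crossForm σ θ v φ Φ f' ψ := by
    rw [crossForm, crossForm, crossForm, ← form_add_right (stronglyMeasurable_symb ψ)
      (norm_symb_le ψ) hθ' (fun _ => hθ1 _) hφ (memLp_pF_sliceInt hK hv hΦ h2)
      (memLp_pF_swapArr hK (hv.mulL hf hc)) (memLp_pF_swapArr hK (hv.mulL hf' hc'))]
    refine form_congr (ae_eq_refl _) ?_
    have h3 : swapArr (mulL (fun y => f y + f' y) v) =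
        fun z => swapArr (mulL f v) z + swapArr (mulL f' v) z := by
      funext z
      simp only [swapArr, mulL, add_mul]
    have i1 := ae_integrable_slice (stronglyMeasurable_swapArr (hv.mulL hf hc).meas) hK
      (swapArr_eq_zero (hv.mulL hf hc)) (memLp_swapArr hK (hv.mulL hf hc))
    have i2 := ae_integrable_slice (stronglyMeasurable_swapArr (hv.mulL hf' hc').meas) hK
      (swapArr_eq_zero (hv.mulL hf' hc')) (memLp_swapArr hK (hv.mulL hf' hc'))
    rw [h3]
    filter_upwards [pF_add_ae i1 i2] with z hz
    rw [hz]
  have h4 : mulConj Φ (fun y => f y + f' y) = fun y => mulConj Φ f y + mulConj Φ f' y := by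
    funext y
    simp only [mulConj, map_add, mul_add]
  rw [commForm, commForm, commForm, h1, h4, locForm_add_mid hK hv hθ hθ1 hφ
    (stronglyMeasurable_mulConj hΦ hf) (memLp_mulConj hΦ h2 hf hc)
    (stronglyMeasurable_mulConj hΦ hf') (memLp_mulConj hΦ h2 hf' hc')]
  ring

theorem commForm_smul (c : ℂ) (φ : ℝ → ℂ) (Φ : Euc d × Euc m × Euc m → ℂ)
    (f : Euc d × Euc m → ℂ) (ψ : C(Sph d, ℂ)) :
    commForm σ θ v φ Φ (fun y => c * f y) ψ = (starRingEnd ℂ) c * commForm σ θ v φ Φ f ψ := by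
  have h1 : swapArr (mulL (fun y => c * f y) v) = fun z => c * swapArr (mulL f v) z := by
    funext z
    simp only [swapArr, mulL, mul_assoc]
  have h2 : mulConj Φ (fun y => c * f y) = fun y => (starRingEnd ℂ) c * mulConj Φ f y := by
    funext y
    simp only [mulConj, map_mul]
    ring
  rw [commForm, commForm, h2, locForm_smul_mid, mul_sub]
  congr 1
  rw [crossForm, crossForm, h1, pF_const_mul, ← form_smul_left]
  refine form_congr (ae_eq_refl _) (Eventually.of_forall fun z => ?_)
  simp only [map_mul]
  ring

/-- Only the values of the multiplier on the support of `v` matter. -/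
theorem commForm_indicator {Λ : Set (Euc m)} (hvK : ∀ s x l, x ∉ K → v (s, x, l) = 0)
    (hvΛ : ∀ s x l, l ∉ Λ → v (s, x, l) = 0) (φ : ℝ → ℂ) (Φ : Euc d × Euc m × Euc m → ℂ)
    (f : Euc d × Euc m → ℂ) (ψ : C(Sph d, ℂ)) :
    commForm σ θ v φ Φ ((K ×ˢ Λ).indicator f) ψ = commForm σ θ v φ Φ f ψ := by
  have hv0 : ∀ s (y : Euc d × Euc m), y ∉ K ×ˢ Λ → v (s, y) = 0 := by
    rintro s ⟨x, l⟩ hy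
    by_cases hx : x ∈ K
    · exact hvΛ s x l fun hl => hy ⟨hx, hl⟩
    · exact hvK s x l hx
  have h1 : mulL ((K ×ˢ Λ).indicator f) v = mulL f v := by
    funext z
    by_cases hz : z.2 ∈ K ×ˢ Λ
    · rw [mulL, mulL, indicator_of_mem hz]
    · simp [mulL, hv0 z.1 z.2 hz]
  rw [commForm, commForm, crossForm, crossForm, h1]
  congr 1
  refine form_congr (ae_eq_refl _) (Eventually.of_forall fun z => ?_)
  -- For `q ∈ Λ` the multipliers agree at every `x ∈ K`, and elsewhere `v` vanishes. For `q ∉ Λ` the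
  -- first factors may differ, but the transform of `v(·, q)` is `0`.
  by_cases hq : z.1.2 ∈ Λ
  · congr 1
    refine pF_eq_of_ae_eq (a := z.1) (Eventually.of_forall fun x => ?_) z.2
    simp only [sliceInt]
    congr 1
    funext p
    by_cases hx : x ∈ K
    · rw [mulConj, mulConj, indicator_of_mem (by exact ⟨hx, hq⟩)]
    · simp [hvK _ _ _ hx]
  · have : pF (swapArr v) z = pF (fun _ => 0) z :=
      pF_eq_of_ae_eq (a := z.1) (Eventually.of_forall fun x => hvΛ _ _ _ hq) z.2
    rw [this]
    simp [pF, Real.fourier_eq]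

theorem fourierChar_mul_eq (a b : ℝ) :
    (Real.fourierChar a : ℂ) * Real.fourierChar b = Real.fourierChar (a + b) := by
  rw [AddChar.map_add_eq_mul, Circle.coe_mul]

theorem conj_fourierChar (a : ℝ) :
    (starRingEnd ℂ) (Real.fourierChar a : ℂ) = Real.fourierChar (-a) := by
  rw [AddChar.map_neg_eq_inv, Circle.coe_inv_eq_conj]

/-- Modulation becomes translation in frequency. Only the `x` part of the character translates; its
`l` part is a phase in `q`, which leaves the integral over `x`. -/
theorem pF_swapArr_mulL_chr (a : Euc d × Euc m) (v : S × Euc d × Euc m → ℂ)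
    (z : (S × Euc m) × Euc d) :
    pF (swapArr (mulL (chr a) v)) z =
      (Real.fourierChar (inner ℝ z.1.2 a.2) : ℂ) * pF (swapArr v) (z.1, z.2 - a.1) := by
  simp only [pF, Real.fourier_eq, swapArr, mulL, chr, Circle.smul_def, smul_eq_mul]
  rw [← integral_const_mul]
  congr 1
  funext x
  rw [← mul_assoc, ← mul_assoc, fourierChar_mul_eq, fourierChar_mul_eq, inner_sub_right]
  congr 3
  ring

/-- The conjugate character translates in the opposite direction. It is taken at `(x, q)`, hence
does not interfere with the integration over `p`. -/
theorem pF_sliceInt_mulConj_chr (a : Euc d × Euc m) (Φ : Euc d × Euc m × Euc m → ℂ)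
    (v : S × Euc d × Euc m → ℂ) (z : (S × Euc m) × Euc d) :
    pF (sliceInt (mulConj Φ (chr a)) v) z =
      (starRingEnd ℂ) (Real.fourierChar (inner ℝ z.1.2 a.2) : ℂ) *
        pF (sliceInt Φ v) (z.1, z.2 + a.1) := by
  have h : ∀ (w : S × Euc m) (x : Euc d), sliceInt (mulConj Φ (chr a)) v (w, x) =
      (Real.fourierChar (-inner ℝ x a.1 - inner ℝ w.2 a.2) : ℂ) * sliceInt Φ v (w, x) := by
    intro w x
    simp only [sliceInt, mulConj, chr, conj_fourierChar]
    rw [← integral_const_mul]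
    congr 1
    funext p
    rw [neg_add']
    ring
  simp only [pF, Real.fourier_eq, Circle.smul_def, smul_eq_mul, h, conj_fourierChar]
  rw [← integral_const_mul]
  congr 1
  funext x
  rw [← mul_assoc, ← mul_assoc, fourierChar_mul_eq, fourierChar_mul_eq, inner_add_right]
  congr 3
  ring

/-- For a character, the commutator has the symbol `ψ(ξ/|ξ|) - ψ((ξ-η)/|ξ-η|)`. -/
theorem commForm_chr (hK : IsCompact K) (hv : SliceBounded σ K N v)
    (hθ : StronglyMeasurable θ) (hθ1 : ∀ z, ‖θ z‖ ≤ 1) {φ : ℝ → ℂ} (hφ : Integrable φ)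
    {Φ : Euc d × Euc m × Euc m → ℂ} (hΦ : StronglyMeasurable Φ) (h2 : MemLp Φ 2 volume)
    (a : Euc d × Euc m) (ψ : C(Sph d, ℂ)) :
    commForm σ θ v φ Φ (chr a) ψ = form (σ.prod (volume : Measure (Euc m)))
      (fun z => symb ψ z + -symb ψ (z.1, z.2 - a.1)) (fun w => θ (w.1.1, w.2)) φ
      (pF (sliceInt Φ v)) (pF (swapArr (mulL (chr a) v))) := by
  have hθ' : StronglyMeasurable fun w : (S × Euc m) × ℝ => θ (w.1.1, w.2) :=
    hθ.comp_measurable (by fun_prop)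
  have hsh : StronglyMeasurable fun z : ℝ × Euc d => -symb ψ (z.1, z.2 - a.1) :=
    ((stronglyMeasurable_symb ψ).comp_measurable
      (g := fun z : ℝ × Euc d => (z.1, z.2 - a.1)) (by fun_prop)).neg
  have hX := memLp_pF_sliceInt hK hv hΦ h2
  have hY := memLp_pF_swapArr hK (hv.mulL (continuous_chr a).stronglyMeasurable (c := 1)
    (fun y => (norm_chr a y).le))
  rw [form_add_symbol (stronglyMeasurable_symb ψ) (norm_symb_le ψ) hθ' (fun _ => hθ1 _) hsh
    (C' := ‖ψ‖) (fun z => by rw [norm_neg]; exact norm_symb_le ψ _) hφ hX hY, commForm,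
    sub_eq_add_neg]
  congr 1
  have hneg : form (σ.prod (volume : Measure (Euc m))) (fun z => -symb ψ (z.1, z.2 - a.1))
      (fun w => θ (w.1.1, w.2)) φ (pF (sliceInt Φ v)) (pF (swapArr (mulL (chr a) v))) =
      -form (σ.prod (volume : Measure (Euc m))) (fun z => symb ψ (z.1, z.2 - a.1))
      (fun w => θ (w.1.1, w.2)) φ (pF (sliceInt Φ v)) (pF (swapArr (mulL (chr a) v))) := by
    have := form_smul_symbol (α := σ.prod (volume : Measure (Euc m)))
      (b := fun z => symb ψ (z.1, z.2 - a.1)) (θ := fun w => θ (w.1.1, w.2)) (-1) φ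
      (pF (sliceInt Φ v)) (pF (swapArr (mulL (chr a) v)))
    simpa using this
  rw [hneg]
  congr 1
  -- The substitution `ξ' ↦ ξ' - η` undoes the translation of the first factor and creates that of
  -- the second. The phases in `q` then match, and only the symbol remains shifted.
  have hmp : MeasurePreserving
      (fun y : ℝ × (S × Euc m) × Euc d => (y.1, y.2.1, y.2.2 - a.1))
      ((volume : Measure ℝ).prod ((σ.prod volume).prod volume))
      ((volume : Measure ℝ).prod ((σ.prod volume).prod volume)) :=
    (MeasurePreserving.id _).prod ((MeasurePreserving.id _).prod
      (measurePreserving_sub_right volume a.1))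
  have hI := integrable_formFun (stronglyMeasurable_symb ψ) (norm_symb_le ψ) hθ' (fun _ => hθ1 _)
    hφ (memLp_pF_sliceInt hK hv (stronglyMeasurable_mulConj hΦ
      (continuous_chr a).stronglyMeasurable) (memLp_mulConj hΦ h2
      (continuous_chr a).stronglyMeasurable (c := 1) (fun y => (norm_chr a y).le)))
    (memLp_pF_swapArr hK hv)
  rw [locForm, form, ← hmp.map_eq, integral_map hmp.measurable.aemeasurable
    (by rw [hmp.map_eq]; exact hI.1), form]
  congr 1
  funext y
  simp only [formFun, pF_sliceInt_mulConj_chr, pF_swapArr_mulL_chr, map_mul, sub_add_cancel]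
  ring

theorem form_lowPass {A : Type*} [MeasurableSpace A] {α : Measure A} (b : ℝ × Euc d → ℂ)
    (θ : A × ℝ → ℂ) (φ : ℝ → ℂ) (X Y : A × Euc d → ℂ) (R : ℝ) :
    form α (lowPass R b) θ φ X Y = form α b θ φ (lowPass R X) Y := by
  rw [form, form]
  congr 1
  funext y
  by_cases h : y.2.2 ∈ Metric.closedBall (0 : Euc d) R
  · simp only [formFun, lowPass, indicator_of_mem h]
  · simp only [formFun, lowPass, indicator_of_notMem h]
    ring

/-- For `‖ξ'‖ > R` the symbol of the commutator is at most `ε`. For `‖ξ'‖ ≤ R` the cutoff passes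
from the symbol to the first factor, which tends to `0` in `L²`, while the second factor stays
bounded. -/
theorem tendsto_commForm_chr {v : ℕ → S × Euc d × Euc m → ℂ} (hK : IsCompact K)
    (hv : ∀ n, SliceBounded σ K N (v n)) {B : ℝ≥0∞} (hB : B < ∞)
    (hvB : ∀ n s, ∫⁻ y, ‖v n (s, y)‖ₑ ^ 2 ≤ B)
    (hw : ∀ f : Euc d × Euc m → ℂ, MemLp f 2 volume →
      Tendsto (fun n => ∫⁻ s, ‖∫ y, f y * v n (s, y)‖ₑ ^ 2 ∂σ) atTop (𝓝 0))
    (hθ : StronglyMeasurable θ) (hθ1 : ∀ z, ‖θ z‖ ≤ 1) {φ : ℝ → ℂ} (hφ : Integrable φ)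
    {Φ : Euc d × Euc m × Euc m → ℂ} (hΦ : StronglyMeasurable Φ) (h2 : MemLp Φ 2 volume)
    (a : Euc d × Euc m) (ψ : C(Sph d, ℂ)) :
    Tendsto (fun n => commForm σ θ (v n) φ Φ (chr a) ψ) atTop (𝓝 0) := by
  have hθ' : StronglyMeasurable fun w : (S × Euc m) × ℝ => θ (w.1.1, w.2) :=
    hθ.comp_measurable (by fun_prop)
  have hvc : ∀ n, SliceBounded σ K (1 * N) (mulL (chr a) (v n)) := fun n =>
    (hv n).mulL (continuous_chr a).stronglyMeasurable (fun y => (norm_chr a y).le)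
  set Cφ : ℝ := (eLpNorm φ 1 volume).toReal with hCφ
  set CX : ℝ := (N * (σ univ) ^ (1 / 2 : ℝ) * eLpNorm Φ 2 volume).toReal with hCX
  set CY : ℝ := (swapConst σ K (1 * N)).toReal with hCY
  refine tendsto_zero_of_norm_le_eps (c := Cφ * (CX * CY)) fun ε hε => ?_
  obtain ⟨R, hR⟩ := symb_slowly_varying ψ a.1 hε
  set b : ℝ × Euc d → ℂ := fun z => symb ψ z + -symb ψ (z.1, z.2 - a.1) with hb
  have hbm : StronglyMeasurable b := (stronglyMeasurable_symb ψ).add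
    ((stronglyMeasurable_symb ψ).comp_measurable
      (g := fun z : ℝ × Euc d => (z.1, z.2 - a.1)) (by fun_prop)).neg
  have hbC : ∀ z, ‖b z‖ ≤ 2 * ‖ψ‖ := fun z => by
    refine (norm_add_le _ _).trans ?_
    rw [norm_neg]
    linarith [norm_symb_le ψ z, norm_symb_le ψ (z.1, z.2 - a.1)]
  have hlow : StronglyMeasurable (lowPass R b) := stronglyMeasurable_lowPass R hbm
  have hlowC : ∀ z, ‖lowPass R b z‖ ≤ 2 * ‖ψ‖ := fun z => by
    by_cases h : z.2 ∈ Metric.closedBall (0 : Euc d) R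
    · rw [lowPass, indicator_of_mem h]; exact hbC z
    · rw [lowPass, indicator_of_notMem h, norm_zero]; positivity
  have hhigh : StronglyMeasurable fun z => b z - lowPass R b z := hbm.sub hlow
  have hhighC : ∀ z, ‖b z - lowPass R b z‖ ≤ ε := fun z => by
    by_cases h : z.2 ∈ Metric.closedBall (0 : Euc d) R
    · rw [lowPass, indicator_of_mem h, sub_self, norm_zero]; exact hε.le
    · rw [lowPass, indicator_of_notMem h, sub_zero, hb]
      rw [mem_closedBall_zero_iff, not_le] at h
      simpa only [← sub_eq_add_neg] using hR z.1 z.2 h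
  refine ⟨fun n => 2 * ‖ψ‖ * Cφ * ((eLpNorm (lowPass R (pF (sliceInt Φ (v n)))) 2
    ((σ.prod (volume : Measure (Euc m))).prod volume)).toReal * CY), ?_, fun n => ?_⟩
  · have h1 := tendsto_eLpNorm_lowPass (fun n => (hv n).meas) hB hvB hw hΦ h2 R
    have h3 := (ENNReal.tendsto_toReal ENNReal.zero_ne_top).comp h1
    have h4 := (h3.mul_const CY).const_mul (2 * ‖ψ‖ * Cφ)
    simpa using h4
  · have hX := memLp_pF_sliceInt hK (hv n) hΦ h2
    have hY := memLp_pF_swapArr hK (hvc n)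
    have hXl := toReal_eLpNorm_pF_sliceInt_le hK (hv n) hΦ h2
    have hYl := toReal_eLpNorm_pF_swapArr_le hK (hvc n)
    have hsplit : b = fun z => (b z - lowPass R b z) + lowPass R b z := by
      funext z; ring
    rw [commForm_chr hK (hv n) hθ hθ1 hφ hΦ h2, ← hb, hsplit,
      form_add_symbol hhigh hhighC hθ' (fun _ => hθ1 _) hlow hlowC hφ hX hY, form_lowPass]
    refine (norm_add_le _ _).trans (add_le_add ?_ ?_)
    · refine (norm_form_le hε.le hhighC (fun _ => hθ1 _) hφ hX hY).trans ?_
      rw [mul_assoc]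
      gcongr
    · refine (norm_form_le (by positivity) hbC (fun _ => hθ1 _) hφ (MemLp.lowPass R hX) hY).trans ?_
      exact mul_le_mul_of_nonneg_left (mul_le_mul_of_nonneg_left hYl ENNReal.toReal_nonneg)
        (mul_nonneg (by positivity) ENNReal.toReal_nonneg)

/-- The commutator with a continuous function tends to `0`. -/
theorem tendsto_commForm {v : ℕ → S × Euc d × Euc m → ℂ} (hK : IsCompact K)
    (hv : ∀ n, SliceBounded σ K N (v n)) {Λ : Set (Euc m)} (hΛ : IsCompact Λ)
    (hvΛ : ∀ n s x l, l ∉ Λ → v n (s, x, l) = 0) {B : ℝ≥0∞} (hB : B < ∞)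
    (hvB : ∀ n s, ∫⁻ y, ‖v n (s, y)‖ₑ ^ 2 ≤ B)
    (hw : ∀ f : Euc d × Euc m → ℂ, MemLp f 2 volume →
      Tendsto (fun n => ∫⁻ s, ‖∫ y, f y * v n (s, y)‖ₑ ^ 2 ∂σ) atTop (𝓝 0))
    (hθ : StronglyMeasurable θ) (hθ1 : ∀ z, ‖θ z‖ ≤ 1) {φ : ℝ → ℂ} (hφ : Integrable φ)
    {Φ : Euc d × Euc m × Euc m → ℂ} (hΦ : StronglyMeasurable Φ) (h2 : MemLp Φ 2 volume)
    {g : Euc d × Euc m → ℂ} (hg : Continuous g) {C : ℝ≥0} (hgC : ∀ y, ‖g y‖ ≤ C)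
    (ψ : C(Sph d, ℂ)) :
    Tendsto (fun n => commForm σ θ (v n) φ Φ g ψ) atTop (𝓝 0) := by
  -- The class of multipliers for which the claim holds, to be shown closed under linear
  -- combinations. Measurability and boundedness are carried along because additivity of the
  -- commutator requires them.
  let P : (Euc d × Euc m → ℂ) → Prop := fun f => StronglyMeasurable f ∧
    (∃ c : ℝ≥0, ∀ y, ‖f y‖ ≤ c) ∧ Tendsto (fun n => commForm σ θ (v n) φ Φ f ψ) atTop (𝓝 0)
  have hPsmul : ∀ (c : ℂ) f, P f → P fun y => c * f y := by
    rintro c f ⟨hf, ⟨C, hC⟩, ht⟩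
    refine ⟨hf.const_mul c, ⟨‖c‖₊ * C, fun y => ?_⟩, ?_⟩
    · rw [norm_mul, NNReal.coe_mul, coe_nnnorm]
      gcongr
      exact hC y
    · simp only [commForm_smul]
      simpa using ht.const_mul ((starRingEnd ℂ) c)
  have hPadd : ∀ f f', P f → P f' → P fun y => f y + f' y := by
    rintro f f' ⟨hf, ⟨C, hC⟩, ht⟩ ⟨hf', ⟨C', hC'⟩, ht'⟩
    refine ⟨hf.add hf', ⟨C + C', fun y => (norm_add_le _ _).trans (add_le_add (hC y) (hC' y))⟩, ?_⟩
    have : (fun n => commForm σ θ (v n) φ Φ (fun y => f y + f' y) ψ) = fun n =>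
        commForm σ θ (v n) φ Φ f ψ + commForm σ θ (v n) φ Φ f' ψ :=
      funext fun n => commForm_add hK (hv n) hθ hθ1 hφ hΦ h2 hf hC hf' hC' ψ
    rw [this]
    simpa using ht.add ht'
  have hPchr : ∀ a, P (chr a) := fun a => ⟨(continuous_chr a).stronglyMeasurable,
    ⟨1, fun y => (norm_chr a y).le⟩, tendsto_commForm_chr hK hv hB hvB hw hθ hθ1 hφ hΦ h2 a ψ⟩
  have hPzero : P fun _ => 0 := by
    have := hPsmul 0 _ (hPchr 0)
    simpa using this
  have hPsum : ∀ w : (Euc d × Euc m) →₀ ℂ, P fun y => w.sum fun a z => z * chr a y := by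
    intro w
    induction w using Finsupp.induction_linear with
    | zero => simpa using hPzero
    | add w w' h h' =>
      have := hPadd _ _ h h'
      convert this using 2 with y
      exact Finsupp.sum_add_index' (fun _ => zero_mul _) (fun _ _ _ => add_mul _ _ _)
    | single a z =>
      have := hPsmul z _ (hPchr a)
      convert this using 2 with y
      exact Finsupp.sum_single_index (zero_mul _)
  refine tendsto_zero_of_norm_le_eps (c := 2 * (locConst σ K N * (eLpNorm φ 1 volume).toReal *
      (eLpNorm Φ 2 volume).toReal * ‖ψ‖)) fun ε hε => ?_
  obtain ⟨w, hwε⟩ := exists_chr_sum_near hg (hK.prod hΛ) hε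
  obtain ⟨hf, ⟨c, hc⟩, ht⟩ := hPsum w
  set f : Euc d × Euc m → ℂ := fun y => w.sum fun a z => z * chr a y with hfdef
  refine ⟨fun n => ‖commForm σ θ (v n) φ Φ f ψ‖, by simpa using ht.norm, fun n => ?_⟩
  have hgf : StronglyMeasurable fun y => g y - f y := hg.stronglyMeasurable.sub hf
  have hind : StronglyMeasurable ((K ×ˢ Λ).indicator fun y => g y - f y) :=
    hgf.indicator (hK.prod hΛ).measurableSet
  have e1 : g = fun y => (g y - f y) + f y := by funext y; ring
  have e2 := commForm_add hK (hv n) hθ hθ1 hφ hΦ h2 hgf (c := C + c)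
    (fun y => (norm_sub_le _ _).trans (add_le_add (hgC y) (hc y))) hf hc ψ
  rw [← e1] at e2
  -- The remainder `g - f` is small only on `K ×ˢ Λ`; elsewhere the trigonometric polynomial is
  -- uncontrolled. The support of `v n` allows the remainder to be cut off there.
  rw [e2, ← commForm_indicator (hv n).supp (hvΛ n) φ Φ (fun y => g y - f y) ψ]
  refine (norm_add_le _ _).trans (add_le_add ?_ le_rfl)
  refine (norm_commForm_le hK (hv n) hθ1 hφ hΦ h2 hind (c := ε.toNNReal) (fun y => ?_) ψ).trans
    (le_of_eq ?_)
  · rw [Real.coe_toNNReal _ hε.le]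
    by_cases hy : y ∈ K ×ˢ Λ
    · rw [indicator_of_mem hy]; exact hwε y hy
    · rw [indicator_of_notMem hy, norm_zero]; exact hε.le
  · rw [Real.coe_toNNReal _ hε.le]

end Commutator

/-! ### Further permutations of variables. -/

section Rearrange

variable {α β γ δ : Type*} [MeasurableSpace α] [MeasurableSpace β] [MeasurableSpace γ]
  [MeasurableSpace δ] (a : Measure α) (b : Measure β) (c : Measure γ) (e : Measure δ)
  [SFinite a] [SFinite b] [SFinite c] [SFinite e]

theorem measurePreserving_front :
    MeasurePreserving (fun z : α × β × γ => (z.2.1, z.1, z.2.2))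
      (a.prod (b.prod c)) (b.prod (a.prod c)) :=
  (measurePreserving_prodAssoc b a c).comp
    (((Measure.measurePreserving_swap (μ := a) (ν := b)).prod (MeasurePreserving.id c)).comp
      (measurePreserving_prodAssoc a b c).symm)

/-- Inserts the time variable, split off from the integrand at `(ω, p, q, ξ₀, ξ')`, next to `ω` and
brings `ξ₀` to the front, as `fullFun` expects. -/
theorem measurePreserving_gather {ε ζ : Type*} [MeasurableSpace ε] [MeasurableSpace ζ]
    (f : Measure ε) (g : Measure ζ) [SFinite f] [SFinite g] :
    MeasurePreserving (fun z : (α × β × γ × δ × ε) × ζ =>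
        (z.1.2.2.2.1, ((z.1.1, z.2), z.1.2.1, z.1.2.2.1), z.1.2.2.2.2))
      ((a.prod (b.prod (c.prod (e.prod f)))).prod g)
      (e.prod (((a.prod g).prod (b.prod c)).prod f)) := by
  have h1 := measurePreserving_swap_last a (b.prod (c.prod (e.prod f))) g
  have h2 := (MeasurePreserving.id (a.prod g)).prod
    (measurePreserving_prodAssoc b c (e.prod f)).symm
  have h3 := (measurePreserving_prodAssoc (a.prod g) (b.prod c) (e.prod f)).symm
  have h4 := measurePreserving_front ((a.prod g).prod (b.prod c)) e f
  exact h4.comp (h3.comp (h2.comp h1))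

/-- Inserts `p` as a separate innermost variable, so that it can be integrated first. -/
theorem measurePreserving_insert {ε : Type*} [MeasurableSpace ε] (f : Measure ε) [SFinite f] :
    MeasurePreserving (fun z : (α × (β × γ) × δ) × ε =>
        (z.1.1, (z.1.2.1.1, z.2, z.1.2.1.2), z.1.2.2))
      ((a.prod ((b.prod c).prod e)).prod f) (a.prod ((b.prod (f.prod c)).prod e)) := by
  have h1 := measurePreserving_prodAssoc a ((b.prod c).prod e) f
  have h2 := (MeasurePreserving.id a).prod (measurePreserving_swap_last (b.prod c) e f)
  have h3 := (MeasurePreserving.id a).prod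
    ((measurePreserving_prodAssoc b c f).prod (MeasurePreserving.id e))
  have h4 := (MeasurePreserving.id a).prod (((MeasurePreserving.id b).prod
    (Measure.measurePreserving_swap (μ := c) (ν := f))).prod (MeasurePreserving.id e))
  exact h4.comp (h3.comp (h2.comp h1))

theorem measurePreserving_split :
    MeasurePreserving (fun z : (α × β × γ) × δ => ((z.1.1, z.1.2.2), z.2, z.1.2.1))
      ((a.prod (b.prod c)).prod e) ((a.prod c).prod (e.prod b)) := by
  have h1 := ((MeasurePreserving.id a).prod
    (Measure.measurePreserving_swap (μ := b) (ν := c))).prod (MeasurePreserving.id e)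
  have h2 := (measurePreserving_prodAssoc a c b).symm.prod (MeasurePreserving.id e)
  have h3 := measurePreserving_prodAssoc (a.prod c) b e
  have h4 := (MeasurePreserving.id (a.prod c)).prod
    (Measure.measurePreserving_swap (μ := b) (ν := e))
  exact h4.comp (h3.comp (h2.comp h1))

end Rearrange

theorem memLp_two_of_bounded_support {α : Type*} [MeasurableSpace α] {μ : Measure α} {F : α → ℂ}
    (hF : StronglyMeasurable F) {C : ℝ} (hC : ∀ a, ‖F a‖ ≤ C) {E : Set α} (hE : MeasurableSet E)
    (hμ : μ E < ∞) (h0 : ∀ a ∉ E, F a = 0) : MemLp F 2 μ := by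
  have : IsFiniteMeasure (μ.restrict E) := ⟨by simpa using hμ⟩
  have h1 : MemLp F 2 (μ.restrict E) :=
    MemLp.of_bound hF.aestronglyMeasurable C (Eventually.of_forall hC)
  rw [← memLp_indicator_iff_restrict hE] at h1
  rwa [indicator_eq_self.2 (fun a ha => by_contra fun h => ha (h0 a h))] at h1

theorem memLp_two_mul_prod {α β : Type*} [MeasurableSpace α] [MeasurableSpace β] {μ : Measure α}
    {ν : Measure β} [SFinite μ] [SFinite ν] {f : α → ℂ} {g : β → ℂ} (hf : MemLp f 2 μ)
    (hg : MemLp g 2 ν) : MemLp (fun z : α × β => f z.1 * g z.2) 2 (μ.prod ν) := by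
  have hm : AEStronglyMeasurable (fun z : α × β => f z.1 * g z.2) (μ.prod ν) :=
    hf.1.comp_fst.mul hg.1.comp_snd
  refine ⟨hm, (eLpNorm_two_le_of_sq_le (c := eLpNorm f 2 μ * eLpNorm g 2 ν)
    (le_of_eq ?_)).trans_lt (ENNReal.mul_lt_top hf.2 hg.2)⟩
  simp only [enorm_mul, mul_pow]
  rw [lintegral_prod_mul (hf.1.enorm.pow_const 2) (hg.1.enorm.pow_const 2), eLpNorm_two_sq,
    eLpNorm_two_sq]

instance isFiniteMeasure_timeMeasure (T : ℝ) : IsFiniteMeasure (timeMeasure T) := by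
  rw [timeMeasure]
  infer_instance

/-! ### Fubini: from the integrand to the form. -/

section Fubini

variable {Ω : Type*} [MeasurableSpace Ω] {d m : ℕ}

/-- The oscillating factor of the temporal Fourier transform. -/
def timeChar (z : (Ω × ℝ) × ℝ) : ℂ := Real.fourierChar (-(z.1.2 * z.2))

theorem stronglyMeasurable_timeChar : StronglyMeasurable (timeChar (Ω := Ω)) := by
  have h : Continuous fun p : ℝ × ℝ => (Real.fourierChar (-(p.1 * p.2)) : ℂ) :=
    continuous_subtype_val.comp (Real.continuous_fourierChar.comp (by fun_prop))
  exact h.stronglyMeasurable.comp_measurable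
    (g := fun z : (Ω × ℝ) × ℝ => (z.1.2, z.2)) (by fun_prop)

theorem norm_timeChar_le (z : (Ω × ℝ) × ℝ) : ‖timeChar z‖ ≤ 1 := (Circle.norm_coe _).le

/-- A real function of `(ω, t, x, l)` as a complex function of `((ω, t), x, l)`. -/
def lift (v : Ω × ℝ × Euc d × Euc m → ℝ) (z : (Ω × ℝ) × Euc d × Euc m) : ℂ :=
  (v (z.1.1, z.1.2, z.2) : ℂ)

theorem stronglyMeasurable_lift {v : Ω × ℝ × Euc d × Euc m → ℝ} (hv : StronglyMeasurable v) :
    StronglyMeasurable (lift v) :=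
  Complex.continuous_ofReal.comp_stronglyMeasurable (hv.comp_measurable (by fun_prop))

/-- `(x, p, q) ↦ f(x, p) 1_Λ(q)`. -/
def extendBy (Λ : Set (Euc m)) (f : Euc d × Euc m → ℂ) (y : Euc d × Euc m × Euc m) : ℂ :=
  f (y.1, y.2.1) * Λ.indicator (fun _ => 1) y.2.2

theorem stronglyMeasurable_indicator_one {Λ : Set (Euc m)} (hΛ : IsCompact Λ) :
    StronglyMeasurable (Λ.indicator fun _ => (1 : ℂ)) :=
  stronglyMeasurable_const.indicator hΛ.measurableSet

theorem memLp_indicator_one {Λ : Set (Euc m)} (hΛ : IsCompact Λ) :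
    MemLp (Λ.indicator fun _ => (1 : ℂ)) 2 volume :=
  memLp_indicator_const 2 hΛ.measurableSet 1 (Or.inr hΛ.measure_lt_top.ne)

theorem stronglyMeasurable_extendBy {Λ : Set (Euc m)} (hΛ : IsCompact Λ)
    {f : Euc d × Euc m → ℂ} (hf : StronglyMeasurable f) : StronglyMeasurable (extendBy Λ f) :=
  (hf.comp_measurable (by fun_prop)).mul
    ((stronglyMeasurable_indicator_one hΛ).comp_measurable (by fun_prop))

theorem memLp_extendBy {Λ : Set (Euc m)} (hΛ : IsCompact Λ) {f : Euc d × Euc m → ℂ}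
    (h2 : MemLp f 2 volume) : MemLp (extendBy Λ f) 2 volume := by
  have h := memLp_two_mul_prod h2 (memLp_indicator_one hΛ)
  exact h.comp_measurePreserving (measurePreserving_prodAssoc (volume : Measure (Euc d))
    (volume : Measure (Euc m)) (volume : Measure (Euc m))).symm

variable (P : Measure Ω) [IsProbabilityMeasure P] (T : ℝ) {K : Set (Euc d)} {Λ : Set (Euc m)}
  {M : ℝ≥0} {v : Ω × ℝ × Euc d × Euc m → ℝ}

/-- `((s, p, q), x) ↦ f₁(x, p) v(s, x, p) 1_Λ(q)`. -/
def leftFactor (Λ : Set (Euc m)) (f : Euc d × Euc m → ℂ) (v : (Ω × ℝ) × Euc d × Euc m → ℂ)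
    (z : ((Ω × ℝ) × Euc m × Euc m) × Euc d) : ℂ :=
  f (z.2, z.1.2.1) * cut Λ v (z.1.1, z.2, z.1.2.1) * Λ.indicator (fun _ => 1) z.1.2.2

/-- `((s, p, q), x) ↦ f₂(x, q) v(s, x, q) 1_Λ(p)`. -/
def rightFactor (Λ : Set (Euc m)) (f : Euc d × Euc m → ℂ) (v : (Ω × ℝ) × Euc d × Euc m → ℂ)
    (z : ((Ω × ℝ) × Euc m × Euc m) × Euc d) : ℂ :=
  f (z.2, z.1.2.2) * cut Λ v (z.1.1, z.2, z.1.2.2) * Λ.indicator (fun _ => 1) z.1.2.1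

theorem norm_cut_le {S : Type*} [MeasurableSpace S] {v : S × Euc d × Euc m → ℂ}
    (hM : ∀ z, ‖v z‖ ≤ M)
    (z : S × Euc d × Euc m) : ‖cut Λ v z‖ ≤ M := by
  by_cases h : z.2.2 ∈ Λ
  · rw [cut_of_mem h]; exact hM z
  · rw [cut_of_notMem h, norm_zero]; exact M.2

theorem stronglyMeasurable_leftFactor (hΛ : IsCompact Λ) {f : Euc d × Euc m → ℂ}
    (hf : StronglyMeasurable f) {v : (Ω × ℝ) × Euc d × Euc m → ℂ} (hv : StronglyMeasurable v) :
    StronglyMeasurable (leftFactor Λ f v) :=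
  ((hf.comp_measurable (by fun_prop)).mul
    ((stronglyMeasurable_cut hΛ.measurableSet hv).comp_measurable (by fun_prop))).mul
    ((stronglyMeasurable_indicator_one hΛ).comp_measurable (by fun_prop))

theorem stronglyMeasurable_rightFactor (hΛ : IsCompact Λ) {f : Euc d × Euc m → ℂ}
    (hf : StronglyMeasurable f) {v : (Ω × ℝ) × Euc d × Euc m → ℂ} (hv : StronglyMeasurable v) :
    StronglyMeasurable (rightFactor Λ f v) :=
  ((hf.comp_measurable (by fun_prop)).mul
    ((stronglyMeasurable_cut hΛ.measurableSet hv).comp_measurable (by fun_prop))).mul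
    ((stronglyMeasurable_indicator_one hΛ).comp_measurable (by fun_prop))

variable {σ : Measure (Ω × ℝ)} [IsFiniteMeasure σ]

/-- Without the indicator in `q` the factor would be constant in `q` and not square integrable. Here
`f` supplies the integrability and `v` is only bounded. -/
theorem memLp_leftFactor (hΛ : IsCompact Λ) {f : Euc d × Euc m → ℂ}
    (hf : StronglyMeasurable f) (h2 : MemLp f 2 volume) {v : (Ω × ℝ) × Euc d × Euc m → ℂ}
    (hv : StronglyMeasurable v) (hM : ∀ z, ‖v z‖ ≤ M) :
    MemLp (leftFactor Λ f v) 2 ((σ.prod (volume.prod volume)).prod volume) := by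
  have h1 : MemLp (fun _ : Ω × ℝ => (1 : ℂ)) 2 σ := memLp_const 1
  have h3 := memLp_two_mul_prod (memLp_two_mul_prod h1 (memLp_indicator_one hΛ)) h2
  have h4 := (h3.comp_measurePreserving (measurePreserving_split σ (volume : Measure (Euc m))
    (volume : Measure (Euc m)) (volume : Measure (Euc d)))).const_mul (M : ℂ)
  refine h4.mono (stronglyMeasurable_leftFactor hΛ hf hv).aestronglyMeasurable
    (Eventually.of_forall fun z => ?_)
  simp only [leftFactor, norm_mul, Function.comp, one_mul]
  have h5 := norm_cut_le (Λ := Λ) hM (z.1.1, z.2, z.1.2.1)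
  have h6 : ‖(M : ℂ)‖ = M := by simp
  calc _ ≤ ‖f (z.2, z.1.2.1)‖ * M * ‖Λ.indicator (fun _ => (1 : ℂ)) z.1.2.2‖ := by gcongr
    _ = _ := by rw [h6]; ring

/-- Here the roles change: `f` is only bounded, and integrability comes from the bounded product
being carried by `K` in `x` and by `Λ` in `p` and `q`. -/
theorem memLp_rightFactor (hK : IsCompact K) (hΛ : IsCompact Λ) {f : Euc d × Euc m → ℂ}
    (hf : StronglyMeasurable f) {c : ℝ≥0} (hc : ∀ y, ‖f y‖ ≤ c)
    {v : (Ω × ℝ) × Euc d × Euc m → ℂ} (hv : StronglyMeasurable v) (hM : ∀ z, ‖v z‖ ≤ M)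
    (hvK : ∀ s x l, x ∉ K → v (s, x, l) = 0) :
    MemLp (rightFactor Λ f v) 2 ((σ.prod (volume.prod volume)).prod volume) := by
  refine memLp_two_of_bounded_support (stronglyMeasurable_rightFactor hΛ hf hv) (C := c * M * 1)
    (E := (univ ×ˢ (Λ ×ˢ Λ)) ×ˢ K) (fun z => ?_) ?_ ?_ fun z hz => ?_
  · simp only [rightFactor, norm_mul]
    have h5 := norm_cut_le (Λ := Λ) hM (z.1.1, z.2, z.1.2.2)
    have h6 : ‖Λ.indicator (fun _ => (1 : ℂ)) z.1.2.1‖ ≤ 1 := by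
      refine (norm_indicator_le_norm_self _ _).trans (by simp)
    have h7 := hc (z.2, z.1.2.2)
    gcongr
  · exact (MeasurableSet.univ.prod (hΛ.measurableSet.prod hΛ.measurableSet)).prod hK.measurableSet
  · rw [Measure.prod_prod, Measure.prod_prod, Measure.prod_prod]
    exact ENNReal.mul_lt_top (ENNReal.mul_lt_top (measure_lt_top _ _)
      (ENNReal.mul_lt_top hΛ.measure_lt_top hΛ.measure_lt_top)) hK.measure_lt_top
  · simp only [rightFactor]
    by_cases hp : z.1.2.1 ∈ Λ
    · by_cases hq : z.1.2.2 ∈ Λ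
      · have hx : z.2 ∉ K := fun hx => hz ⟨⟨mem_univ _, hp, hq⟩, hx⟩
        rw [cut_of_mem (by exact hq), hvK _ _ _ hx, mul_zero, zero_mul]
      · rw [cut_of_notMem (by exact hq), mul_zero, zero_mul]
    · rw [indicator_of_notMem hp, mul_zero]

theorem cut_eq_zero {v : (Ω × ℝ) × Euc d × Euc m → ℂ}
    (hvK : ∀ s x l, x ∉ K → v (s, x, l) = 0) (s : Ω × ℝ) (l : Euc m) (x : Euc d) (hx : x ∉ K) :
    cut Λ v (s, x, l) = 0 := by
  by_cases h : l ∈ Λ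
  · rw [cut_of_mem (by exact h), hvK _ _ _ hx]
  · rw [cut_of_notMem (by exact h)]

/-- The integrand, before the integration in time. -/
def fullFun (Λ : Set (Euc m)) (φ : ℝ → ℂ) (f₁ f₂ : Euc d × Euc m → ℂ) (ψ : C(Sph d, ℂ))
    (v : (Ω × ℝ) × Euc d × Euc m → ℂ) (y : ℝ × ((Ω × ℝ) × Euc m × Euc m) × Euc d) : ℂ :=
  formFun (symb ψ) (fun w => timeChar (w.1.1, w.2)) φ (pF (leftFactor Λ f₁ v))
    (pF (rightFactor Λ f₂ v)) y

theorem integrable_fullFun (hK : IsCompact K) (hΛ : IsCompact Λ) {φ : ℝ → ℂ} (hφ : Integrable φ)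
    {f₁ f₂ : Euc d × Euc m → ℂ} (hf₁ : StronglyMeasurable f₁) (h2 : MemLp f₁ 2 volume)
    (hf₂ : StronglyMeasurable f₂) {c : ℝ≥0} (hc : ∀ y, ‖f₂ y‖ ≤ c) (ψ : C(Sph d, ℂ))
    {v : (Ω × ℝ) × Euc d × Euc m → ℂ} (hv : StronglyMeasurable v) (hM : ∀ z, ‖v z‖ ≤ M)
    (hvK : ∀ s x l, x ∉ K → v (s, x, l) = 0) :
    Integrable (fullFun Λ φ f₁ f₂ ψ v)
      ((volume : Measure ℝ).prod ((σ.prod (volume.prod volume)).prod volume)) := by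
  have hθ : StronglyMeasurable fun w : ((Ω × ℝ) × Euc m × Euc m) × ℝ =>
      timeChar (w.1.1, w.2) := stronglyMeasurable_timeChar.comp_measurable (by fun_prop)
  refine integrable_formFun (stronglyMeasurable_symb ψ) (norm_symb_le ψ) hθ
    (fun _ => norm_timeChar_le _) hφ
    (memLp_pF (stronglyMeasurable_leftFactor hΛ hf₁ hv) hK (fun a x hx => ?_)
      (memLp_leftFactor hΛ hf₁ h2 hv hM))
    (memLp_pF (stronglyMeasurable_rightFactor hΛ hf₂ hv) hK (fun a x hx => ?_)
      (memLp_rightFactor hK hΛ hf₂ hc hv hM hvK))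
  · simp [leftFactor, cut_eq_zero (Λ := Λ) hvK _ _ _ hx]
  · simp [rightFactor, cut_eq_zero (Λ := Λ) hvK _ _ _ hx]

theorem pF_leftFactor (f : Euc d × Euc m → ℂ) (v : (Ω × ℝ) × Euc d × Euc m → ℂ)
    (s : Ω × ℝ) (p q : Euc m) (ξ : Euc d) :
    pF (leftFactor Λ f v) ((s, p, q), ξ) = Λ.indicator (fun _ => 1) q *
      𝓕 (fun x : Euc d => f (x, p) * cut Λ v (s, x, p)) ξ := by
  simp only [pF, leftFactor, Real.fourier_eq, Circle.smul_def, smul_eq_mul]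
  rw [← integral_const_mul]
  congr 1; funext x; ring

theorem pF_rightFactor (f : Euc d × Euc m → ℂ) (v : (Ω × ℝ) × Euc d × Euc m → ℂ)
    (s : Ω × ℝ) (p q : Euc m) (ξ : Euc d) :
    pF (rightFactor Λ f v) ((s, p, q), ξ) = Λ.indicator (fun _ => 1) p *
      𝓕 (fun x : Euc d => f (x, q) * cut Λ v (s, x, q)) ξ := by
  simp only [pF, rightFactor, Real.fourier_eq, Circle.smul_def, smul_eq_mul]
  rw [← integral_const_mul]
  congr 1; funext x; ring

theorem fourier_cut_eq {f : Euc d × Euc m → ℂ} (hf : ∀ x l, l ∉ Λ → f (x, l) = 0)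
    (v : Ω × ℝ × Euc d × Euc m → ℝ) (ω : Ω) (t : ℝ) (l : Euc m) (ξ : Euc d) :
    𝓕 (fun x : Euc d => f (x, l) * cut Λ (lift v) ((ω, t), x, l)) ξ =
      spaceFourier f v ω l t ξ := by
  simp only [spaceFourier]
  refine congrArg (fun F : Euc d → ℂ => 𝓕 F ξ) (funext fun x => ?_)
  by_cases h : l ∈ Λ
  · rw [cut_of_mem (by exact h)]; rfl
  · rw [hf x l h, zero_mul, zero_mul]

theorem spaceFourier_eq_zero {f : Euc d × Euc m → ℂ} (hf : ∀ x l, l ∉ Λ → f (x, l) = 0)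
    (v : Ω × ℝ × Euc d × Euc m → ℝ) (ω : Ω) (t : ℝ) {l : Euc m} (hl : l ∉ Λ) (ξ : Euc d) :
    spaceFourier f v ω l t ξ = 0 := by
  simp [spaceFourier, hf _ l hl, Real.fourier_eq]

/-- The auxiliary indicators are harmless, since the test functions already force `p` and `q` into
`Λ`. -/
theorem pF_leftFactor_mul_conj {f₁ f₂ : Euc d × Euc m → ℂ} (h₁ : ∀ x l, l ∉ Λ → f₁ (x, l) = 0)
    (h₂ : ∀ x l, l ∉ Λ → f₂ (x, l) = 0) (v : Ω × ℝ × Euc d × Euc m → ℝ) (ω : Ω) (t : ℝ)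
    (p q : Euc m) (ξ : Euc d) :
    pF (leftFactor Λ f₁ (lift v)) (((ω, t), p, q), ξ) *
        (starRingEnd ℂ) (pF (rightFactor Λ f₂ (lift v)) (((ω, t), p, q), ξ)) =
      spaceFourier f₁ v ω p t ξ * (starRingEnd ℂ) (spaceFourier f₂ v ω q t ξ) := by
  rw [pF_leftFactor, pF_rightFactor, fourier_cut_eq h₁, fourier_cut_eq h₂]
  by_cases hp : p ∈ Λ
  · by_cases hq : q ∈ Λ
    · rw [indicator_of_mem hp, indicator_of_mem hq, one_mul, one_mul]
    · rw [spaceFourier_eq_zero h₂ v ω t hq]; simp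
  · rw [spaceFourier_eq_zero h₁ v ω t hp]; simp

/-- The temporal Fourier transform is written out, and its kernel becomes the factor `timeChar`. -/
theorem integrand_eq_integral {φ : ℝ → ℂ} {f₁ f₂ : Euc d × Euc m → ℂ}
    (h₁ : ∀ x l, l ∉ Λ → f₁ (x, l) = 0) (h₂ : ∀ x l, l ∉ Λ → f₂ (x, l) = 0) (ψ : C(Sph d, ℂ))
    (v : Ω × ℝ × Euc d × Euc m → ℝ) (w : Ω × Euc m × Euc m × ℝ × Euc d) :
    integrand T φ f₁ f₂ ψ v w.1 w.2 = ∫ t, fullFun Λ φ f₁ f₂ ψ (lift v)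
      (w.2.2.2.1, ((w.1, t), w.2.1, w.2.2.1), w.2.2.2.2) ∂(timeMeasure T) := by
  simp only [fullFun, formFun, pF_leftFactor_mul_conj h₁ h₂]
  rw [integrand, crossFourier, Real.fourier_real_eq, ← integral_const_mul, timeMeasure,
    ← integral_indicator measurableSet_Ioo]
  congr 1
  funext t
  by_cases ht : t ∈ Ioo 0 T
  · rw [indicator_of_mem ht, indicator_of_mem ht]
    simp only [timeChar, symb, Circle.smul_def, smul_eq_mul]
    ring
  · rw [indicator_of_notMem ht, indicator_of_notMem ht, smul_zero, mul_zero]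

/-- Fubini in `(x, p)`: integrating the transforms over `p` gives the transform of the slice
integral. -/
theorem integral_pF_leftFactor (hΛ : IsCompact Λ) {f : Euc d × Euc m → ℂ}
    (hf : StronglyMeasurable f) (h2 : MemLp f 2 volume) {v : (Ω × ℝ) × Euc d × Euc m → ℂ}
    (hv : StronglyMeasurable v) {B : ℝ≥0∞} (hB : B < ∞)
    (hvB : ∀ s, ∫⁻ y, ‖cut Λ v (s, y)‖ₑ ^ 2 ≤ B) (s : Ω × ℝ) (q : Euc m) (ξ : Euc d) :
    ∫ p, pF (leftFactor Λ f v) ((s, p, q), ξ) =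
      pF (sliceInt (extendBy Λ f) (cut Λ v)) ((s, q), ξ) := by
  have hcut := stronglyMeasurable_cut hΛ.measurableSet hv
  have hext := stronglyMeasurable_extendBy hΛ hf
  have h1 : ∫⁻ y : Euc d × Euc m, ‖extendBy Λ f (y.1, y.2, q)‖ₑ ^ 2 < ∞ := by
    refine lt_of_le_of_lt (lintegral_mono (g := fun y => ‖f y‖ₑ ^ 2) fun y => ?_) ?_
    · refine pow_le_pow_left' ?_ 2
      rw [extendBy, enorm_mul]
      refine (mul_le_of_le_one_right zero_le ?_)
      by_cases hq : q ∈ Λ <;> simp [hq]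
    · rw [← eLpNorm_two_sq]
      exact ENNReal.pow_lt_top h2.eLpNorm_lt_top
  have h3 := (hvB s).trans_lt hB
  rw [pF_sliceInt_eq hext hcut s q ξ h1 h3]
  have hI := integrable_mul_of_lintegral_sq (f := fun y : Euc d × Euc m =>
    extendBy Λ f (y.1, y.2, q)) (g := fun y => cut Λ v (s, y)) (hext.comp_measurable (by fun_prop))
    (hcut.comp_measurable (by fun_prop)) h1 h3
  have hc : Continuous fun y : Euc d × Euc m => (Real.fourierChar (-inner ℝ y.1 ξ) : ℂ) :=
    continuous_subtype_val.comp (Real.continuous_fourierChar.comp (by fun_prop))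
  have hI' := hI.bdd_mul (c := 1) hc.aestronglyMeasurable
    (Eventually.of_forall fun y => (Circle.norm_coe _).le)
  simp only [mul_assoc]
  rw [Measure.volume_eq_prod, integral_prod_symm _ hI']
  congr 1
  funext p
  simp only [pF, leftFactor, extendBy, Real.fourier_eq, Circle.smul_def, smul_eq_mul]
  congr 1
  funext x
  ring

/-- The second factor depends on `p` only through the indicator of `Λ`, so the integration over `p`
falls on the first factor alone. -/
theorem integral_fullFun (hK : IsCompact K) (hΛ : IsCompact Λ) {φ : ℝ → ℂ} (hφ : Integrable φ)
    {f₁ f₂ : Euc d × Euc m → ℂ} (hf₁ : StronglyMeasurable f₁) (h2 : MemLp f₁ 2 volume)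
    (h₁ : ∀ x l, l ∉ Λ → f₁ (x, l) = 0)
    (hf₂ : StronglyMeasurable f₂) {c : ℝ≥0} (hc : ∀ y, ‖f₂ y‖ ≤ c) (ψ : C(Sph d, ℂ))
    {v : (Ω × ℝ) × Euc d × Euc m → ℂ} (hv : StronglyMeasurable v) (hM : ∀ z, ‖v z‖ ≤ M)
    (hvK : ∀ s x l, x ∉ K → v (s, x, l) = 0) {B : ℝ≥0∞} (hB : B < ∞)
    (hvB : ∀ s, ∫⁻ y, ‖cut Λ v (s, y)‖ₑ ^ 2 ≤ B) :
    ∫ y, fullFun Λ φ f₁ f₂ ψ v y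
        ∂((volume : Measure ℝ).prod ((σ.prod (volume.prod volume)).prod volume)) =
      crossForm σ timeChar (cut Λ v) φ (extendBy Λ f₁) f₂ ψ := by
  have hI := integrable_fullFun (σ := σ) hK hΛ hφ hf₁ h2 hf₂ hc ψ hv hM hvK
  have hmp := measurePreserving_insert (volume : Measure ℝ) σ (volume : Measure (Euc m))
    (volume : Measure (Euc d)) (volume : Measure (Euc m))
  have hI' := hmp.integrable_comp_of_integrable hI
  rw [← hmp.map_eq, integral_map hmp.measurable.aemeasurable (by rw [hmp.map_eq]; exact hI.1)]
  rw [crossForm, form]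
  refine (integral_prod _ hI').trans ?_
  congr 1
  funext y
  obtain ⟨t, ⟨⟨s, q⟩, ξ⟩⟩ := y
  simp only [fullFun, formFun, Function.comp]
  rw [← integral_pF_leftFactor hΛ hf₁ h2 hv hB hvB, ← integral_mul_const, ← integral_const_mul]
  congr 1
  funext p
  congr 1
  rw [pF_rightFactor]
  have e : pF (swapArr (mulL f₂ (cut Λ v))) ((s, q), ξ) =
      𝓕 (fun x : Euc d => f₂ (x, q) * cut Λ v (s, x, q)) ξ := rfl
  rw [e]
  -- For `p ∉ Λ` the first factor vanishes because `f₁` does, so dropping the indicator changes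
  -- nothing.
  by_cases hp : p ∈ Λ
  · rw [indicator_of_mem hp, one_mul]
  · rw [pF_leftFactor]
    simp [h₁ _ p hp, Real.fourier_eq]

end Fubini

/-! ### Regular representatives and convergence in expectation. -/

section Regularization

variable {Ω : Type*} [MeasurableSpace Ω] {P : Measure Ω} [IsProbabilityMeasure P] {T : ℝ}
  {d m : ℕ} {K : Set (Euc d)} {Λ : Set (Euc m)} {M : ℝ≥0}

/-- Strongly measurable functions that are bounded by `M` and supported in `K`, everywhere. -/
structure Regular (K : Set (Euc d)) (M : ℝ≥0) (v : Ω × ℝ × Euc d × Euc m → ℝ) : Prop where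
  meas : StronglyMeasurable v
  bound : ∀ z, |v z| ≤ M
  supp : ∀ z, z.2.2.1 ∉ K → v z = 0

/-- A measurable representative is truncated to `[-M, M]` and set to `0` off `K`. Bounds valid
everywhere make the estimates available on every slice. The sign of `M` is not known, hence
`M.toNNReal`. -/
theorem exists_regular {u : Ω × ℝ × Euc d × Euc m → ℝ}
    (hmeas : AEStronglyMeasurable u (fullMeasure P T d m)) {M : ℝ}
    (hbdd : ∀ᵐ z ∂(fullMeasure P T d m), |u z| ≤ M) (hK : IsCompact K)
    (hsupp : ∀ᵐ z ∂(fullMeasure P T d m), z.2.2.1 ∉ K → u z = 0) :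
    ∃ v, Regular K M.toNNReal v ∧ u =ᵐ[fullMeasure P T d m] v := by
  set g : Ω × ℝ × Euc d × Euc m → ℝ := fun z =>
    max (-(M.toNNReal : ℝ)) (min (M.toNNReal : ℝ) (hmeas.mk u z)) with hg
  have hgm : Measurable g :=
    measurable_const.max (measurable_const.min hmeas.stronglyMeasurable_mk.measurable)
  have hE : MeasurableSet {z : Ω × ℝ × Euc d × Euc m | z.2.2.1 ∈ K} :=
    (by fun_prop : Measurable fun z : Ω × ℝ × Euc d × Euc m => z.2.2.1) hK.measurableSet
  have hM0 : (0 : ℝ) ≤ (M.toNNReal : ℝ) := NNReal.coe_nonneg _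
  refine ⟨{z : Ω × ℝ × Euc d × Euc m | z.2.2.1 ∈ K}.indicator g,
    ⟨(hgm.indicator hE).stronglyMeasurable, fun z => ?_, fun z hz =>
      indicator_of_notMem (show z ∉ {z : Ω × ℝ × Euc d × Euc m | z.2.2.1 ∈ K} from hz) _⟩,
    ?_⟩
  · by_cases hz : z ∈ {z : Ω × ℝ × Euc d × Euc m | z.2.2.1 ∈ K}
    · rw [indicator_of_mem hz, abs_le]
      exact ⟨le_max_left _ _, max_le (by linarith) (min_le_left _ _)⟩
    · rw [indicator_of_notMem hz, abs_zero]
      exact hM0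
  · filter_upwards [hmeas.ae_eq_mk, hbdd, hsupp] with z h1 h2 h3
    by_cases hz : z ∈ {z : Ω × ℝ × Euc d × Euc m | z.2.2.1 ∈ K}
    · rw [indicator_of_mem hz, hg]
      simp only
      rw [← h1]
      have h4 : M ≤ (M.toNNReal : ℝ) := Real.le_coe_toNNReal M
      rw [abs_le] at h2
      rw [min_eq_right (by linarith), max_eq_right (by linarith)]
    · rw [indicator_of_notMem hz, h3 hz]

variable {v : Ω × ℝ × Euc d × Euc m → ℝ}

theorem Regular.norm_lift_le (hv : Regular K M v) (z : (Ω × ℝ) × Euc d × Euc m) :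
    ‖lift v z‖ ≤ M := by
  simpa [lift] using hv.bound _

theorem Regular.lift_eq_zero (hv : Regular K M v) (s : Ω × ℝ) (x : Euc d) (l : Euc m)
    (hx : x ∉ K) : lift v (s, x, l) = 0 := by
  simp [lift, hv.supp (s.1, s.2, x, l) hx]

theorem Regular.lintegral_cut_le (hv : Regular K M v) (hK : IsCompact K) (hΛ : IsCompact Λ)
    (s : Ω × ℝ) : ∫⁻ y, ‖cut Λ (lift v) (s, y)‖ₑ ^ 2 ≤
      (M : ℝ≥0∞) ^ 2 * volume (K ×ˢ Λ : Set (Euc d × Euc m)) := by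
  rw [← lintegral_indicator_const (hK.measurableSet.prod hΛ.measurableSet)]
  refine lintegral_mono fun y => ?_
  by_cases hy : y ∈ K ×ˢ Λ
  · rw [indicator_of_mem hy]
    refine pow_le_pow_left' ?_ 2
    rw [← ofReal_norm]
    exact (ENNReal.ofReal_le_ofReal (norm_cut_le hv.norm_lift_le _)).trans (by simp)
  · rw [indicator_of_notMem hy]
    by_cases hl : y.2 ∈ Λ
    · have hx : y.1 ∉ K := fun hx => hy ⟨hx, hl⟩
      have : cut Λ (lift v) (s, y) = 0 := cut_eq_zero hv.lift_eq_zero s y.2 y.1 hx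
      simp [this]
    · rw [cut_of_notMem (by exact hl)]
      simp

theorem cutBound_lt_top (hK : IsCompact K) (hΛ : IsCompact Λ) :
    (M : ℝ≥0∞) ^ 2 * volume (K ×ˢ Λ : Set (Euc d × Euc m)) < ∞ :=
  ENNReal.mul_lt_top (ENNReal.pow_lt_top ENNReal.coe_lt_top) (hK.prod hΛ).measure_lt_top

/-- The integrand is integrable and its integral is the cross form. -/
theorem Regular.integral_integrand (hv : Regular K M v) (hK : IsCompact K) (hΛ : IsCompact Λ)
    {φ : ℝ → ℂ} (hφ : Integrable φ)
    {f₁ f₂ : Euc d × Euc m → ℂ} (hf₁ : StronglyMeasurable f₁) (h2 : MemLp f₁ 2 volume)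
    (h₁ : ∀ x l, l ∉ Λ → f₁ (x, l) = 0) (hf₂ : StronglyMeasurable f₂) {c : ℝ≥0}
    (hc : ∀ y, ‖f₂ y‖ ≤ c) (h₂ : ∀ x l, l ∉ Λ → f₂ (x, l) = 0) (ψ : C(Sph d, ℂ)) :
    Integrable (fun w : Ω × Euc m × Euc m × ℝ × Euc d => integrand T φ f₁ f₂ ψ v w.1 w.2)
      (P.prod volume) ∧
    ∫ ω, (∫ z, integrand T φ f₁ f₂ ψ v ω z) ∂P =
      crossForm (P.prod (timeMeasure T)) timeChar (cut Λ (lift v)) φ (extendBy Λ f₁) f₂ ψ := by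
  have : SFinite (P.prod (volume : Measure (Euc m × Euc m × ℝ × Euc d))) :=
    Measure.prod.instSFinite
  have hl := stronglyMeasurable_lift hv.meas
  have hI := integrable_fullFun (σ := P.prod (timeMeasure T)) hK hΛ hφ hf₁ h2 hf₂ hc ψ hl
    hv.norm_lift_le hv.lift_eq_zero
  have hmp := measurePreserving_gather P (volume : Measure (Euc m)) (volume : Measure (Euc m))
    (volume : Measure ℝ) (volume : Measure (Euc d)) (timeMeasure T)
  have hI' : Integrable (fullFun Λ φ f₁ f₂ ψ (lift v) ∘
      fun z : (Ω × Euc m × Euc m × ℝ × Euc d) × ℝ =>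
        (z.1.2.2.2.1, ((z.1.1, z.2), z.1.2.1, z.1.2.2.1), z.1.2.2.2.2))
      ((P.prod volume).prod (timeMeasure T)) := hmp.integrable_comp_of_integrable hI
  have heq := integrand_eq_integral T (φ := φ) h₁ h₂ ψ v
  have hint : Integrable (fun w : Ω × Euc m × Euc m × ℝ × Euc d =>
      integrand T φ f₁ f₂ ψ v w.1 w.2) (P.prod volume) := by
    simp only [heq]
    exact hI'.integral_prod_left
  refine ⟨hint, ?_⟩
  rw [← integral_fullFun hK hΛ hφ hf₁ h2 h₁ hf₂ hc ψ hl hv.norm_lift_le hv.lift_eq_zero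
    (cutBound_lt_top hK hΛ) (hv.lintegral_cut_le hK hΛ), ← hmp.map_eq,
    integral_map hmp.measurable.aemeasurable (by rw [hmp.map_eq]; exact hI.1)]
  refine (integral_prod _ hint).symm.trans ?_
  simp only [heq]
  exact (integral_prod _ hI').symm

theorem ae_spaceFourier_eq {f f' : Euc d × Euc m → ℂ} {u u' : Ω × ℝ × Euc d × Euc m → ℝ}
    (h : ∀ᵐ z ∂(fullMeasure P T d m), f z.2.2 * (u z : ℂ) = f' z.2.2 * (u' z : ℂ)) :
    ∀ᵐ w : Ω × Euc m ∂(P.prod volume), ∀ᵐ t ∂(timeMeasure T), ∀ ξ,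
      spaceFourier f u w.1 w.2 t ξ = spaceFourier f' u' w.1 w.2 t ξ := by
  have hmp := measurePreserving_rotate P (volume : Measure (Euc m)) (timeMeasure T)
    (volume : Measure (Euc d))
  have h1 := Measure.ae_ae_of_ae_prod (Measure.ae_ae_of_ae_prod
    (hmp.quasiMeasurePreserving.ae h))
  filter_upwards [h1] with w hw
  filter_upwards [hw] with t ht ξ
  simp only [spaceFourier, Real.fourier_eq]
  refine integral_congr_ae ?_
  filter_upwards [ht] with x hx
  exact congrArg _ hx

/-- The hypotheses compare products, so a test function may also be altered off `K`, where the
function it multiplies vanishes. -/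
theorem ae_integrand_eq (φ : ℝ → ℂ) {f₁ f₁' f₂ f₂' : Euc d × Euc m → ℂ} (ψ : Sph d → ℂ)
    {u u' : Ω × ℝ × Euc d × Euc m → ℝ}
    (h₁ : ∀ᵐ z ∂(fullMeasure P T d m), f₁ z.2.2 * (u z : ℂ) = f₁' z.2.2 * (u' z : ℂ))
    (h₂ : ∀ᵐ z ∂(fullMeasure P T d m), f₂ z.2.2 * (u z : ℂ) = f₂' z.2.2 * (u' z : ℂ)) :
    ∀ᵐ w : Ω × Euc m × Euc m × ℝ × Euc d ∂(P.prod volume),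
      integrand T φ f₁ f₂ ψ u w.1 w.2 = integrand T φ f₁' f₂' ψ u' w.1 w.2 := by
  have a1 := (measurePreserving_prodAssoc P (volume : Measure (Euc m))
    (volume : Measure (Euc m × ℝ × Euc d))).symm.quasiMeasurePreserving
  have q1 := (Measure.quasiMeasurePreserving_fst.comp a1).ae (ae_spaceFourier_eq h₁)
  have a2 := ((MeasurePreserving.id P).prod (measurePreserving_front (volume : Measure (Euc m))
    (volume : Measure (Euc m)) (volume : Measure (ℝ × Euc d)))).quasiMeasurePreserving
  have q2 := ((Measure.quasiMeasurePreserving_fst.comp a1).comp a2).ae (ae_spaceFourier_eq h₂)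
  filter_upwards [q1, q2] with w hw1 hw2
  simp only [integrand, crossFourier]
  congr 1
  simp only [Real.fourier_eq]
  refine integral_congr_ae ?_
  have e1 := (ae_restrict_iff' measurableSet_Ioo).1 hw1
  have e2 := (ae_restrict_iff' measurableSet_Ioo).1 hw2
  filter_upwards [e1, e2] with t ht1 ht2
  by_cases ht : t ∈ Ioo 0 T
  · rw [indicator_of_mem ht, indicator_of_mem ht]
    have e3 := ht1 ht w.2.2.2.2
    have e4 := ht2 ht w.2.2.2.2
    simp only [Function.comp, Prod.map] at e3 e4
    exact congrArg _ (congrArg₂ (fun a b => a * (starRingEnd ℂ) b) e3 e4)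
  · rw [indicator_of_notMem ht, indicator_of_notMem ht]

/-- Strong-weak convergence, in expectation and for complex test functions, of the functions cut
off in `l`. -/
theorem tendsto_lintegral_of_strongWeak {u v : ℕ → Ω × ℝ × Euc d × Euc m → ℝ}
    (hconv : TendstoZeroStrongWeak P T u) (hv : ∀ n, Regular K M (v n))
    (huv : ∀ n, u n =ᵐ[fullMeasure P T d m] v n) (hK : IsCompact K) (hΛ : IsCompact Λ)
    (f : Euc d × Euc m → ℂ) (hf : MemLp f 2 volume) :
    Tendsto (fun n => ∫⁻ s, ‖∫ y, f y * cut Λ (lift (v n)) (s, y)‖ₑ ^ 2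
      ∂(P.prod (timeMeasure T))) atTop (𝓝 0) := by
  set f' := hf.1.mk f with hf'
  have hfm : StronglyMeasurable f' := hf.1.stronglyMeasurable_mk
  have hf2 : MemLp f' 2 volume := hf.ae_eq hf.1.ae_eq_mk
  set F : ℕ → Ω × ℝ → ℂ := fun n s => ∫ y, f' y * cut Λ (lift (v n)) (s, y) with hF
  have hcm : ∀ n, StronglyMeasurable (cut Λ (lift (v n))) := fun n =>
    stronglyMeasurable_cut hΛ.measurableSet (stronglyMeasurable_lift (hv n).meas)
  have hFm : ∀ n, StronglyMeasurable (F n) := fun n => by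
    have h : StronglyMeasurable fun z : (Ω × ℝ) × Euc d × Euc m =>
        f' z.2 * cut Λ (lift (v n)) z := (hfm.comp_measurable (by fun_prop)).mul (hcm n)
    exact h.integral_prod_right' (ν := (volume : Measure (Euc d × Euc m)))
  have e1 : ∀ n s, ∫ y, f y * cut Λ (lift (v n)) (s, y) = F n s := fun n s => by
    refine integral_congr_ae ?_
    filter_upwards [hf.1.ae_eq_mk] with y hy
    rw [hy]
  simp only [e1]
  set B : ℝ≥0∞ := (M : ℝ≥0∞) ^ 2 * volume (K ×ˢ Λ : Set (Euc d × Euc m)) with hB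
  have hBtop : B < ∞ := cutBound_lt_top hK hΛ
  set A : ℝ≥0∞ := ∫⁻ y, ‖f' y‖ₑ ^ 2 with hA
  have hAtop : A < ∞ := by
    rw [hA, ← eLpNorm_two_sq]
    exact ENNReal.pow_lt_top hf2.eLpNorm_lt_top
  have hFb : ∀ n s, ‖F n s‖ₑ ^ 2 ≤ A * B := fun n s => by
    refine (pow_le_pow_left' (enorm_integral_le_lintegral_enorm _) 2).trans ?_
    simp only [enorm_mul]
    refine (sq_lintegral_mul_le hfm.enorm.aemeasurable
      ((hcm n).comp_measurable (by fun_prop)).enorm.aemeasurable).trans ?_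
    gcongr
    exact (hv n).lintegral_cut_le hK hΛ s
  have e2 : ∀ n, ∫⁻ s, ‖F n s‖ₑ ^ 2 ∂(P.prod (timeMeasure T)) =
      ∫⁻ ω, ∫⁻ t, ‖F n (ω, t)‖ₑ ^ 2 ∂(timeMeasure T) ∂P := fun n =>
    lintegral_prod _ ((hFm n).enorm.pow_const 2).aemeasurable
  simp only [e2]
  rw [← lintegral_zero (μ := P)]
  -- Almost sure convergence becomes convergence in expectation: Cauchy-Schwarz bounds the inner
  -- integral by a constant, which is integrable for the probability measure.
  refine tendsto_lintegral_of_dominated_convergence (fun _ => A * B * timeMeasure T univ)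
    (fun n => ((hFm n).enorm.pow_const 2).lintegral_prod_right')
    (fun n => Eventually.of_forall fun ω => ?_) ?_ ?_
  · rw [← lintegral_const]
    exact lintegral_mono fun t => hFb n _
  · rw [lintegral_const]
    exact (ENNReal.mul_lt_top (ENNReal.mul_lt_top (ENNReal.mul_lt_top hAtop hBtop)
      (measure_lt_top _ _)) (measure_lt_top _ _)).ne
  -- The cutoff in `l` is shifted from the sequence to the test function, which stays in `L²`. The
  -- convergence hypothesis, stated for real test functions, is then applied to the real and
  -- imaginary parts.
  set g : Euc d × Euc m → ℂ := {y : Euc d × Euc m | y.2 ∈ Λ}.indicator f' with hg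
  have hΛm : MeasurableSet {y : Euc d × Euc m | y.2 ∈ Λ} := measurable_snd hΛ.measurableSet
  have hgm : StronglyMeasurable g := hfm.indicator hΛm
  have hg2 : MemLp g 2 volume := hf2.indicator hΛm
  have hgl : ∀ n s y, f' y * cut Λ (lift (v n)) (s, y) = g y * lift (v n) (s, y) := by
    intro n s y
    by_cases hy : y.2 ∈ Λ
    · rw [cut_of_mem (by exact hy), hg, indicator_of_mem (by exact hy)]
    · rw [cut_of_notMem (by exact hy), hg, indicator_of_notMem (by exact hy), mul_zero, zero_mul]
  have hint : ∀ n s, Integrable fun y => g y * lift (v n) (s, y) := fun n s => by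
    have := integrable_mul_of_lintegral_sq (f := f') (g := fun y => cut Λ (lift (v n)) (s, y)) hfm
      ((hcm n).comp_measurable (by fun_prop)) hAtop
      (((hv n).lintegral_cut_le hK hΛ s).trans_lt hBtop)
    simpa only [hgl] using this
  have hre : ∀ n s, (F n s).re = ∫ y, v n (s.1, s.2, y) * (g y).re := fun n s => by
    have := Complex.reCLM.integral_comp_comm (hint n s)
    simp only [hF, hgl]
    refine this.symm.trans ?_
    congr 1; funext y
    simp [lift, mul_comm]
  have him : ∀ n s, (F n s).im = ∫ y, v n (s.1, s.2, y) * (g y).im := fun n s => by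
    have := Complex.imCLM.integral_comp_comm (hint n s)
    simp only [hF, hgl]
    refine this.symm.trans ?_
    congr 1; funext y
    simp [lift, mul_comm]
  have huv' : ∀ᵐ ω ∂P, ∀ n, ∀ᵐ t ∂(timeMeasure T), ∀ᵐ y : Euc d × Euc m,
      u n (ω, t, y) = v n (ω, t, y) := by
    rw [ae_all_iff]
    intro n
    filter_upwards [Measure.ae_ae_of_ae_prod (huv n)] with ω hω
    exact Measure.ae_ae_of_ae_prod hω
  have hslice : ∀ (n : ℕ) (ω : Ω) {h : Euc d × Euc m → ℝ},
      (∀ᵐ t ∂(timeMeasure T), ∀ᵐ y : Euc d × Euc m, u n (ω, t, y) = v n (ω, t, y)) →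
      (fun t => ∫ y, u n (ω, t, y) * h y) =ᵐ[timeMeasure T] fun t => ∫ y, v n (ω, t, y) * h y := by
    intro n ω h hω
    filter_upwards [hω] with t ht
    refine integral_congr_ae ?_
    filter_upwards [ht] with y hy
    rw [hy]
  filter_upwards [hconv.2 _ hg2.re, hconv.2 _ hg2.im, huv'] with ω h1 h2 h3
  have hFω : ∀ n, StronglyMeasurable fun t => F n (ω, t) := fun n =>
    (hFm n).comp_measurable (by fun_prop)
  have hbound : ∀ n, eLpNorm (fun t => F n (ω, t)) 2 (timeMeasure T) ≤
      eLpNorm (fun t => ∫ y, u n (ω, t, y) * RCLike.re (g y)) 2 (timeMeasure T) +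
      eLpNorm (fun t => ∫ y, u n (ω, t, y) * RCLike.im (g y)) 2 (timeMeasure T) := by
    intro n
    rw [eLpNorm_congr_ae (hslice n ω (h3 n)), eLpNorm_congr_ae (hslice n ω (h3 n))]
    have r1 : (fun t => ∫ y, v n (ω, t, y) * RCLike.re (g y)) = fun t => (F n (ω, t)).re :=
      funext fun t => (hre n (ω, t)).symm
    have r2 : (fun t => ∫ y, v n (ω, t, y) * RCLike.im (g y)) = fun t => (F n (ω, t)).im :=
      funext fun t => (him n (ω, t)).symm
    rw [r1, r2]
    have m1 : AEStronglyMeasurable (fun t => (F n (ω, t)).re) (timeMeasure T) :=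
      (Complex.continuous_re.comp_stronglyMeasurable (hFω n)).aestronglyMeasurable
    have m2 : AEStronglyMeasurable (fun t => (F n (ω, t)).im) (timeMeasure T) :=
      (Complex.continuous_im.comp_stronglyMeasurable (hFω n)).aestronglyMeasurable
    rw [← eLpNorm_norm (fun t => (F n (ω, t)).re), ← eLpNorm_norm (fun t => (F n (ω, t)).im)]
    refine le_trans (eLpNorm_mono (g := (fun t => ‖(F n (ω, t)).re‖) + fun t => ‖(F n (ω, t)).im‖)
      fun t => ?_) (eLpNorm_add_le m1.norm m2.norm (by norm_num))
    refine (Complex.norm_le_abs_re_add_abs_im _).trans (le_of_eq ?_)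
    exact (Real.norm_of_nonneg (add_nonneg (abs_nonneg _) (abs_nonneg _))).symm
  have hsum := h1.add h2
  rw [add_zero] at hsum
  have hlim := tendsto_of_tendsto_of_tendsto_of_le_of_le tendsto_const_nhds hsum
    (fun n => zero_le) hbound
  have hsq := ENNReal.Tendsto.pow hlim (n := 2)
  simp only [eLpNorm_two_sq] at hsq
  simpa using hsq

/-- The bound in `L²` with respect to `l` passes to regular representatives. -/
theorem Regular.sliceBounded (hv : Regular K M v) {u : Ω × ℝ × Euc d × Euc m → ℝ}
    (huv : u =ᵐ[fullMeasure P T d m] v) {C : ℝ≥0}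
    (hC : ∀ᵐ w ∂(P.prod ((timeMeasure T).prod (volume : Measure (Euc d)))),
      eLpNorm (fun l : Euc m => u (w.1, w.2.1, w.2.2, l)) 2 volume ≤ C) :
    SliceBounded (P.prod (timeMeasure T)) K C (lift v) := by
  refine ⟨stronglyMeasurable_lift hv.meas, hv.lift_eq_zero, ?_⟩
  have q1 := (measurePreserving_prodAssoc P (timeMeasure T)
    (volume : Measure (Euc d))).quasiMeasurePreserving.ae hC
  have q2 : ∀ᵐ w : (Ω × ℝ) × Euc d ∂((P.prod (timeMeasure T)).prod volume),
      ∀ᵐ l : Euc m, u (w.1.1, w.1.2, w.2, l) = v (w.1.1, w.1.2, w.2, l) := by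
    have a1 := measurePreserving_prodAssoc P (timeMeasure T) (volume : Measure (Euc d × Euc m))
    have a2 := measurePreserving_prodAssoc (P.prod (timeMeasure T)) (volume : Measure (Euc d))
      (volume : Measure (Euc m))
    exact Measure.ae_ae_of_ae_prod ((a1.comp a2).quasiMeasurePreserving.ae huv)
  filter_upwards [q1, q2] with w hw1 hw2
  have h3 : eLpNorm (fun l : Euc m => u (w.1.1, w.1.2, w.2, l)) 2 volume ≤ C := hw1
  rw [eLpNorm_congr_ae hw2] at h3
  have h4 := pow_le_pow_left' h3 2
  rw [eLpNorm_two_sq] at h4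
  refine (le_of_eq (lintegral_congr fun l => ?_)).trans h4
  simp [lift, enorm_eq_nnnorm]

end Regularization

/-! ### Exhaustion by balls in `l`. -/

section Exhaustion

/-- Each algebraic law involves finitely many elements of `p`, and a single index `j` serves them
all. -/
theorem isTrilinear_of_eventually {X Y Z : Type*} [AddCommGroup X] [Module ℂ X] [AddCommGroup Y]
    [Module ℂ Y] [AddCommGroup Z] [Module ℂ Z] {p : Submodule ℂ Y} {f : X → p → Z → ℂ}
    {g : ℕ → X → Y → Z → ℂ} (hg : ∀ j, IsTrilinear (g j))
    (h : ∀ y : p, ∃ j₀, ∀ j ≥ j₀, ∀ x z, f x y z = g j x y z) : IsTrilinear f := by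
  refine ⟨fun x x' y z => ?_, fun c x y z => ?_, fun x y y' z => ?_, fun c x y z => ?_,
    fun x y z z' => ?_, fun c x y z => ?_⟩
  · obtain ⟨j, hj⟩ := h y
    simp only [hj j le_rfl, (hg j).add₁]
  · obtain ⟨j, hj⟩ := h y
    simp only [hj j le_rfl, (hg j).smul₁]
  · obtain ⟨j, hj⟩ := h y
    obtain ⟨j', hj'⟩ := h y'
    obtain ⟨j'', hj''⟩ := h (y + y')
    set i := max j (max j' j'')
    rw [hj i (le_max_left _ _), hj' i ((le_max_left _ _).trans (le_max_right _ _)),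
      hj'' i ((le_max_right _ _).trans (le_max_right _ _)), Submodule.coe_add, (hg i).add₂]
  · obtain ⟨j, hj⟩ := h y
    obtain ⟨j', hj'⟩ := h (c • y)
    rw [hj (max j j') (le_max_left _ _), hj' (max j j') (le_max_right _ _), Submodule.coe_smul,
      (hg _).smul₂]
  · obtain ⟨j, hj⟩ := h y
    simp only [hj j le_rfl, (hg j).add₃]
  · obtain ⟨j, hj⟩ := h y
    simp only [hj j le_rfl, (hg j).smul₃]

theorem exists_closedBall_prod_of_isCompact {m : ℕ} {B : Set (Euc m × Euc m)} (hB : IsCompact B) :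
    ∃ j₀ : ℕ, ∀ j ≥ j₀, B ⊆ Metric.closedBall (0 : Euc m) j ×ˢ Metric.closedBall (0 : Euc m) j := by
  obtain ⟨r, hr⟩ := hB.isBounded.subset_closedBall 0
  obtain ⟨j₀, hj₀⟩ := exists_nat_ge r
  refine ⟨j₀, fun j hj y hy => ?_⟩
  have h1 := hr hy
  have h2 : (j₀ : ℝ) ≤ j := by exact_mod_cast hj
  rw [mem_closedBall_zero_iff, Prod.norm_def] at h1
  exact ⟨mem_closedBall_zero_iff.2 (((le_max_left _ _).trans h1).trans (hj₀.trans h2)),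
    mem_closedBall_zero_iff.2 (((le_max_right _ _).trans h1).trans (hj₀.trans h2))⟩

end Exhaustion

/-! ### Regularization of the test functions. -/

section TestFunctions

variable {d m : ℕ}

/-- Test functions of the representation formula can be replaced by strongly measurable, square
integrable ones that vanish outside a compact set of the variable `l`. -/
theorem exists_regular_testFunction {K : Set (Euc d)} (hK : IsCompact K) {r : ℝ≥0∞} (hr : 2 ≤ r)
    {φ₁ φ₂ : Euc d × Euc m → ℂ} (h₁ : MemLp φ₁ r volume) {Λ₁ : Set (Euc m)} (hΛ₁ : IsCompact Λ₁)
    (hv₁ : ∀ᵐ y : Euc d × Euc m, y.2 ∉ Λ₁ → φ₁ y = 0) (h₂ : HasCompactSupport φ₂) :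
    ∃ Λ : Set (Euc m), IsCompact Λ ∧ (∀ x l, l ∉ Λ → φ₂ (x, l) = 0) ∧
      ∃ f₁ : Euc d × Euc m → ℂ, StronglyMeasurable f₁ ∧ MemLp f₁ 2 volume ∧
        (∀ x l, l ∉ Λ → f₁ (x, l) = 0) ∧ (∀ᵐ y : Euc d × Euc m, y.1 ∈ K → φ₁ y = f₁ y) ∧
        mulConj (extendBy Λ f₁) φ₂ =ᵐ[volume]
          fun z => φ₁ (z.1, z.2.1) * (starRingEnd ℂ) (φ₂ (z.1, z.2.2)) := by
  -- `Λ` has to hold the `l` supports of both functions. `K'` contains `K`, so that the integrand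
  -- does not change, and the `x` support of `φ₂`, so that the product `Φ` does not change. On the
  -- compact `K' ×ˢ Λ` the exponent drops from `r` to `2`.
  set Λ := Λ₁ ∪ Prod.snd '' tsupport φ₂
  set K' := K ∪ Prod.fst '' tsupport φ₂
  have hΛ : IsCompact Λ := hΛ₁.union (h₂.isCompact.image continuous_snd)
  have hK' : IsCompact K' := hK.union (h₂.isCompact.image continuous_fst)
  have hE : MeasurableSet (K' ×ˢ Λ) := hK'.measurableSet.prod hΛ.measurableSet
  have hsupp : ∀ x l, φ₂ (x, l) ≠ 0 → x ∈ K' ∧ l ∈ Λ := fun x l h =>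
    have h' : (x, l) ∈ tsupport φ₂ := subset_tsupport _ h
    ⟨Or.inr ⟨_, h', rfl⟩, Or.inr ⟨_, h', rfl⟩⟩
  have hf : ∀ᵐ y : Euc d × Euc m, y.1 ∈ K' →
      φ₁ y = (K' ×ˢ Λ).indicator (h₁.1.mk φ₁) y := by
    filter_upwards [hv₁, h₁.1.ae_eq_mk] with y hy hy' hyK
    by_cases hyΛ : y.2 ∈ Λ
    · rw [indicator_of_mem (show y ∈ K' ×ˢ Λ from ⟨hyK, hyΛ⟩), hy']
    · rw [indicator_of_notMem fun h => hyΛ h.2, hy fun h => hyΛ (Or.inl h)]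
  refine ⟨Λ, hΛ, fun x l hl => by_contra fun h => hl (hsupp x l h).2,
    (K' ×ˢ Λ).indicator (h₁.1.mk φ₁), h₁.1.stronglyMeasurable_mk.indicator hE, ?_, fun x l hl => ?_,
    ?_, ?_⟩
  · have : IsFiniteMeasure ((volume : Measure (Euc d × Euc m)).restrict (K' ×ˢ Λ)) :=
      ⟨by simpa using (hK'.prod hΛ).measure_lt_top⟩
    rw [memLp_indicator_iff_restrict hE]
    exact ((h₁.ae_eq h₁.1.ae_eq_mk).restrict _).mono_exponent hr
  · exact indicator_of_notMem (fun h => hl h.2) _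
  · filter_upwards [hf] with y hy hyK using hy (Or.inl hyK)
  · have q := (Measure.quasiMeasurePreserving_fst.comp
      (measurePreserving_prodAssoc (volume : Measure (Euc d)) (volume : Measure (Euc m))
        (volume : Measure (Euc m))).symm.quasiMeasurePreserving).ae hf
    filter_upwards [q] with z hz
    by_cases h : φ₂ (z.1, z.2.2) = 0
    · simp [mulConj, h]
    · obtain ⟨hx, hl⟩ := hsupp _ _ h
      have hz' : φ₁ (z.1, z.2.1) = (K' ×ˢ Λ).indicator (h₁.1.mk φ₁) (z.1, z.2.1) := hz hx
      simp [mulConj, extendBy, hl, hz']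

theorem ae_fullMeasure_of_ae {Ω : Type*} [MeasurableSpace Ω] {P : Measure Ω}
    [IsProbabilityMeasure P] {T : ℝ} {p : Euc d × Euc m → Prop} (h : ∀ᵐ y, p y) :
    ∀ᵐ z ∂(fullMeasure P T d m), p z.2.2 :=
  ((Measure.quasiMeasurePreserving_snd (μ := timeMeasure T)
    (ν := (volume : Measure (Euc d × Euc m)))).comp
    (Measure.quasiMeasurePreserving_snd (μ := P)
      (ν := (timeMeasure T).prod (volume : Measure (Euc d × Euc m))))).ae h

end TestFunctions

/-! ### Separability of the function spaces. -/

section Separability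

instance separableSpace_L1 : TopologicalSpace.SeparableSpace L1 :=
  have : Fact ((1 : ℝ≥0∞) ≠ ∞) := ⟨by simp⟩
  inferInstance

instance separableSpace_L2 (d m : ℕ) : TopologicalSpace.SeparableSpace (L2 d m) :=
  have : Fact ((2 : ℝ≥0∞) ≠ ∞) := ⟨by simp⟩
  have : IsSeparable (volume : Measure (Euc d × Euc m × Euc m)) := isSeparable_of_sigmaFinite _
  inferInstance

end Separability

/-! ### Construction of the functional. -/

section Construction

variable {Ω : Type*} [MeasurableSpace Ω] {P : Measure Ω} [IsProbabilityMeasure P] {T : ℝ}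
  {d m : ℕ} {K : Set (Euc d)} {M : ℝ≥0} {v : Ω × ℝ × Euc d × Euc m → ℝ}

variable (P T) in
/-- The localized form of a function of `(ω, t, x, l)`. -/
def probForm (v : Ω × ℝ × Euc d × Euc m → ℝ) (φ : L1) (Φ : L2 d m) (ψ : C(Sph d, ℂ)) : ℂ :=
  locForm (P.prod (timeMeasure T)) timeChar (lift v) φ Φ ψ

variable (P T) in
/-- The localized form of the restriction to `l` in the ball of radius `j`. -/
def ballForm (j : ℕ) (v : Ω × ℝ × Euc d × Euc m → ℝ) (φ : L1) (Φ : L2 d m) (ψ : C(Sph d, ℂ)) : ℂ :=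
  locForm (P.prod (timeMeasure T)) timeChar (cut (Metric.closedBall 0 j) (lift v)) φ Φ ψ

variable (P T) in
theorem exists_isBoundedTrilinear_ballForm (hK : IsCompact K) (M : ℝ≥0) (j : ℕ) :
    ∃ C : ℝ, ∀ v : Ω × ℝ × Euc d × Euc m → ℝ, Regular K M v →
      IsBoundedTrilinear (ballForm P T j v) C :=
  ⟨_, fun _ hv => isBoundedTrilinear_locForm hK
    (sliceBounded_cut (stronglyMeasurable_lift hv.meas) hv.norm_lift_le hv.lift_eq_zero
      (isCompact_closedBall (0 : Euc m) j)) stronglyMeasurable_timeChar norm_timeChar_le⟩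

variable (P T) in
theorem probForm_eq_ballForm {j : ℕ} {B : Set (Euc m × Euc m)}
    (hj : B ⊆ Metric.closedBall (0 : Euc m) j ×ˢ Metric.closedBall (0 : Euc m) j) {Φ : L2 d m}
    (hΦ : VanishesOff B Φ) (v : Ω × ℝ × Euc d × Euc m → ℝ) (φ : L1) (ψ : C(Sph d, ℂ)) :
    probForm P T v φ Φ ψ = ballForm P T j v φ Φ ψ :=
  locForm_cut _ ψ (by filter_upwards [hΦ] with y hy h using hy fun h' => h (hj h'))

theorem vanishesOff_of_mulConj {Λ : Set (Euc m)} {f₁ f₂ : Euc d × Euc m → ℂ}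
    (h₁ : ∀ x l, l ∉ Λ → f₁ (x, l) = 0) (h₂ : ∀ x l, l ∉ Λ → f₂ (x, l) = 0) {Φ : L2 d m}
    (hΦ : Φ =ᵐ[volume] mulConj (extendBy Λ f₁) f₂) : VanishesOff (Λ ×ˢ Λ) Φ := by
  filter_upwards [hΦ] with y hy h
  rw [hy]
  by_cases hp : y.2.1 ∈ Λ
  · simp [mulConj, h₂ y.1 y.2.2 fun hq => h ⟨hp, hq⟩]
  · simp [mulConj, extendBy, h₁ y.1 y.2.1 hp]

/-- The difference between the quadratic expressions and the localized forms tends to `0`. -/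
theorem tendsto_integral_sub_probForm {u v : ℕ → Ω × ℝ × Euc d × Euc m → ℝ}
    (hconv : TendstoZeroStrongWeak P T u) (hv : ∀ n, Regular K M (v n))
    (huv : ∀ n, u n =ᵐ[fullMeasure P T d m] v n) (hK : IsCompact K) (φ : L1)
    {φ₁ φ₂ : Euc d × Euc m → ℂ} (ψ : C(Sph d, ℂ)) {r : ℝ≥0∞} (hr : 2 ≤ r)
    (h₁ : MemLp φ₁ r volume) {Λ₁ : Set (Euc m)} (hΛ₁ : IsCompact Λ₁)
    (hv₁ : ∀ᵐ y : Euc d × Euc m, y.2 ∉ Λ₁ → φ₁ y = 0) (hc₂ : Continuous φ₂)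
    (h₂ : HasCompactSupport φ₂) :
    (∀ n, Integrable (fun w : Ω × Euc m × Euc m × ℝ × Euc d =>
      integrand T φ φ₁ φ₂ ψ (u n) w.1 w.2) (P.prod volume)) ∧
    ∃ Φ : L2c d m, ((Φ : L2 d m) =ᵐ[volume]
        fun z => φ₁ (z.1, z.2.1) * (starRingEnd ℂ) (φ₂ (z.1, z.2.2))) ∧
      Tendsto (fun n => (∫ ω, (∫ z, integrand T φ φ₁ φ₂ ψ (u n) ω z) ∂P) -
        probForm P T (v n) φ (Φ : L2 d m) ψ) atTop (𝓝 0) := by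
  obtain ⟨Λ, hΛ, hz₂, f₁, hf₁, hf₁2, hz₁, hKf, hΦeq⟩ :=
    exists_regular_testFunction hK hr h₁ hΛ₁ hv₁ h₂
  obtain ⟨c', hc'⟩ := hc₂.bounded_above_of_compact_support h₂
  have hc : ∀ y, ‖φ₂ y‖ ≤ c'.toNNReal := fun y => (hc' y).trans (Real.le_coe_toNNReal c')
  have hφ : Integrable φ := L1.integrable_coeFn φ
  have hφ₂ : StronglyMeasurable φ₂ := hc₂.stronglyMeasurable
  have hext := stronglyMeasurable_extendBy hΛ hf₁
  have hext2 := memLp_extendBy hΛ hf₁2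
  have hmem := memLp_mulConj hext hext2 hφ₂ hc
  have hae : ∀ n, ∀ᵐ w : Ω × Euc m × Euc m × ℝ × Euc d ∂(P.prod volume),
      integrand T φ φ₁ φ₂ ψ (u n) w.1 w.2 = integrand T φ f₁ φ₂ ψ (v n) w.1 w.2 := fun n => by
    refine ae_integrand_eq φ ψ ?_ ?_
    · filter_upwards [huv n, ae_fullMeasure_of_ae (P := P) (T := T) hKf] with z hz hz'
      by_cases hx : z.2.2.1 ∈ K
      · rw [hz, hz' hx]
      · rw [hz, (hv n).supp z hx]
        simp
    · filter_upwards [huv n] with z hz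
      rw [hz]
  have hint := fun n => (hv n).integral_integrand (P := P) (T := T) hK hΛ hφ hf₁ hf₁2 hz₁ hφ₂ hc
    hz₂ ψ
  set Φ₀ : L2 d m := hmem.toLp _
  have hΦ₀ : Φ₀ =ᵐ[volume] mulConj (extendBy Λ f₁) φ₂ := hmem.coeFn_toLp
  have hoff : VanishesOff (Λ ×ˢ Λ) Φ₀ := vanishesOff_of_mulConj hz₁ hz₂ hΦ₀
  refine ⟨fun n => (integrable_congr (hae n)).2 (hint n).1,
    ⟨Φ₀, Λ ×ˢ Λ, hΛ.prod hΛ, hoff⟩, hΦ₀.trans hΦeq, ?_⟩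
  -- The commutator lemma with multiplier `φ₂`, applied to `f₁(x, p) 1_Λ(q)`: the cross form is the
  -- expectation of the integrand, and multiplication by the conjugate of `φ₂(x, q)` produces `Φ`.
  have hcomm := tendsto_commForm (v := fun n => cut Λ (lift (v n))) (θ := timeChar) hK
    (fun n => sliceBounded_cut (σ := P.prod (timeMeasure T)) (stronglyMeasurable_lift (hv n).meas)
      (hv n).norm_lift_le (hv n).lift_eq_zero hΛ) hΛ (fun n s x l hl => cut_of_notMem (by exact hl))
    (cutBound_lt_top (M := M) hK hΛ) (fun n s => (hv n).lintegral_cut_le hK hΛ s)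
    (tendsto_lintegral_of_strongWeak hconv hv huv hK hΛ) stronglyMeasurable_timeChar
    norm_timeChar_le hφ hext hext2 hc₂ hc ψ
  refine hcomm.congr fun n => ?_
  rw [commForm, ← (hint n).2, probForm, locForm_cut (Λ := Λ) _ ψ hoff,
    locForm_congr ψ (ae_eq_refl _) hΦ₀]
  congr 1
  refine integral_congr_ae ?_
  filter_upwards [Measure.ae_ae_of_ae_prod (hae n)] with ω hω
  exact (integral_congr_ae hω).symm

end Construction

end HMeas

end

/-! ### The main theorem. -/

theorem theorem3p2 {Ω : Type*} [MeasurableSpace Ω] (P : Measure Ω) [IsProbabilityMeasure P]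
    (d m : ℕ) (T : ℝ) (hT : 0 < T)
    (u : ℕ → Ω × ℝ × HMeas.Euc d × HMeas.Euc m → ℝ)
    (hmeas : ∀ n, AEStronglyMeasurable (u n) (HMeas.fullMeasure P T d m))
    (hbdd : ∃ M : ℝ, ∀ n, ∀ᵐ z ∂(HMeas.fullMeasure P T d m), |u n z| ≤ M)
    (hconv : HMeas.TendstoZeroStrongWeak P T u)
    (K : Set (HMeas.Euc d)) (hK : IsCompact K)
    (hsupp : ∀ n, ∀ᵐ z ∂(HMeas.fullMeasure P T d m), z.2.2.1 ∉ K → u n z = 0) :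
    ∃ k : ℕ → ℕ, StrictMono k ∧
    ∃ μ : HMeas.L1 →ₗ[ℂ] HMeas.L2c d m →ₗ[ℂ] C(HMeas.Sph d, ℂ) →ₗ[ℂ] ℂ,
      -- continuity
      (∀ B : Set (HMeas.Euc m × HMeas.Euc m), IsCompact B →
        ∃ C : ℝ, ∀ (φ : HMeas.L1) (Φ : HMeas.L2c d m) (ψ : C(HMeas.Sph d, ℂ)),
          HMeas.VanishesOff B (Φ : HMeas.L2 d m) →
            ‖μ φ Φ ψ‖ ≤ C * ‖φ‖ * ‖(Φ : HMeas.L2 d m)‖ * ‖ψ‖) ∧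
      -- representation of the limits
      (∀ (φ : HMeas.L1) (r : ℝ≥0∞) (φ₁ φ₂ : HMeas.Euc d × HMeas.Euc m → ℂ)
          (ψ : C(HMeas.Sph d, ℂ)),
        2 < r → MemLp φ₁ r volume →
        (∃ Λ : Set (HMeas.Euc m), IsCompact Λ ∧
          ∀ᵐ y : HMeas.Euc d × HMeas.Euc m, y.2 ∉ Λ → φ₁ y = 0) →
        Continuous φ₂ → HasCompactSupport φ₂ →
        ContMDiff (𝓡 d) 𝓘(ℝ, ℂ) (d : ℕ∞) ψ →
        (∀ n, Integrable (fun w : Ω × HMeas.Euc m × HMeas.Euc m × ℝ × HMeas.Euc d =>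
            HMeas.integrand T φ φ₁ φ₂ ψ (u n) w.1 w.2) (P.prod volume)) ∧
        ∃ Φ : HMeas.L2c d m,
          ((Φ : HMeas.L2 d m) =ᵐ[volume]
            fun z => φ₁ (z.1, z.2.1) * (starRingEnd ℂ) (φ₂ (z.1, z.2.2))) ∧
          Tendsto (fun n => ∫ ω, (∫ z : HMeas.Euc m × HMeas.Euc m × ℝ × HMeas.Euc d,
              HMeas.integrand T φ φ₁ φ₂ ψ (u (k n)) ω z) ∂P)
            atTop (𝓝 (μ φ Φ ψ))) ∧
      -- global extension
      ((∃ C : ℝ≥0, ∀ n, ∀ᵐ w ∂(P.prod ((HMeas.timeMeasure T).prod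
            (volume : Measure (HMeas.Euc d)))),
          eLpNorm (fun l : HMeas.Euc m => u n (w.1, w.2.1, w.2.2, l)) 2 volume ≤ C) →
        ∃ μ' : HMeas.L1 →ₗ[ℂ] HMeas.L2 d m →ₗ[ℂ] C(HMeas.Sph d, ℂ) →ₗ[ℂ] ℂ,
          (∃ C : ℝ, ∀ (φ : HMeas.L1) (Φ : HMeas.L2 d m) (ψ : C(HMeas.Sph d, ℂ)),
            ‖μ' φ Φ ψ‖ ≤ C * ‖φ‖ * ‖Φ‖ * ‖ψ‖) ∧
          ∀ (φ : HMeas.L1) (Φ : HMeas.L2c d m) (ψ : C(HMeas.Sph d, ℂ)),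
            μ' φ (Φ : HMeas.L2 d m) ψ = μ φ Φ ψ) := by
  obtain ⟨M, hM⟩ := hbdd
  choose v hv huv using fun n => HMeas.exists_regular (hmeas n) (hM n) hK (hsupp n)
  choose C hC using HMeas.exists_isBoundedTrilinear_ballForm P T (m := m) hK M.toNNReal
  obtain ⟨k, hk, hlim⟩ := HMeas.exists_subseq_tendsto_trilinear
    (f := fun n j => HMeas.ballForm P T j (v n)) (fun n j => hC j (v n) (hv n))
  have hg := fun j => HMeas.isBoundedTrilinear_ulim fun n => hC j (v (k n)) (hv (k n))
  have heq : ∀ {B : Set (HMeas.Euc m × HMeas.Euc m)}, IsCompact B → ∃ j₀ : ℕ, ∀ j ≥ j₀,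
      ∀ Φ : HMeas.L2 d m, HMeas.VanishesOff B Φ → ∀ w φ ψ,
        HMeas.probForm P T w φ Φ ψ = HMeas.ballForm P T j w φ Φ ψ := fun hB =>
    let ⟨j₀, hj₀⟩ := HMeas.exists_closedBall_prod_of_isCompact hB
    ⟨j₀, fun j hj _ hΦ w φ ψ => HMeas.probForm_eq_ballForm P T (hj₀ j hj) hΦ w φ ψ⟩
  -- The functional is the ultralimit of the forms without cutoff in `l`. These need not be bounded
  -- on all of `L²`, but each `Φ` in `L2c` is seen by all large balls, where trilinearity and bounds
  -- are known.
  have htri : HMeas.IsTrilinear fun (φ : HMeas.L1) (Φ : HMeas.L2c d m) (ψ : C(HMeas.Sph d, ℂ)) =>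
      HMeas.ulim fun n => HMeas.probForm P T (v (k n)) φ (Φ : HMeas.L2 d m) ψ := by
    refine HMeas.isTrilinear_of_eventually (fun j => (hg j).toIsTrilinear) fun Φ => ?_
    obtain ⟨B, hB, hΦ⟩ := Φ.2
    obtain ⟨j₀, hj₀⟩ := heq hB
    exact ⟨j₀, fun j hj φ ψ => by simp only [hj₀ j hj _ hΦ]⟩
  refine ⟨k, hk, htri.toLin, fun B hB => ?_, fun φ r φ₁ φ₂ ψ hr h₁ hΛ hc₂ h₂ _ => ?_, ?_⟩
  · obtain ⟨j, hj⟩ := heq hB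
    refine ⟨C j, fun φ Φ ψ hΦ => ?_⟩
    rw [HMeas.IsTrilinear.toLin_apply]
    simp only [hj j le_rfl _ hΦ]
    exact (hg j).bound φ Φ ψ
  · obtain ⟨Λ, hΛ, hv₁⟩ := hΛ
    obtain ⟨hint, Φ, hΦ, ht⟩ :=
      HMeas.tendsto_integral_sub_probForm hconv hv huv hK φ ψ hr.le h₁ hΛ hv₁ hc₂ h₂
    refine ⟨hint, Φ, hΦ, ?_⟩
    obtain ⟨B, hB, hoff⟩ := Φ.2
    obtain ⟨j, hj⟩ := heq hB
    -- Along the subsequence the ball form has an ordinary limit, which the ultralimit must equal;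
    -- the commutator error tends to `0`.
    obtain ⟨l, hl⟩ := hlim j φ Φ ψ
    simp only [← hj j le_rfl _ hoff] at hl
    rw [HMeas.IsTrilinear.toLin_apply, HMeas.ulim_eq_of_tendsto hl]
    simpa using (ht.comp hk.tendsto_atTop).add hl
  · rintro ⟨c, hc⟩
    -- Under the additional bound no cutoff is needed. The extension is the ultralimit of the same
    -- sequence that defines `μ`, hence agrees with it on `L2c` by definition.
    have hb := HMeas.isBoundedTrilinear_ulim fun n => HMeas.isBoundedTrilinear_locForm hK
      ((hv (k n)).sliceBounded (huv (k n)) (hc (k n))) HMeas.stronglyMeasurable_timeChar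
      HMeas.norm_timeChar_le
    exact ⟨hb.toIsTrilinear.toLin, ⟨_, hb.bound⟩, fun φ Φ ψ => rfl⟩
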